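/- Let $\mathcal A$ be a finite collection of nonzero, pairwise non-collinear vectors $\alpha\in\mathbb R^N$ with multiplicities $m_\alpha\in\mathbb Z_{\ge 0}$; put $(x,y)=\sum_j x_jy_j$, $x^2=(x,x)$ for $x,y\in\mathbb C^N$, $\partial_\alpha=(\alpha,\partial/\partial x)$, $|m|=\sum_\alpha m_\alpha$ and $A_m(x)=\prod_{\alpha\in\mathcal A}(\alpha,x)^{m_\alpha}$. Let $\mathcal Q_{\mathcal A}\subset\mathbb C[x_1,\dots,x_N]$ be the space of quasi-invariants, i.e. of the polynomials $q$ such that $\partial_\alpha^{2s-1}q=0$ on the hyperplane $(\alpha,x)=0$ for all $\alpha\in\mathcal A$ and $s=1,\dots,m_\alpha$. Assume that $\mathcal A$ admits a Baker--Akhiezer function, i.e. a function $\phi(x,\lambda)=P(x,\lambda)e^{(x,\lambda)}$ of $x,\lambda\in\mathbb C^N$, continuous in $\lambda$, with $P(x,\lambda)$ a polynomial in $x$ of degree at most $|m|$ whose homogeneous component of degree $|m|$ in $x$ is $A_m(x)A_m(\lambda)$, such that $\partial_\alpha^{2s-1}\phi(x,\lambda)=0$ for $(\alpha,x)=0$,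 for all $\alpha\in\mathcal A$ and $s=1,\dots,m_\alpha$ (derivatives in $x$). Assume moreover that $\phi(0,0)\neq0$. For $q\in\mathcal Q_{\mathcal A}$ let $L_q$ be the differential operator, with rational coefficients regular where $A_m\ne0$, such that $L_q\phi(x,\lambda)=q(\lambda)\phi(x,\lambda)$, where $L_q$ acts in $x$. Let $\langle f,q\rangle_m=\phi(0,0)^{-1}(L_qf)(0)$, where the value at $0$ is that of the continuous extension from $A_m\neq0$, and set $$H_q(x)=\langle F(x,\cdot),q\rangle_m,\qquad F(x,\lambda)=\phi(x,\lambda)e^{-\lambda^2/2}.$$ Let $$\mathcal L^{\mathcal H}=L-E=\Delta-\sum_{\alpha\in\mathcal A}\frac{2m_\alpha}{(\alpha,x)}\partial_\alpha-\sum_{j=1}^N x_j\partial_j .$$ Then $H_q$ is well defined for every $q\in\mathcal Q_{\mathcal A}$ and $q\mapsto H_q$ is a linear map $\mathcal Q_{\mathcal A}\to\mathcal Q_{\mathcal A}$. If $q\in\mathcal Q_{\mathcal A}$ is homogeneous of degree $d$, then $$\mathcal L^{\mathcal H}H_q=-d\,H_q,$$ and $H_q\ne0$ if $q\neq0$. Consequently,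 for every basis $(q_i)$ of $\mathcal Q_{\mathcal A}$ consisting of homogeneous polynomials, the polynomials $H_{q_i}$ form a basis of $\mathcal Q_{\mathcal A}$ consisting of eigenfunctions of $\mathcal L^{\mathcal H}$, with eigenvalues $-\deg q_i$. -/

import Mathlib

open MvPolynomial Filter Topology

noncomputable section

/-- A finite collection of nonzero, pairwise non-collinear vectors `α ∈ ℝ^N` with
multiplicities `m_α ∈ ℕ`. -/
structure HyperplaneConfig (N : ℕ) where
  /-- the index set of the collection -/
  ι : Type
  [fin : Fintype ι]
  /-- the vectors `α` -/
  vec : ι → Fin N → ℝ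
  /-- the multiplicities `m_α` -/
  mult : ι → ℕ
  vec_ne_zero : ∀ i, vec i ≠ 0
  noncollinear : ∀ i j, i ≠ j → LinearIndependent ℝ ![vec i, vec j]

attribute [instance] HyperplaneConfig.fin

/-- The derivative `∂_v f = (v, ∂/∂x) f` of a function on `ℂ^N`. -/
def dirDeriv {N : ℕ} (v : Fin N → ℂ) (f : (Fin N → ℂ) → ℂ) : (Fin N → ℂ) → ℂ :=
  fun x => lineDeriv ℂ f x v

/-- The partial derivative `∂_j f`. -/
def partialDeriv {N : ℕ} (j : Fin N) (f : (Fin N → ℂ) → ℂ) : (Fin N → ℂ) → ℂ :=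
  dirDeriv (Pi.single j 1) f

/-- The iterated partial derivative `∂^ν f = ∂_1^{ν_1} ⋯ ∂_N^{ν_N} f`. -/
def multiDeriv {N : ℕ} (ν : Fin N →₀ ℕ) (f : (Fin N → ℂ) → ℂ) : (Fin N → ℂ) → ℂ :=
  (List.finRange N).foldr (fun j g => (partialDeriv j)^[ν j] g) f

/-- The derivation `(v, ∂/∂x)` on polynomials. -/
def polyDirDeriv {N : ℕ} (v : Fin N → ℂ) : Module.End ℂ (MvPolynomial (Fin N) ℂ) :=
  ∑ j, v j • (pderiv j : Derivation ℂ (MvPolynomial (Fin N) ℂ) (MvPolynomial (Fin N) ℂ)).toLinearMap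

/-- Data of a linear differential operator `∑_ν a_ν(x) ∂^ν` in `N` variables whose coefficients are
rational functions with poles at most on the hyperplanes of a configuration: `num ν` is the
numerator of `a_ν`, and the common denominator is the power `pole` of the polynomial `A_m`. -/
structure DiffOp (N : ℕ) where
  num : (Fin N →₀ ℕ) →₀ MvPolynomial (Fin N) ℂ
  pole : ℕ

namespace HyperplaneConfig

variable {N : ℕ} (A : HyperplaneConfig N)

/-- The vector `α` regarded as an element of `ℂ^N`. -/
def cvec (i : A.ι) : Fin N → ℂ := fun j => (A.vec i j : ℂ)

/-- `|m| = ∑ m_α`. -/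
def totalMult : ℕ := ∑ i, A.mult i

/-- The polynomial `A_m(x) = ∏ (x, α)^{m_α}`. -/
def poly : MvPolynomial (Fin N) ℂ :=
  ∏ i, (∑ j, C (A.cvec i j) * X j) ^ A.mult i

/-- The complement of the hyperplanes, `A_m(x) ≠ 0`. -/
def regular : Set (Fin N → ℂ) := {x | eval x A.poly ≠ 0}

/-- The space `Q_A` of quasi-invariants: the polynomials `q` with
`∂_α q = ∂_α^3 q = ⋯ = ∂_α^{2m_α-1} q = 0` on `(α, x) = 0` for all `α`. -/
def quasiInvariants : Submodule ℂ (MvPolynomial (Fin N) ℂ) where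
  carrier := {q | ∀ i, ∀ s < A.mult i, ∀ x : Fin N → ℂ, A.cvec i ⬝ᵥ x = 0 →
    eval x ((polyDirDeriv (A.cvec i) ^ (2 * s + 1)) q) = 0}
  add_mem' := by
    intro p q hp hq i s hs x hx
    rw [map_add, map_add, hp i s hs x hx, hq i s hs x hx, add_zero]
  zero_mem' := by
    intro i s hs x hx
    rw [map_zero, map_zero]
  smul_mem' := by
    intro c q hq i s hs x hx
    rw [map_smul, smul_eval, hq i s hs x hx, mul_zero]

/-- The function `φ(x, λ)` on `ℂ^N × ℂ^N` is a rational Baker-Akhiezer function of `A`.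
For each `λ`, `P(x, λ)` is a polynomial in `x` of degree at most `|m|` whose component of degree
`|m|` is `A_m(x) A_m(λ)`. Continuity in `λ` pins down the values of `φ` on `A_m(λ) = 0`, where
the other two conditions alone leave them arbitrary. -/
structure IsBakerAkhiezer (φ : (Fin N → ℂ) → (Fin N → ℂ) → ℂ) : Prop where
  form : ∃ P : (Fin N → ℂ) → MvPolynomial (Fin N) ℂ,
    (∀ l, (P l).totalDegree ≤ A.totalMult) ∧
    (∀ l, homogeneousComponent A.totalMult (P l) = C (eval l A.poly) * A.poly) ∧
    ∀ x l, φ x l = eval x (P l) * Complex.exp (x ⬝ᵥ l)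
  continuous : ∀ x, Continuous (φ x)
  vanishing : ∀ l, ∀ i, ∀ s < A.mult i, ∀ x : Fin N → ℂ, A.cvec i ⬝ᵥ x = 0 →
    (dirDeriv (A.cvec i))^[2 * s + 1] (fun y => φ y l) x = 0

/-- The action on functions of the operator `D = ∑_ν a_ν(x) ∂^ν` with coefficients
`a_ν = num ν / A_m ^ pole` (meaningful where `A_m(x) ≠ 0`). -/
def applyOp (D : DiffOp N) (f : (Fin N → ℂ) → ℂ) : (Fin N → ℂ) → ℂ :=
  fun x => (D.num.sum fun ν a => eval x a * multiDeriv ν f x) / eval x A.poly ^ D.pole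

/-- `D` is the differential operator `L_q` attached to `q`: acting in the variable `x`,
`L_q φ(x, λ) = q(λ) φ(x, λ)`. -/
def IsQuantumIntegral (φ : (Fin N → ℂ) → (Fin N → ℂ) → ℂ) (q : MvPolynomial (Fin N) ℂ)
    (D : DiffOp N) : Prop :=
  ∀ l, ∀ x ∈ A.regular, A.applyOp D (fun y => φ y l) x = eval l q * φ x l

/-- `⟨f, q⟩_m = c`, where `⟨f, q⟩_m = φ(0,0)⁻¹ (L_q f)(0)` is the (symmetric) normalised bilinear
form on quasi-invariants, in which `f` may also be a quasi-invariant power series.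
As `L_q` has poles along the hyperplanes, the value of `L_q f` at the origin is the one of its
continuous extension. -/
def IsPairing (φ : (Fin N → ℂ) → (Fin N → ℂ) → ℂ) (f : (Fin N → ℂ) → ℂ)
    (q : MvPolynomial (Fin N) ℂ) (c : ℂ) : Prop :=
  ∃ D : DiffOp N, A.IsQuantumIntegral φ q D ∧
    Tendsto (fun l => (φ 0 0)⁻¹ * A.applyOp D f l) (𝓝[A.regular] 0) (𝓝 c)

/-- `h` is the function `H_q(x) = ⟨F(x, ·), q⟩_m`, where `F(x, λ) = φ(x, λ) exp(-λ²/2)`. -/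
def IsHermite (φ : (Fin N → ℂ) → (Fin N → ℂ) → ℂ) (q : MvPolynomial (Fin N) ℂ)
    (h : (Fin N → ℂ) → ℂ) : Prop :=
  ∀ x, A.IsPairing φ (fun l => φ x l * Complex.exp (-(l ⬝ᵥ l) / 2)) q (h x)

/-- The Calogero-Moser operator `L = Δ - ∑ 2 m_α / (α, x) ∂_α`. -/
def cmOp (f : (Fin N → ℂ) → ℂ) : (Fin N → ℂ) → ℂ := fun x =>
  ∑ j, partialDeriv j (partialDeriv j f) x
    - ∑ i, 2 * (A.mult i : ℂ) / (A.cvec i ⬝ᵥ x) * dirDeriv (A.cvec i) f x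

/-- The harmonic Calogero-Moser operator `L - E`, with `E = ∑ x_j ∂_j` the Euler operator. -/
def harmonicCmOp (f : (Fin N → ℂ) → ℂ) : (Fin N → ℂ) → ℂ := fun x =>
  A.cmOp f x - ∑ j, x j * partialDeriv j f x

/-- `H` satisfies `(L - E) H = c H` (an identity of rational functions). -/
def IsEigen (c : ℂ) (H : MvPolynomial (Fin N) ℂ) : Prop :=
  ∀ x ∈ A.regular, A.harmonicCmOp (fun y => eval y H) x = c * eval x H

end HyperplaneConfig

end

noncomputable section

namespace MvPolynomial

/-! The heart of the matter is the formula `H_q = exp(-L/2) q`, with `L` the Calogero-Moser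
operator. It follows from three properties of `φ`: the symmetry `φ(x, λ) = φ(λ, x)`, the equation
`L_x φ = λ² φ`, and `φ(x, 0) = φ(0, 0)`. By symmetry `L_q` may act in `λ`, with `L_q φ = q(x) φ`.
Since it commutes with `L_x`, one gets `L_q (λ^{2k} φ) = L_x^k (q(x) φ)`, which at `λ = 0` is `φ(0,
0) L^k q`. Expanding the Gaussian gives the formula (`IsBAPoly.tendsto_applyOp`). As `L` lowers
degrees by two, the series is finite and unitriangular, hence bijective (`expNegLinear_bijective`);
and `[E, L] = -2L` yields `(L - E) exp(-L/2) = -exp(-L/2) E`, which is the eigenvalue equation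
(`cmPoly_expNegLinear`).

The properties of `φ` come from uniqueness. If `R(x, λ) e^{(x, λ)}` is quasi-invariant in `x`, the
leading component of `R` in `x` is divisible by `A_m(x)` (`pow_dvd_wc_of_dvd_twist`,
`prod_linForm_dvd_wc`), so `R = 0` when its degree is below `|m|` (`eq_zero_of_mem_quasiX`).
Cramer's rule and continuity in `λ` make `φ` a polynomial in both variables times the exponential
(`exists_polynomial`). Uniqueness then gives `φ(tx, λ) = φ(x, tλ)` (`IsBAPoly.weight_eq`) and `L_λ φ
= x² φ` (`IsBAPoly.cmL_eq`). A second uniqueness statement, for solutions of this last equation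
(`eq_zero_of_cmL`), gives the equation in `x` and the symmetry (`IsBAPoly.cmX_eq`,
`IsBAPoly.swapVars_eq`).

Finally, up to a power of `A_m(λ)`, every quasi-invariant multiple of the exponential is a
differential operator in `λ` applied to `φ` (`IsBAPoly.exists_opL`). This provides the operators
`L_q` and shows that `L` preserves quasi-invariants (`IsBAPoly.exists_cmX_eq`). Exponentials are
removed throughout by conjugation, which turns derivatives into twisted derivations of polynomials.
-/

lemma aeval_eq_eval_apply {σ : Type*} (x : σ → ℂ) (p : MvPolynomial σ ℂ) :
    aeval x p = eval x p := by
  rw [← coe_aeval_eq_eval]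
  rfl

/-! ### Filtration of polynomials by weighted degree. -/

section WeightedDegree

variable {σ : Type*}

/-- The polynomials all of whose monomials have `w`-weight less than `d`. -/
def degLT (w : σ → ℕ) (d : ℕ) : Submodule ℂ (MvPolynomial σ ℂ) where
  carrier := {p | ∀ m, coeff m p ≠ 0 → Finsupp.weight w m < d}
  add_mem' := by
    intro p q hp hq m hm
    by_cases h : coeff m p = 0
    · refine hq m fun h' => hm ?_
      rw [coeff_add, h, h', add_zero]
    · exact hp m h
  zero_mem' := by
    intro m hm
    simp at hm
  smul_mem' := by
    intro c p hp m hm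
    refine hp m fun h => hm ?_
    rw [coeff_smul, h, smul_zero]

variable {w : σ → ℕ} {d e k : ℕ} {p u : MvPolynomial σ ℂ}

lemma degLT_mono (h : d ≤ e) (hp : p ∈ degLT w d) : p ∈ degLT w e :=
  fun m hm => (hp m hm).trans_le h

lemma eq_zero_of_mem_degLT_zero (hp : p ∈ degLT w 0) : p = 0 := by
  ext m
  by_contra h
  exact absurd (hp m h) (Nat.not_lt_zero _)

lemma exists_mem_degLT (w : σ → ℕ) (p : MvPolynomial σ ℂ) : ∃ d, p ∈ degLT w d := by
  refine ⟨p.support.sup (Finsupp.weight w) + 1, fun m hm => Nat.lt_succ_of_le ?_⟩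
  exact Finset.le_sup (f := Finsupp.weight w) (mem_support_iff.2 hm)

lemma IsWeightedHomogeneous.mem_degLT (hp : IsWeightedHomogeneous w p d) :
    p ∈ degLT w (d + 1) := fun m hm => by rw [hp hm]; exact Nat.lt_succ_self d

lemma IsWeightedHomogeneous.mul_mem_degLT (hu : IsWeightedHomogeneous w u e)
    (hp : p ∈ degLT w d) : u * p ∈ degLT w (e + d) := by
  classical
  intro m hm
  rw [coeff_mul] at hm
  obtain ⟨⟨a, b⟩, hab, h⟩ := Finset.exists_ne_zero_of_sum_ne_zero hm
  replace hab : a + b = m := Finset.HasAntidiagonal.mem_antidiagonal.1 hab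
  have h1 : Finsupp.weight w a = e := hu (left_ne_zero_of_mul h)
  have h2 : Finsupp.weight w b < d := hp b (right_ne_zero_of_mul h)
  rw [← hab, map_add]
  omega

lemma pderiv_mem_degLT (i : σ) (hp : p ∈ degLT w (d + w i)) : pderiv i p ∈ degLT w d := by
  classical
  intro m hm
  rw [coeff_pderiv] at hm
  have h := hp _ (left_ne_zero_of_mul hm)
  rw [map_add, Finsupp.weight_single, one_smul] at h
  omega

lemma wc_eq_zero_of_mem_degLT (hp : p ∈ degLT w d) (h : d ≤ k) :
    weightedHomogeneousComponent w k p = 0 := by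
  classical
  ext m
  rw [coeff_weightedHomogeneousComponent, coeff_zero]
  split_ifs with hm
  · by_contra hne
    have := hp m hne
    omega
  · rfl

lemma mem_degLT_iff_wc : p ∈ degLT w d ↔ ∀ k, d ≤ k → weightedHomogeneousComponent w k p = 0 := by
  classical
  refine ⟨fun hp k hk => wc_eq_zero_of_mem_degLT hp hk, fun h m hm => ?_⟩
  by_contra hlt
  have := congrArg (coeff m) (h _ (not_lt.1 hlt))
  rw [coeff_weightedHomogeneousComponent, if_pos rfl, coeff_zero] at this
  exact hm this

lemma sub_wc_mem_degLT (hp : p ∈ degLT w (d + 1)) :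
    p - weightedHomogeneousComponent w d p ∈ degLT w d := by
  classical
  intro m hm
  rw [coeff_sub, coeff_weightedHomogeneousComponent] at hm
  split_ifs at hm with h
  · simp at hm
  · have := hp m (by simpa using hm)
    omega

lemma mem_degLT_of_wc_eq_zero (hp : p ∈ degLT w (d + 1))
    (h : weightedHomogeneousComponent w d p = 0) : p ∈ degLT w d := by
  simpa [h] using sub_wc_mem_degLT hp

lemma IsWeightedHomogeneous.wc_mul (hu : IsWeightedHomogeneous w u e) (k : ℕ)
    (p : MvPolynomial σ ℂ) :
    weightedHomogeneousComponent w (e + k) (u * p) = u * weightedHomogeneousComponent w k p := by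
  classical
  ext m
  rw [coeff_weightedHomogeneousComponent, coeff_mul, coeff_mul]
  split_ifs with h
  · refine Finset.sum_congr rfl fun ab hab => ?_
    replace hab : ab.1 + ab.2 = m := Finset.HasAntidiagonal.mem_antidiagonal.1 hab
    by_cases hne : coeff ab.1 u = 0
    · rw [hne, zero_mul, zero_mul]
    have h1 := hu hne
    rw [← hab, map_add] at h
    rw [coeff_weightedHomogeneousComponent, if_pos (by omega)]
  · refine (Finset.sum_eq_zero fun ab hab => ?_).symm
    replace hab : ab.1 + ab.2 = m := Finset.HasAntidiagonal.mem_antidiagonal.1 hab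
    by_cases hne : coeff ab.1 u = 0
    · rw [hne, zero_mul]
    have h1 := hu hne
    rw [← hab, map_add] at h
    rw [coeff_weightedHomogeneousComponent, if_neg (by omega), mul_zero]

/-- Each component of `u * p` is `u` times a component of `p`, and the polynomial ring is a domain.
-/
lemma IsWeightedHomogeneous.mem_degLT_of_mul_mem (hu : IsWeightedHomogeneous w u e) (hu0 : u ≠ 0)
    (h : u * p ∈ degLT w (e + d)) : p ∈ degLT w d := by
  rw [mem_degLT_iff_wc] at h ⊢
  intro k hk
  have := h (e + k) (by omega)
  rw [hu.wc_mul] at this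
  exact (mul_eq_zero.1 this).resolve_left hu0

end WeightedDegree

/-! ### Linear forms: divisibility, primality, vanishing on hyperplanes. -/

section LinearForm

variable {σ : Type*} [Fintype σ]

/-- The linear form with coefficient vector `c`. -/
def linForm (c : σ → ℂ) : MvPolynomial σ ℂ := ∑ i, C (c i) * X i

variable (c u : σ → ℂ)

lemma eval_linForm (x : σ → ℂ) : eval x (linForm c) = c ⬝ᵥ x := by
  simp [linForm, dotProduct]

/-- Substitution of the projection onto the hyperplane of `linForm c` along `u`. -/
def hyperplaneProj : MvPolynomial σ ℂ →ₐ[ℂ] MvPolynomial σ ℂ :=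
  aeval fun i => X i - C (u i) * linForm c

lemma linForm_dvd_sub_hyperplaneProj (p : MvPolynomial σ ℂ) :
    linForm c ∣ p - hyperplaneProj c u p := by
  induction p using MvPolynomial.induction_on with
  | C a => simp [hyperplaneProj, algebraMap_eq]
  | add p q hp hq =>
    rw [map_add, add_sub_add_comm]
    exact dvd_add hp hq
  | mul_X p i hp =>
    have : p * X i - hyperplaneProj c u (p * X i) =
        (p - hyperplaneProj c u p) * X i
          + hyperplaneProj c u p * (C (u i) * linForm c) := by
      rw [map_mul]
      simp only [hyperplaneProj, aeval_X]
      ring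
    rw [this]
    exact dvd_add (hp.mul_right _) ((dvd_mul_left _ _).mul_left _)

variable {c u}

lemma hyperplaneProj_linForm (hu : c ⬝ᵥ u = 1) : hyperplaneProj c u (linForm c) = 0 := by
  have h : hyperplaneProj c u (linForm c) = linForm c - C (c ⬝ᵥ u) * linForm c := by
    conv_lhs => rw [linForm]
    rw [map_sum]
    simp only [map_mul, hyperplaneProj, aeval_X, algHom_C, algebraMap_eq, mul_sub,
      Finset.sum_sub_distrib]
    congr 1
    rw [dotProduct, map_sum, Finset.sum_mul]
    exact Finset.sum_congr rfl fun i _ => by rw [C_mul]; ring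
  rw [h, hu, C_1, one_mul, sub_self]

/-- The substitution kills the form itself and changes `p` only by a multiple of the form. Its
values lie in a domain, so this criterion also yields primality. -/
lemma linForm_dvd_iff (hu : c ⬝ᵥ u = 1) (p : MvPolynomial σ ℂ) :
    linForm c ∣ p ↔ hyperplaneProj c u p = 0 := by
  constructor
  · rintro ⟨q, rfl⟩
    rw [map_mul, hyperplaneProj_linForm hu, zero_mul]
  · intro h
    simpa [h] using linForm_dvd_sub_hyperplaneProj c u p

lemma exists_dotProduct_eq_one (hc : c ≠ 0) : ∃ u : σ → ℂ, c ⬝ᵥ u = 1 := by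
  classical
  obtain ⟨i, hi⟩ := Function.ne_iff.1 hc
  exact ⟨Pi.single i (c i)⁻¹, by rw [dotProduct_single]; exact mul_inv_cancel₀ hi⟩

lemma linForm_ne_zero (hc : c ≠ 0) : linForm c ≠ 0 := by
  obtain ⟨u, hu⟩ := exists_dotProduct_eq_one hc
  intro h
  have := eval_linForm c u
  rw [h, hu] at this
  simp at this

lemma prime_linForm (hc : c ≠ 0) : Prime (linForm c) := by
  obtain ⟨u, hu⟩ := exists_dotProduct_eq_one hc
  refine ⟨linForm_ne_zero hc, fun h => ?_, fun a b hab => ?_⟩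
  · have := (h.map (hyperplaneProj c u))
    rw [hyperplaneProj_linForm hu] at this
    exact not_isUnit_zero this
  · rw [linForm_dvd_iff hu] at hab ⊢
    rw [linForm_dvd_iff hu]
    rwa [map_mul, mul_eq_zero] at hab

lemma linForm_dvd_of_eval_eq_zero (hc : c ≠ 0) {p : MvPolynomial σ ℂ}
    (h : ∀ x, c ⬝ᵥ x = 0 → eval x p = 0) : linForm c ∣ p := by
  obtain ⟨u, hu⟩ := exists_dotProduct_eq_one hc
  rw [linForm_dvd_iff hu]
  refine MvPolynomial.funext fun x => ?_
  rw [map_zero, hyperplaneProj, ← aeval_eq_eval_apply, ← AlgHom.comp_apply, comp_aeval,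
    aeval_eq_eval_apply]
  have hx : (fun i => aeval x (X i - C (u i) * linForm c)) = x - (c ⬝ᵥ x) • u := by
    funext i
    rw [aeval_eq_eval_apply]
    simp only [map_sub, map_mul, eval_X, eval_C, eval_linForm, Pi.sub_apply, Pi.smul_apply,
      smul_eq_mul]
    ring
  rw [hx]
  apply h
  rw [dotProduct_sub, dotProduct_smul, hu, smul_eq_mul, mul_one, sub_self]

end LinearForm

lemma prod_pow_dvd_of_prime {ι R : Type*} [CommRing R] [IsDomain R] (s : Finset ι)
    (ℓ : ι → R) (m : ι → ℕ) (hp : ∀ i, Prime (ℓ i)) (hij : ∀ i j, i ≠ j → ¬ ℓ i ∣ ℓ j)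
    {T : R} (h : ∀ i ∈ s, ℓ i ^ m i ∣ T) : ∏ i ∈ s, ℓ i ^ m i ∣ T := by
  classical
  induction s using Finset.induction_on generalizing T with
  | empty => simp
  | insert a s ha ih =>
    rw [Finset.prod_insert ha]
    obtain ⟨T', rfl⟩ := h a (Finset.mem_insert_self a s)
    refine mul_dvd_mul_left _ (ih fun i hi => ?_)
    refine (hp i).pow_dvd_of_dvd_mul_left _ (fun hd => ?_) (h i (Finset.mem_insert_of_mem hi))
    exact hij i a (fun hia => ha (hia ▸ hi)) ((hp i).dvd_of_dvd_pow hd)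

lemma eq_zero_of_eval_eq_zero_of_ne {σ : Type*} {p a : MvPolynomial σ ℂ} (ha : a ≠ 0)
    (h : ∀ x, eval x a ≠ 0 → eval x p = 0) : p = 0 := by
  have : a * p = 0 := by
    refine MvPolynomial.funext fun x => ?_
    rw [map_mul, map_zero, mul_eq_zero]
    by_cases hx : eval x a = 0
    · exact Or.inl hx
    · exact Or.inr (h x hx)
  exact (mul_eq_zero.1 this).resolve_left ha

/-! ### Density of non-vanishing sets and continuous quotients of polynomials. -/

section Density

variable {σ : Type*} [Finite σ]

/-- A polynomial that vanishes on a product of discs is zero, since every disc is infinite. -/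
lemma dense_eval_ne_zero {p : MvPolynomial σ ℂ} (hp : p ≠ 0) :
    Dense {x : σ → ℂ | eval x p ≠ 0} := by
  have := Fintype.ofFinite σ
  intro y
  rw [Metric.mem_closure_iff]
  intro ε hε
  by_contra! hcon
  refine hp (funext_set (fun i => Metric.ball (y i) ε) (fun i => ?_) fun x hx => ?_)
  · exact (IsPreconnected.infinite_of_nontrivial (convex_ball (y i) ε).isPreconnected
      ⟨y i, Metric.mem_ball_self hε, y i + (ε / 2 : ℝ), by
        simp [abs_of_pos hε, hε], by simp [hε.ne']⟩)
  · by_contra hne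
    rw [map_zero] at hne
    have h1 := hcon x hne
    have h2 : dist y x < ε := (dist_pi_lt_iff hε).2 fun i => by
      rw [dist_comm]
      exact hx i trivial
    exact absurd h2 (not_lt.2 h1)

/-- A continuous function which is a quotient of polynomials is a polynomial. -/
lemma dvd_of_continuous_quotient {D : MvPolynomial σ ℂ} (hD : D ≠ 0) {n : MvPolynomial σ ℂ}
    {f : (σ → ℂ) → ℂ} (hf : Continuous f) (h : ∀ x, eval x D * f x = eval x n) : D ∣ n := by
  induction D using WfDvdMonoid.induction_on_irreducible generalizing n with
  | zero => exact absurd rfl hD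
  | unit u hu => exact hu.dvd
  | mul a π ha hπ ih =>
    have hprime : Prime π := hπ.prime
    have : (Ideal.span {π}).IsPrime := (Ideal.span_singleton_prime hprime.ne_zero).2 hprime
    -- Where `π` vanishes so does `D * f`, that is `n`; the Nullstellensatz for the prime ideal
    -- `(π)` turns this into divisibility.
    have hn : π ∣ n := by
      rw [← Ideal.mem_span_singleton,
        ← IsPrime.vanishingIdeal_zeroLocus (K := ℂ) (Ideal.span {π})]
      intro x hx
      have hx' := hx π (Ideal.mem_span_singleton_self π)
      rw [aeval_eq_eval_apply] at hx' ⊢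
      have := h x
      rw [map_mul] at this
      rw [hx'] at this
      rw [← this]; ring
    obtain ⟨n', rfl⟩ := hn
    refine mul_dvd_mul_left _ (ih ha ?_)
    -- The factor `π` cancels only off its zero set; continuity of `f` restores the identity at
    -- every point.
    have hdense := dense_eval_ne_zero hprime.ne_zero
    refine fun x => congrFun (Continuous.ext_on hdense
      ((MvPolynomial.continuous_eval a).mul hf) (MvPolynomial.continuous_eval n') fun x hx => ?_) x
    have := h x
    rw [map_mul, map_mul, mul_assoc] at this
    exact mul_left_cancel₀ hx this

end Density

end MvPolynomial

namespace MvPolynomial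

/-! ### Derivations conjugated by an exponential. -/

section Twisted

variable {B : Type*} [CommRing B] [Algebra ℂ B]

/-- The derivation `δ` twisted by the multiplication by `a`: the conjugate of `δ` by an
exponential whose logarithmic derivative is `a`. -/
def twist (δ : Derivation ℂ B B) (a : B) : Module.End ℂ B :=
  δ.toLinearMap + LinearMap.mulLeft ℂ a

variable (δ : Derivation ℂ B B) (a : B)

lemma twist_apply (p : B) : twist δ a p = δ p + a * p := rfl

lemma twist_mul (p q : B) : twist δ a (p * q) = δ p * q + p * twist δ a q := by
  simp only [twist_apply, Derivation.leibniz, smul_eq_mul]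
  ring

/-- The Leibniz expansion stops after two terms, because `δ` annihilates `δ ℓ`. -/
lemma twist_pow_mul_of_isConst {ℓ c : B} (hℓ : δ ℓ = c) (hc : δ c = 0) (n : ℕ) (p : B) :
    (twist δ a ^ (n + 1)) (ℓ * p) =
      ℓ * (twist δ a ^ (n + 1)) p + ((n : B) + 1) * (c * (twist δ a ^ n) p) := by
  induction n with
  | zero => simp [twist_mul, hℓ]; ring
  | succ n ih =>
    rw [pow_succ', Module.End.mul_apply, ih, map_add, twist_mul, hℓ, ← Module.End.mul_apply,
      ← pow_succ', twist_mul, twist_mul, hc]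
    have h1 : δ ((n : B) + 1) = 0 := by
      rw [map_add, Derivation.map_natCast, Derivation.map_one_eq_zero, add_zero]
    rw [h1, ← Module.End.mul_apply (twist δ a) (twist δ a ^ n), ← pow_succ']
    push_cast
    ring

lemma twist_pow_mul_mem (q p : B) (n : ℕ) :
    (twist δ a ^ n) (q * p) ∈ AddSubmonoid.closure
      {r | ∃ i j, i + j = n ∧ r = (δ.toLinearMap ^ i) q * (twist δ a ^ j) p} := by
  induction n with
  | zero => exact AddSubmonoid.subset_closure ⟨0, 0, rfl, by simp⟩
  | succ n ih =>
    rw [pow_succ', Module.End.mul_apply]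
    generalize (twist δ a ^ n) (q * p) = y at ih
    induction ih using AddSubmonoid.closure_induction with
    | mem r hr =>
      obtain ⟨i, j, hij, rfl⟩ := hr
      rw [twist_mul]
      refine add_mem (AddSubmonoid.subset_closure ⟨i + 1, j, by omega, ?_⟩)
        (AddSubmonoid.subset_closure ⟨i, j + 1, by omega, ?_⟩)
      · rw [pow_succ', Module.End.mul_apply]; rfl
      · rw [pow_succ' _ j, Module.End.mul_apply]
    | zero => rw [map_zero]; exact zero_mem _
    | add r s _ _ hr hs => rw [map_add]; exact add_mem hr hs

/-- Vanishing modulo `ℓ` of the odd derivatives of order less than `2 m` is stable under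
products. -/
lemma dvd_twist_pow_mul {ℓ q p : B} {m : ℕ}
    (hq : ∀ s < m, ℓ ∣ (δ.toLinearMap ^ (2 * s + 1)) q)
    (hp : ∀ s < m, ℓ ∣ (twist δ a ^ (2 * s + 1)) p) (s : ℕ) (hs : s < m) :
    ℓ ∣ (twist δ a ^ (2 * s + 1)) (q * p) := by
  have h := twist_pow_mul_mem δ a q p (2 * s + 1)
  generalize (twist δ a ^ (2 * s + 1)) (q * p) = y at h
  induction h using AddSubmonoid.closure_induction with
  | mem r hr =>
    obtain ⟨i, j, hij, rfl⟩ := hr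
    -- The total order is odd, so exactly one of `i`, `j` is odd, and the corresponding factor is
    -- divisible by `ℓ`.
    rcases Nat.even_or_odd' i with ⟨k, rfl | rfl⟩
    · obtain ⟨t, rfl⟩ : ∃ t, j = 2 * t + 1 := ⟨s - k, by omega⟩
      exact (hp t (by omega)).mul_left _
    · exact (hq k (by omega)).mul_right _
  | zero => exact dvd_zero _
  | add r s _ _ hr hs => exact dvd_add hr hs

end Twisted

/-! ### Directional derivatives and leading components. -/

section DirectionalDerivation

variable {σ : Type*}

/-- The polynomial `p` along the line `t ↦ x + t v`. -/
def alongLine (x v : σ → ℂ) : MvPolynomial σ ℂ →ₐ[ℂ] Polynomial ℂ :=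
  aeval fun i => Polynomial.C (x i) + Polynomial.C (v i) * Polynomial.X

lemma eval_alongLine (x v : σ → ℂ) (t : ℂ) (p : MvPolynomial σ ℂ) :
    (alongLine x v p).eval t = eval (x + t • v) p := by
  rw [← aeval_eq_eval_apply, alongLine, ← Polynomial.coe_aeval_eq_eval,
    ← AlgHom.comp_apply (Polynomial.aeval t : Polynomial ℂ →ₐ[ℂ] ℂ), comp_aeval]
  congr 2
  funext i
  simp only [map_add, map_mul, Polynomial.aeval_C, Polynomial.aeval_X, Pi.add_apply, Pi.smul_apply,
    smul_eq_mul, Algebra.algebraMap_self, RingHom.id_apply]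
  ring

variable [Fintype σ]

/-- The derivation `(v, ∂/∂x)`. -/
def dirD (v : σ → ℂ) : Derivation ℂ (MvPolynomial σ ℂ) (MvPolynomial σ ℂ) :=
  ∑ i, v i • pderiv i

lemma dirD_apply (v : σ → ℂ) (p : MvPolynomial σ ℂ) : dirD v p = ∑ i, v i • pderiv i p := by
  have h := map_sum (Derivation.coeFnAddMonoidHom (R := ℂ) (A := MvPolynomial σ ℂ)
    (M := MvPolynomial σ ℂ)) (fun i => v i • pderiv i) Finset.univ
  have h' := congrFun h p
  rw [Finset.sum_apply] at h'
  exact h'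

lemma dirD_X (v : σ → ℂ) (i : σ) : dirD v (X i) = C (v i) := by
  classical
  rw [dirD_apply, Finset.sum_eq_single i]
  · rw [pderiv_X_self, smul_eq_C_mul, mul_one]
  · intro j _ hj
    rw [pderiv_X_of_ne hj.symm, smul_zero]
  · simp

lemma dirD_C (v : σ → ℂ) (a : ℂ) : dirD v (C a : MvPolynomial σ ℂ) = 0 :=
  derivation_C _ _

lemma dirD_linForm (v c : σ → ℂ) : dirD v (linForm c) = C (c ⬝ᵥ v) := by
  simp only [linForm, map_sum, dotProduct]
  exact Finset.sum_congr rfl fun i _ => by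
    rw [Derivation.leibniz, dirD_X, dirD_C, smul_zero, add_zero, smul_eq_mul, C_mul]

lemma dirD_mem_degLT {w : σ → ℕ} {v : σ → ℂ} (hv : ∀ i, v i ≠ 0 → w i = 1) {d : ℕ}
    {p : MvPolynomial σ ℂ} (hp : p ∈ degLT w (d + 1)) : dirD v p ∈ degLT w d := by
  rw [dirD_apply]
  refine Submodule.sum_mem _ fun i _ => ?_
  by_cases h : v i = 0
  · rw [h, zero_smul]; exact zero_mem _
  · exact Submodule.smul_mem _ _ (pderiv_mem_degLT i (by rwa [hv i h]))

lemma isWeightedHomogeneous_linForm {w : σ → ℕ} {c : σ → ℂ} {d : ℕ}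
    (hc : ∀ i, c i ≠ 0 → w i = d) : IsWeightedHomogeneous w (linForm c) d := by
  refine IsWeightedHomogeneous.sum _ _ _ fun i _ => ?_
  by_cases h : c i = 0
  · rw [h, C_0, zero_mul]; exact isWeightedHomogeneous_zero _ _ _
  · have := isWeightedHomogeneous_X ℂ w i
    rw [hc i h] at this
    exact this.C_mul _

lemma derivative_alongLine (x v : σ → ℂ) (p : MvPolynomial σ ℂ) :
    Polynomial.derivative (alongLine x v p) = alongLine x v (dirD v p) := by
  induction p using MvPolynomial.induction_on with
  | C a =>
    rw [dirD_C, map_zero]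
    simp [alongLine]
  | add p q hp hq => rw [map_add, map_add, map_add, map_add, hp, hq]
  | mul_X p i hp =>
    rw [map_mul, Polynomial.derivative_mul, hp, Derivation.leibniz, dirD_X, smul_eq_mul,
      smul_eq_mul, map_add, map_mul, map_mul]
    have h : Polynomial.derivative (alongLine x v (X i)) = alongLine x v (C (v i)) := by
      simp [alongLine]
    rw [h]
    ring

/-- Odd-order vanishing of `(δ + a)ⁿ p` on the hyperplane `ℓ = 0` forces divisibility of
the top component of `p` by a power of `ℓ`. -/
lemma pow_dvd_wc_of_dvd_twist {w : σ → ℕ} {v c : σ → ℂ} {a : MvPolynomial σ ℂ}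
    (hv : ∀ i, v i ≠ 0 → w i = 1) (hcw : ∀ i, c i ≠ 0 → w i = 1) (hcv : c ⬝ᵥ v ≠ 0)
    (ha : IsWeightedHomogeneous w a 0) (hla : ¬ linForm c ∣ a) (m d : ℕ) (p : MvPolynomial σ ℂ)
    (hp : p ∈ degLT w (d + 1))
    (h : ∀ s < m, linForm c ∣ (twist (dirD v) a ^ (2 * s + 1)) p) :
    linForm c ^ m ∣ weightedHomogeneousComponent w d p := by
  have hc : c ≠ 0 := fun hc => hcv (by rw [hc, zero_dotProduct])
  have hℓ := isWeightedHomogeneous_linForm hcw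
  induction m generalizing d p with
  | zero => simp
  | succ m ih =>
    -- Write `(∂ + a) p = ℓ r`. The quotient `r` has lower degree and inherits `m` of the `m + 1`
    -- conditions, while `a` times the top component of `p` is `ℓ` times the component of `r` one
    -- degree below. Primality of `ℓ` then transfers the divisibility from `r` to `p`.
    obtain ⟨r, hr⟩ := h 0 (Nat.succ_pos m)
    rw [mul_zero, zero_add, pow_one] at hr
    have hr1 : linForm c * r ∈ degLT w (1 + d) := by
      rw [← hr, twist_apply, add_comm 1 d]
      refine add_mem (degLT_mono (Nat.le_succ d) (dirD_mem_degLT hv hp)) ?_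
      simpa using ha.mul_mem_degLT hp
    have hr2 : r ∈ degLT w d := hℓ.mem_degLT_of_mul_mem (linForm_ne_zero hc) hr1
    have hr3 : ∀ s < m, linForm c ∣ (twist (dirD v) a ^ (2 * s + 1)) r := by
      intro s hs
      have h1 := h (s + 1) (by omega)
      rw [show 2 * (s + 1) + 1 = (2 * s + 1 + 1) + 1 by ring, pow_succ _ (2 * s + 1 + 1),
        Module.End.mul_apply, hr,
        twist_pow_mul_of_isConst _ _ (dirD_linForm v c) (dirD_C _ _)] at h1
      have h2 := (dvd_add_right (dvd_mul_right _ _)).1 h1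
      have h3 : (((2 * s + 1 : ℕ) : MvPolynomial σ ℂ) + 1) * (C (c ⬝ᵥ v) *
          (twist (dirD v) a ^ (2 * s + 1)) r) =
          C (((2 * s + 1 : ℕ) + 1) * (c ⬝ᵥ v)) * (twist (dirD v) a ^ (2 * s + 1)) r := by
        rw [C_mul, C_add, C_1, ← C_eq_coe_nat]
        ring
      rw [h3] at h2
      have hu : IsUnit (C (((2 * s + 1 : ℕ) + 1) * (c ⬝ᵥ v)) : MvPolynomial σ ℂ) :=
        (IsUnit.mk0 _ (mul_ne_zero (Nat.cast_add_one_ne_zero _) hcv)).map C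
      exact (hu.dvd_mul_left).1 h2
    have hkey : a * weightedHomogeneousComponent w d p =
        weightedHomogeneousComponent w d (linForm c * r) := by
      rw [← hr, twist_apply, map_add,
        wc_eq_zero_of_mem_degLT (dirD_mem_degLT hv hp) le_rfl, zero_add]
      simpa using (ha.wc_mul d p).symm
    refine (prime_linForm hc).pow_dvd_of_dvd_mul_left _ hla ?_
    rw [hkey]
    cases d with
    | zero => rw [eq_zero_of_mem_degLT_zero hr2, mul_zero, map_zero]; exact dvd_zero _
    | succ d =>
      rw [add_comm d 1, hℓ.wc_mul, pow_succ']
      exact mul_dvd_mul_left _ (ih d r hr2 hr3)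

end DirectionalDerivation

end MvPolynomial

/-! ### Derivatives of a polynomial times an exponential. -/

section Analytic

variable {N : ℕ}

lemma polyDirDeriv_eq (v : Fin N → ℂ) : polyDirDeriv v = (dirD v).toLinearMap := by
  ext1 p
  refine LinearMap.ext fun r => ?_
  simp [polyDirDeriv, dirD_apply]

/-- The function `p(y) exp(g(y))`. -/
def expFun (g p : MvPolynomial (Fin N) ℂ) : (Fin N → ℂ) → ℂ :=
  fun y => eval y p * Complex.exp (eval y g)

/-- Restriction to the line `x + t v` reduces the claim to one variable, where conjugation by `exp
g` adds the logarithmic derivative. -/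
lemma dirDeriv_expFun (v : Fin N → ℂ) (g p : MvPolynomial (Fin N) ℂ) :
    dirDeriv v (expFun g p) = expFun g (twist (dirD v) (dirD v g) p) := by
  funext x
  have h : (fun t : ℂ => expFun g p (x + t • v)) = fun t =>
      (alongLine x v p).eval t * Complex.exp ((alongLine x v g).eval t) := by
    funext t
    rw [eval_alongLine, eval_alongLine, expFun]
  have hd := ((alongLine x v p).hasDerivAt 0).mul ((alongLine x v g).hasDerivAt 0).cexp
  rw [dirDeriv, lineDeriv, h]
  refine hd.deriv.trans ?_
  rw [derivative_alongLine, derivative_alongLine]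
  simp only [eval_alongLine, zero_smul, add_zero, expFun, twist_apply, map_add, map_mul]
  ring

lemma iterate_dirDeriv_expFun (v : Fin N → ℂ) (g p : MvPolynomial (Fin N) ℂ) (n : ℕ) :
    (dirDeriv v)^[n] (expFun g p) = expFun g ((twist (dirD v) (dirD v g) ^ n) p) := by
  induction n generalizing p with
  | zero => simp
  | succ n ih =>
    rw [Function.iterate_succ_apply, dirDeriv_expFun, ih, pow_succ, Module.End.mul_apply]

lemma dirDeriv_eval (v : Fin N → ℂ) (p : MvPolynomial (Fin N) ℂ) :
    dirDeriv v (fun y => eval y p) = fun y => eval y (dirD v p) := by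
  have h : ∀ q : MvPolynomial (Fin N) ℂ, expFun 0 q = fun y => eval y q := fun q => by
    funext y; simp [expFun]
  rw [← h, dirDeriv_expFun, h, map_zero]
  simp [twist_apply]

lemma dirD_single (j : Fin N) : dirD (Pi.single j (1 : ℂ)) = pderiv j := by
  refine derivation_ext fun i => ?_
  rw [dirD_X, pderiv_X]
  by_cases h : i = j
  · subst h; simp
  · simp [Pi.single_eq_of_ne h]

/-- The operator on polynomials which corresponds to `∂^ν` on functions `p(y) exp(g(y))`. -/
def twistMulti (g : MvPolynomial (Fin N) ℂ) (ν : Fin N →₀ ℕ) (p : MvPolynomial (Fin N) ℂ) :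
    MvPolynomial (Fin N) ℂ :=
  (List.finRange N).foldr (fun j r => (twist (pderiv j) (pderiv j g) ^ ν j) r) p

lemma multiDeriv_expFun (ν : Fin N →₀ ℕ) (g p : MvPolynomial (Fin N) ℂ) :
    multiDeriv ν (expFun g p) = expFun g (twistMulti g ν p) := by
  unfold multiDeriv twistMulti
  induction List.finRange N with
  | nil => rfl
  | cons j t ih =>
    rw [List.foldr_cons, List.foldr_cons, ih]
    unfold partialDeriv
    rw [iterate_dirDeriv_expFun, dirD_single]

end Analytic

/-! ### Divisibility by the product over all hyperplanes, and uniqueness. -/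

namespace MvPolynomial

variable {σ ι : Type*} [Fintype σ] [Fintype ι]

/-- The powers found for the separate hyperplanes multiply, the forms being pairwise non-associated
primes. A form of multiplicity zero contributes nothing, so `hla` is not needed for it. -/
lemma prod_linForm_dvd_wc {w : σ → ℕ} {v : ι → σ → ℂ} {m : ι → ℕ} {a : ι → MvPolynomial σ ℂ}
    (hvw : ∀ i j, v i j ≠ 0 → w j = 1) (hvv : ∀ i, v i ⬝ᵥ v i ≠ 0)
    (hij : ∀ i j, i ≠ j → ¬ linForm (v i) ∣ linForm (v j))
    (ha : ∀ i, IsWeightedHomogeneous w (a i) 0) (hla : ∀ i, m i ≠ 0 → ¬ linForm (v i) ∣ a i)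
    {d : ℕ} {p : MvPolynomial σ ℂ} (hp : p ∈ degLT w (d + 1))
    (h : ∀ i, ∀ s < m i, linForm (v i) ∣ (twist (dirD (v i)) (a i) ^ (2 * s + 1)) p) :
    ∏ i, linForm (v i) ^ m i ∣ weightedHomogeneousComponent w d p := by
  refine prod_pow_dvd_of_prime _ _ _ (fun i => prime_linForm ?_) hij fun i _ => ?_
  · intro h0
    exact hvv i (by rw [h0, zero_dotProduct])
  · by_cases hm : m i = 0
    · rw [hm, pow_zero]; exact one_dvd _
    · exact pow_dvd_wc_of_dvd_twist (hvw i) (hvw i) (hvv i) (ha i) (hla i hm) _ _ _ hp (h i)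

lemma isWeightedHomogeneous_prod_linForm {w : σ → ℕ} {v : ι → σ → ℂ} (m : ι → ℕ)
    (hvw : ∀ i j, v i j ≠ 0 → w j = 1) :
    IsWeightedHomogeneous w (∏ i, linForm (v i) ^ m i) (∑ i, m i) := by
  refine IsWeightedHomogeneous.prod _ _ _ fun i _ => ?_
  simpa using (isWeightedHomogeneous_linForm (hvw i)).pow (m i)

/-- A nonzero top component would be divisible by a product of degree `∑ i, m i`, which exceeds its
own degree. -/
lemma eq_zero_of_dvd_twist {w : σ → ℕ} {v : ι → σ → ℂ} {m : ι → ℕ} {a : ι → MvPolynomial σ ℂ}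
    (hvw : ∀ i j, v i j ≠ 0 → w j = 1) (hvv : ∀ i, v i ⬝ᵥ v i ≠ 0)
    (hij : ∀ i j, i ≠ j → ¬ linForm (v i) ∣ linForm (v j))
    (ha : ∀ i, IsWeightedHomogeneous w (a i) 0) (hla : ∀ i, m i ≠ 0 → ¬ linForm (v i) ∣ a i)
    {p : MvPolynomial σ ℂ} (hp : p ∈ degLT w (∑ i, m i))
    (h : ∀ i, ∀ s < m i, linForm (v i) ∣ (twist (dirD (v i)) (a i) ^ (2 * s + 1)) p) :
    p = 0 := by
  suffices hd : ∀ d ≤ ∑ i, m i, p ∈ degLT w d → p = 0 from hd _ le_rfl hp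
  intro d
  induction d with
  | zero => exact fun _ => eq_zero_of_mem_degLT_zero
  | succ d ih =>
    intro hdm hpd
    refine ih (by omega) (mem_degLT_of_wc_eq_zero hpd ?_)
    obtain ⟨r, hr⟩ := prod_linForm_dvd_wc hvw hvv hij ha hla hpd h
    have h1 : (∏ i, linForm (v i) ^ m i) * r ∈ degLT w (∑ i, m i + 0) := by
      rw [← hr]
      exact degLT_mono (by omega)
        (weightedHomogeneousComponent_isWeightedHomogeneous d p).mem_degLT
    have h2 := (isWeightedHomogeneous_prod_linForm m hvw).mem_degLT_of_mul_mem
      (Finset.prod_ne_zero_iff.2 fun i _ => pow_ne_zero _ (linForm_ne_zero fun h0 =>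
        hvv i (by rw [h0, zero_dotProduct]))) h1
    rw [hr, eq_zero_of_mem_degLT_zero h2, mul_zero]

end MvPolynomial

/-! ### Geometry of the configuration and uniqueness at a regular spectral parameter. -/

namespace HyperplaneConfig

variable {N : ℕ} (A : HyperplaneConfig N)

lemma poly_eq : A.poly = ∏ i, linForm (A.cvec i) ^ A.mult i := rfl

lemma cvec_dotProduct_self_ne_zero (i : A.ι) : A.cvec i ⬝ᵥ A.cvec i ≠ 0 := by
  have h : A.cvec i ⬝ᵥ A.cvec i = ((A.vec i ⬝ᵥ A.vec i : ℝ) : ℂ) := by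
    simp [dotProduct, cvec]
  rw [h]
  exact_mod_cast fun h0 => A.vec_ne_zero i (dotProduct_self_eq_zero.1 h0)

lemma cvec_ne_zero (i : A.ι) : A.cvec i ≠ 0 := fun h =>
  A.cvec_dotProduct_self_ne_zero i (by rw [h, zero_dotProduct])

/-- Some vector is orthogonal to `α_i` but not to `α_j`. -/
lemma exists_orthogonal {i j : A.ι} (hij : i ≠ j) :
    ∃ x : Fin N → ℂ, A.cvec i ⬝ᵥ x = 0 ∧ A.cvec j ⬝ᵥ x ≠ 0 := by
  have hi : A.vec i ⬝ᵥ A.vec i ≠ 0 := fun h0 => A.vec_ne_zero i (dotProduct_self_eq_zero.1 h0)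
  set k := A.vec i ⬝ᵥ A.vec j / A.vec i ⬝ᵥ A.vec i with hk
  -- Gram-Schmidt: `y` is the part of `α_j` orthogonal to `α_i`. If it were also orthogonal to
  -- `α_j`, it would vanish and the two vectors would be collinear.
  set y : Fin N → ℝ := A.vec j - k • A.vec i with hy
  have hc : ∀ i', A.cvec i' ⬝ᵥ (fun t => (y t : ℂ)) = ((A.vec i' ⬝ᵥ y : ℝ) : ℂ) := by
    intro i'
    simp [dotProduct, cvec]
  have h1 : A.vec i ⬝ᵥ y = 0 := by
    rw [hy, dotProduct_sub, dotProduct_smul, smul_eq_mul, hk, div_mul_cancel₀ _ hi, sub_self]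
  refine ⟨fun t => (y t : ℂ), by rw [hc, h1, Complex.ofReal_zero], ?_⟩
  rw [hc]
  intro h0
  have h2 : A.vec j ⬝ᵥ y = 0 := by exact_mod_cast h0
  have h3 : y ⬝ᵥ y = 0 := by
    nth_rewrite 1 [hy]
    rw [sub_dotProduct, smul_dotProduct, h1, h2]; simp
  have h4 : y = 0 := dotProduct_self_eq_zero.1 h3
  have h5 := LinearIndependent.pair_iff.1 (A.noncollinear i j hij) (-k) 1 (by
    rw [one_smul, ← h4, hy, neg_smul]; abel)
  exact one_ne_zero h5.2

lemma not_linForm_dvd {i j : A.ι} (hij : i ≠ j) :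
    ¬ linForm (A.cvec i) ∣ linForm (A.cvec j) := by
  rintro ⟨r, hr⟩
  obtain ⟨x, h1, h2⟩ := A.exists_orthogonal hij
  apply h2
  rw [← eval_linForm, hr, map_mul, eval_linForm, h1, zero_mul]

lemma poly_ne_zero : A.poly ≠ 0 :=
  Finset.prod_ne_zero_iff.2 fun i _ => pow_ne_zero _ (linForm_ne_zero (A.cvec_ne_zero i))

lemma isWeightedHomogeneous_poly : IsWeightedHomogeneous (1 : Fin N → ℕ) A.poly A.totalMult :=
  isWeightedHomogeneous_prod_linForm A.mult fun _ _ _ => rfl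

lemma cvec_dotProduct_ne_zero_of_regular {l : Fin N → ℂ} (hl : l ∈ A.regular) {i : A.ι}
    (hi : A.mult i ≠ 0) : A.cvec i ⬝ᵥ l ≠ 0 := by
  intro h
  apply hl
  rw [poly_eq, map_prod]
  exact Finset.prod_eq_zero (Finset.mem_univ i) (by rw [map_pow, eval_linForm, h, zero_pow hi])

lemma dense_regular : Dense A.regular := dense_eval_ne_zero A.poly_ne_zero

/-- The derivative `∂_α` conjugated by `exp (x, l)`. -/
def twistAt (l : Fin N → ℂ) (i : A.ι) : Module.End ℂ (MvPolynomial (Fin N) ℂ) :=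
  twist (dirD (A.cvec i)) (C (l ⬝ᵥ A.cvec i))

/-- Uniqueness of quasi-invariants `p(x) exp (x, l)` with `p` of small degree, for regular `l`. -/
lemma eq_zero_of_twistAt {l : Fin N → ℂ} (hl : l ∈ A.regular) {p : MvPolynomial (Fin N) ℂ}
    (hp : p ∈ degLT (1 : Fin N → ℕ) A.totalMult)
    (h : ∀ i, ∀ s < A.mult i, ∀ x, A.cvec i ⬝ᵥ x = 0 →
      eval x ((A.twistAt l i ^ (2 * s + 1)) p) = 0) : p = 0 := by
  refine eq_zero_of_dvd_twist (w := 1) (v := A.cvec) (m := A.mult)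
    (a := fun i => C (l ⬝ᵥ A.cvec i)) (fun _ _ _ => rfl) A.cvec_dotProduct_self_ne_zero
    (fun _ _ => A.not_linForm_dvd) (fun i => isWeightedHomogeneous_C _ _) (fun i hi hd => ?_) hp
    fun i s hs => linForm_dvd_of_eval_eq_zero (A.cvec_ne_zero i) (h i s hs)
  have h0 : l ⬝ᵥ A.cvec i ≠ 0 := by
    rw [dotProduct_comm]; exact A.cvec_dotProduct_ne_zero_of_regular hl hi
  exact (prime_linForm (A.cvec_ne_zero i)).not_isUnit
    (isUnit_of_dvd_unit hd ((IsUnit.mk0 _ h0).map C))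

/-! ### The quasi-invariance conditions as a linear system depending polynomially on `l`. -/

section Cramer

/-- The index set of the quasi-invariance conditions. -/
def CondIndex : Type :=
  {t : A.ι × ℕ × (Fin N → ℂ) // t.2.1 < A.mult t.1 ∧ A.cvec t.1 ⬝ᵥ t.2.2 = 0}

/-- The quasi-invariance conditions on `p(x) exp (x, l)`, as a linear map in `p`. -/
def condMap (l : Fin N → ℂ) : MvPolynomial (Fin N) ℂ →ₗ[ℂ] (A.CondIndex → ℂ) :=
  LinearMap.pi fun t => (aeval t.1.2.2).toLinearMap ∘ₗ (A.twistAt l t.1.1 ^ (2 * t.1.2.1 + 1))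

lemma condMap_apply (l : Fin N → ℂ) (p : MvPolynomial (Fin N) ℂ) (t : A.CondIndex) :
    A.condMap l p t = eval t.1.2.2 ((A.twistAt l t.1.1 ^ (2 * t.1.2.1 + 1)) p) :=
  aeval_eq_eval_apply _ _

lemma condMap_eq_zero_iff {l : Fin N → ℂ} {p : MvPolynomial (Fin N) ℂ} :
    A.condMap l p = 0 ↔ ∀ i, ∀ s < A.mult i, ∀ x, A.cvec i ⬝ᵥ x = 0 →
      eval x ((A.twistAt l i ^ (2 * s + 1)) p) = 0 := by
  constructor
  · intro h i s hs x hx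
    exact (A.condMap_apply l p ⟨(i, s, x), hs, hx⟩).symm.trans (congrFun h _)
  · intro h
    funext t
    rw [condMap_apply]
    exact h _ _ t.2.1 _ t.2.2

lemma twistAt_pow_apply (l : Fin N → ℂ) (i : A.ι) (n : ℕ) (p : MvPolynomial (Fin N) ℂ) :
    (A.twistAt l i ^ n) p = ∑ k ∈ Finset.range (n + 1), (l ⬝ᵥ A.cvec i) ^ k •
      ((n.choose k : ℂ) • ((dirD (A.cvec i)).toLinearMap ^ (n - k)) p) := by
  have h : A.twistAt l i = (l ⬝ᵥ A.cvec i) • (1 : Module.End ℂ (MvPolynomial (Fin N) ℂ))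
      + (dirD (A.cvec i)).toLinearMap := by
    refine LinearMap.ext fun q => ?_
    simp [twistAt, twist_apply, smul_eq_C_mul, add_comm]
  rw [h, Commute.add_pow ((Commute.one_left _).smul_left _)]
  rw [LinearMap.sum_apply]
  refine Finset.sum_congr rfl fun k _ => ?_
  rw [smul_pow, one_pow, Module.End.mul_apply, Module.End.mul_apply, LinearMap.smul_apply,
    Module.End.one_apply]
  congr 1
  rw [← map_natCast (algebraMap ℂ (Module.End ℂ (MvPolynomial (Fin N) ℂ))),
    Module.algebraMap_end_apply, map_smul]

/-- The conditions depend polynomially on `l`. -/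
lemma exists_eval_eq_condMap (θ : (A.CondIndex → ℂ) →ₗ[ℂ] ℂ) (p : MvPolynomial (Fin N) ℂ) :
    ∃ g : MvPolynomial (Fin N) ℂ, ∀ l, θ (A.condMap l p) = eval l g := by
  classical
  let U : A.ι → ℕ → A.CondIndex → ℂ := fun i k t =>
    if t.1.1 = i then ((2 * t.1.2.1 + 1).choose k : ℂ) *
      eval t.1.2.2 (((dirD (A.cvec i)).toLinearMap ^ (2 * t.1.2.1 + 1 - k)) p) else 0
  -- A common bound for the number `2s + 2` of terms in each condition; the extra terms carry
  -- vanishing binomial coefficients.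
  let K := 2 * A.totalMult + 2
  have hU : ∀ l, A.condMap l p =
      ∑ i, ∑ k ∈ Finset.range K, (l ⬝ᵥ A.cvec i) ^ k • U i k := by
    intro l
    funext t
    rw [condMap_apply, twistAt_pow_apply, map_sum, Finset.sum_apply,
      Finset.sum_eq_single t.1.1, Finset.sum_apply]
    · have hK : 2 * t.1.2.1 + 1 + 1 ≤ K := by
        have h1 := t.2.1
        have h2 : A.mult t.1.1 ≤ A.totalMult :=
          Finset.single_le_sum (fun _ _ => Nat.zero_le _) (Finset.mem_univ t.1.1)
        omega
      rw [← Finset.sum_subset (Finset.range_subset_range.2 hK)]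
      · refine Finset.sum_congr rfl fun k _ => ?_
        simp [U, smul_eval]
      · intro k _ hk
        rw [Finset.mem_range, not_lt] at hk
        simp [U, Nat.choose_eq_zero_of_lt (show 2 * t.1.2.1 + 1 < k by omega)]
    · intro i _ hi
      rw [Finset.sum_apply]
      refine Finset.sum_eq_zero fun k _ => ?_
      simp [U, hi.symm]
    · simp
  refine ⟨∑ i, ∑ k ∈ Finset.range K, linForm (A.cvec i) ^ k * C (θ (U i k)), fun l => ?_⟩
  rw [hU]
  simp only [map_sum, map_smul, map_mul, map_pow, eval_linForm, eval_C, smul_eq_mul]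
  refine Finset.sum_congr rfl fun i _ => Finset.sum_congr rfl fun k _ => ?_
  rw [dotProduct_comm]

end Cramer

/-- Modulo `D`, the sum is a polynomial in `x` with coefficients in a complex vector space, and it
vanishes at every `x`. Linear functionals reduce this to scalar polynomials, so each coefficient is
zero. -/
lemma forall_dvd_of_forall_eval_dvd {s : Finset (Fin N →₀ ℕ)} {D : MvPolynomial (Fin N) ℂ}
    {n : (Fin N →₀ ℕ) → MvPolynomial (Fin N) ℂ}
    (h : ∀ x : Fin N → ℂ, D ∣ ∑ ν ∈ s, eval x (monomial ν (1 : ℂ)) • n ν) :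
    ∀ ν ∈ s, D ∣ n ν := by
  classical
  intro ν hν
  rw [← Ideal.mem_span_singleton]
  have hQ : ((Ideal.span {D}).restrictScalars ℂ).mkQ (n ν) = 0 := by
    rw [← Module.forall_dual_apply_eq_zero_iff ℂ]
    intro θ
    have hz : ∑ μ ∈ s, monomial μ (θ (((Ideal.span {D}).restrictScalars ℂ).mkQ (n μ))) = 0 := by
      refine MvPolynomial.funext fun x => ?_
      have h1 : ((Ideal.span {D}).restrictScalars ℂ).mkQ
          (∑ ν ∈ s, eval x (monomial ν (1 : ℂ)) • n ν) = 0 := by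
        rw [Submodule.mkQ_apply, Submodule.Quotient.mk_eq_zero]
        exact Ideal.mem_span_singleton.2 (h x)
      have h2 := congrArg θ h1
      rw [map_sum, map_sum, map_zero] at h2
      rw [map_sum, map_zero, ← h2]
      refine Finset.sum_congr rfl fun μ _ => ?_
      rw [map_smul, map_smul, smul_eq_mul, eval_monomial, eval_monomial, one_mul, mul_comm]
    have := congrArg (coeff ν) hz
    rw [coeff_sum, coeff_zero, Finset.sum_eq_single ν] at this
    · simpa using this
    · intro μ _ hμ
      rw [coeff_monomial, if_neg hμ]
    · exact fun h => absurd hν h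
  rw [Submodule.mkQ_apply, Submodule.Quotient.mk_eq_zero] at hQ
  exact hQ

end HyperplaneConfig

/-! ### Polynomials in two sets of variables. -/

section TwoSets

variable {N : ℕ}

/-- The degree in the first set of variables. -/
def xWeight : Fin N ⊕ Fin N → ℕ := Sum.elim 1 0

/-- The degree in the second set of variables. -/
def lWeight : Fin N ⊕ Fin N → ℕ := Sum.elim 0 1

/-- A polynomial in the first set of variables. -/
def inX : MvPolynomial (Fin N) ℂ →ₐ[ℂ] MvPolynomial (Fin N ⊕ Fin N) ℂ := rename Sum.inl

/-- A polynomial in the second set of variables. -/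
def inL : MvPolynomial (Fin N) ℂ →ₐ[ℂ] MvPolynomial (Fin N ⊕ Fin N) ℂ := rename Sum.inr

lemma inX_injective : Function.Injective (inX (N := N)) := rename_injective _ Sum.inl_injective

lemma inL_injective : Function.Injective (inL (N := N)) := rename_injective _ Sum.inr_injective

lemma eval_inX (x l : Fin N → ℂ) (p : MvPolynomial (Fin N) ℂ) :
    eval (Sum.elim x l) (inX p) = eval x p := by
  rw [inX, eval_rename]; rfl

lemma eval_inL (x l : Fin N → ℂ) (p : MvPolynomial (Fin N) ℂ) :
    eval (Sum.elim x l) (inL p) = eval l p := by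
  rw [inL, eval_rename]; rfl

lemma weight_mapDomain {σ τ : Type*} (f : σ → τ) (w : τ → ℕ) (m : σ →₀ ℕ) :
    Finsupp.weight w (m.mapDomain f) = Finsupp.weight (w ∘ f) m := by
  simp only [Finsupp.weight, LinearMap.toAddMonoidHom_coe]
  exact Finsupp.linearCombination_mapDomain ℕ f m

lemma rename_mem_degLT {σ τ : Type*} (f : σ → τ) {w : τ → ℕ} {d : ℕ} {p : MvPolynomial σ ℂ}
    (hp : p ∈ degLT (w ∘ f) d) : rename f p ∈ degLT w d := by
  intro m hm
  obtain ⟨u, rfl, hu⟩ := coeff_rename_ne_zero _ _ _ hm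
  rw [weight_mapDomain]
  exact hp u hu

lemma rename_isWeightedHomogeneous {σ τ : Type*} (f : σ → τ) {w : τ → ℕ} {d : ℕ}
    {p : MvPolynomial σ ℂ} (hp : IsWeightedHomogeneous (w ∘ f) p d) :
    IsWeightedHomogeneous w (rename f p) d := by
  intro m hm
  obtain ⟨u, rfl, hu⟩ := coeff_rename_ne_zero _ _ _ hm
  rw [weight_mapDomain]
  exact hp hu

lemma isWeightedHomogeneous_zero_weight {σ : Type*} (p : MvPolynomial σ ℂ) :
    IsWeightedHomogeneous (0 : σ → ℕ) p 0 := by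
  intro m _
  rw [Finsupp.weight_apply]
  simp

lemma inX_xWeight {d : ℕ} {p : MvPolynomial (Fin N) ℂ}
    (hp : IsWeightedHomogeneous (1 : Fin N → ℕ) p d) : IsWeightedHomogeneous xWeight (inX p) d :=
  rename_isWeightedHomogeneous _ hp

lemma inL_lWeight {d : ℕ} {p : MvPolynomial (Fin N) ℂ}
    (hp : IsWeightedHomogeneous (1 : Fin N → ℕ) p d) : IsWeightedHomogeneous lWeight (inL p) d :=
  rename_isWeightedHomogeneous _ hp

lemma inX_lWeight (p : MvPolynomial (Fin N) ℂ) : IsWeightedHomogeneous lWeight (inX p) 0 :=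
  rename_isWeightedHomogeneous _ (isWeightedHomogeneous_zero_weight p)

lemma inL_xWeight (p : MvPolynomial (Fin N) ℂ) : IsWeightedHomogeneous xWeight (inL p) 0 :=
  rename_isWeightedHomogeneous _ (isWeightedHomogeneous_zero_weight p)

lemma mem_degLT_one_of_totalDegree_le {d : ℕ} {p : MvPolynomial (Fin N) ℂ}
    (hp : p.totalDegree ≤ d) : p ∈ degLT (1 : Fin N → ℕ) (d + 1) := by
  intro m hm
  have := (le_totalDegree (mem_support_iff.2 hm)).trans hp
  rw [Finsupp.weight_apply]
  simp only [Pi.one_apply, smul_eq_mul, mul_one]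
  omega

end TwoSets

/-! ### Polynomiality of the Baker-Akhiezer function in both variables. -/

namespace HyperplaneConfig

variable {N : ℕ} (A : HyperplaneConfig N) {φ : (Fin N → ℂ) → (Fin N → ℂ) → ℂ}

lemma mem_degLT_top_sub {P : (Fin N → ℂ) → MvPolynomial (Fin N) ℂ}
    (hdeg : ∀ l, (P l).totalDegree ≤ A.totalMult)
    (htop : ∀ l, homogeneousComponent A.totalMult (P l) = C (eval l A.poly) * A.poly)
    (l : Fin N → ℂ) :
    P l - C (eval l A.poly) * A.poly ∈ degLT (1 : Fin N → ℕ) A.totalMult := by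
  rw [← htop l]
  exact sub_wc_mem_degLT (mem_degLT_one_of_totalDegree_le (hdeg l))

lemma condMap_eq_zero_of_isBakerAkhiezer (hφ : A.IsBakerAkhiezer φ)
    {P : (Fin N → ℂ) → MvPolynomial (Fin N) ℂ}
    (hform : ∀ x l, φ x l = eval x (P l) * Complex.exp (x ⬝ᵥ l)) (l : Fin N → ℂ) :
    A.condMap l (P l) = 0 := by
  rw [condMap_eq_zero_iff]
  intro i s hs x hx
  have h := hφ.vanishing l i s hs x hx
  have hfun : (fun y => φ y l) = expFun (linForm l) (P l) := by
    funext y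
    rw [hform, expFun, eval_linForm, dotProduct_comm]
  rw [hfun, iterate_dirDeriv_expFun, dirD_linForm] at h
  exact (mul_eq_zero.1 h).resolve_right (Complex.exp_ne_zero _)

/-- The coefficients of the polynomial part of the Baker-Akhiezer function are rational
functions of `l` with a common denominator. -/
lemma exists_cramer {P : (Fin N → ℂ) → MvPolynomial (Fin N) ℂ}
    (s : Finset (Fin N →₀ ℕ)) (hs : ∀ ν ∈ s, Finsupp.weight (1 : Fin N → ℕ) ν < A.totalMult)
    (hP : ∀ l, P l - C (eval l A.poly) * A.poly =
      ∑ ν ∈ s, monomial ν (coeff ν (P l - C (eval l A.poly) * A.poly)))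
    (hcond : ∀ l, A.condMap l (P l) = 0) :
    ∃ (D : MvPolynomial (Fin N) ℂ) (n : (Fin N →₀ ℕ) → MvPolynomial (Fin N) ℂ), D ≠ 0 ∧
      ∀ l, ∀ ν ∈ s, eval l D * coeff ν (P l - C (eval l A.poly) * A.poly) = eval l (n ν) := by
  classical
  obtain ⟨l₀, hl₀⟩ := A.dense_regular.nonempty
  let ι : (s → ℂ) →ₗ[ℂ] MvPolynomial (Fin N) ℂ :=
    ∑ ν : s, (monomial (ν : Fin N →₀ ℕ)).comp (LinearMap.proj ν)
  have hι : ∀ c : s → ℂ, ι c = ∑ ν : s, monomial (ν : Fin N →₀ ℕ) (c ν) := by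
    intro c
    simp [ι]
  have hcoeff : ∀ (c : s → ℂ) (ν : s), coeff (ν : Fin N →₀ ℕ) (ι c) = c ν := by
    intro c ν
    rw [hι, coeff_sum, Finset.sum_eq_single ν]
    · rw [coeff_monomial, if_pos rfl]
    · intro μ _ hμ
      rw [coeff_monomial, if_neg fun h => hμ (Subtype.ext h)]
    · simp
  -- At the regular point `l₀`, uniqueness makes the infinite system for the lower coefficients
  -- injective. A left inverse chosen there extracts a square system whose matrix is `1` at `l₀`, so
  -- its determinant is a nonzero polynomial and Cramer's rule gives the coefficients over that
  -- determinant.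
  have hinj : LinearMap.ker (A.condMap l₀ ∘ₗ ι) = ⊥ := by
    rw [LinearMap.ker_eq_bot']
    intro c hc
    have h0 : ι c = 0 := by
      refine A.eq_zero_of_twistAt hl₀ ?_ (A.condMap_eq_zero_iff.1 hc)
      rw [hι]
      refine Submodule.sum_mem _ fun ν _ m hm => ?_
      rw [coeff_monomial] at hm
      split_ifs at hm with h
      · rw [← h]; exact hs ν ν.2
      · exact absurd rfl hm
    funext ν
    rw [← hcoeff c ν, h0, coeff_zero, Pi.zero_apply]
  obtain ⟨B, hB⟩ := (A.condMap l₀ ∘ₗ ι).exists_leftInverse_of_injective hinj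
  choose g hg using fun (ν : s) (p : MvPolynomial (Fin N) ℂ) =>
    A.exists_eval_eq_condMap (LinearMap.proj ν ∘ₗ B) p
  let Mx : Matrix s s (MvPolynomial (Fin N) ℂ) := fun ν μ => g ν (monomial (μ : Fin N →₀ ℕ) 1)
  let b : s → MvPolynomial (Fin N) ℂ := fun ν => -(A.poly * g ν A.poly)
  have hMx : ∀ l (c : s → ℂ), (Mx.map (eval l)).mulVec c = B (A.condMap l (ι c)) := by
    intro l c
    funext ν
    have h1 : ι c = ∑ μ : s, c μ • monomial (μ : Fin N →₀ ℕ) (1 : ℂ) := by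
      rw [hι]
      exact Finset.sum_congr rfl fun μ _ => by rw [smul_monomial, smul_eq_mul, mul_one]
    rw [h1, map_sum, map_sum, Finset.sum_apply, Matrix.mulVec, dotProduct]
    refine Finset.sum_congr rfl fun μ _ => ?_
    rw [map_smul, map_smul, Pi.smul_apply, smul_eq_mul, mul_comm]
    congr 1
    exact (hg ν _ l).symm
  refine ⟨Mx.det, fun ν => if h : ν ∈ s then (Mx.adjugate.mulVec b) ⟨ν, h⟩ else 0, ?_, ?_⟩
  · intro hdet
    have h1 : Mx.map (eval l₀) = 1 := by
      refine Matrix.ext_of_mulVec_single fun i => ?_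
      rw [hMx, Matrix.one_mulVec]
      exact LinearMap.congr_fun hB _
    have h2 : eval l₀ Mx.det = 1 := by
      rw [RingHom.map_det, RingHom.mapMatrix_apply, h1, Matrix.det_one]
    rw [hdet, map_zero] at h2
    exact zero_ne_one h2
  · intro l ν hν
    simp only [dif_pos hν]
    set c : s → ℂ := fun ν => coeff (ν : Fin N →₀ ℕ) (P l - C (eval l A.poly) * A.poly) with hc
    have h1 : ι c = P l - C (eval l A.poly) * A.poly := by
      rw [hι, hP l]
      exact Finset.sum_coe_sort s
        (fun ν => monomial ν (coeff ν (P l - C (eval l A.poly) * A.poly)))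
    have h2 : (Mx.map (eval l)).mulVec c = fun ν => eval l (b ν) := by
      rw [hMx, h1, map_sub, hcond l, zero_sub, map_neg, C_mul', map_smul, map_smul]
      funext ν
      simp only [b, map_neg, map_mul, Pi.neg_apply, Pi.smul_apply, smul_eq_mul, ← hg ν A.poly l]
      rfl
    have h3 := congrArg ((Mx.map (eval l)).adjugate.mulVec) h2
    rw [Matrix.mulVec_mulVec, Matrix.adjugate_mul, Matrix.smul_mulVec, Matrix.one_mulVec] at h3
    have h4 := congrFun h3 ⟨ν, hν⟩
    have h5 : eval l Mx.det = (Mx.map (eval l)).det := by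
      rw [RingHom.map_det, RingHom.mapMatrix_apply]
    have h6 : (Mx.map (eval l)).adjugate = Mx.adjugate.map (eval l) := by
      rw [← RingHom.mapMatrix_apply, ← RingHom.map_adjugate, RingHom.mapMatrix_apply]
    rw [Pi.smul_apply, smul_eq_mul, ← h5, h6] at h4
    rw [h4, RingHom.map_mulVec]
    rfl

/-- The Baker-Akhiezer function is a polynomial in both sets of variables times the exponential. -/
theorem exists_polynomial (hφ : A.IsBakerAkhiezer φ) :
    ∃ P : MvPolynomial (Fin N ⊕ Fin N) ℂ,
      (∀ x l, φ x l = eval (Sum.elim x l) P * Complex.exp (x ⬝ᵥ l)) ∧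
      P - inX A.poly * inL A.poly ∈ degLT xWeight A.totalMult := by
  classical
  obtain ⟨P, hdeg, htop, hform⟩ := hφ.form
  have hlow := A.mem_degLT_top_sub hdeg htop
  -- All exponents of total degree below `|m|`; the surrounding box only serves to make the set
  -- finite.
  let s : Finset (Fin N →₀ ℕ) :=
    (Finset.Iic (Finsupp.equivFunOnFinite.symm fun _ => A.totalMult)).filter
      fun ν => Finsupp.weight (1 : Fin N → ℕ) ν < A.totalMult
  have hsmem : ∀ ν : Fin N →₀ ℕ, Finsupp.weight (1 : Fin N → ℕ) ν < A.totalMult → ν ∈ s := by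
    intro ν hν
    refine Finset.mem_filter.2 ⟨Finset.mem_Iic.2 fun j => ?_, hν⟩
    have h1 := Finsupp.le_weight (1 : Fin N → ℕ) (s := j) one_ne_zero ν
    simp only [Finsupp.equivFunOnFinite_symm_apply_apply]
    omega
  have hP : ∀ l, P l - C (eval l A.poly) * A.poly =
      ∑ ν ∈ s, monomial ν (coeff ν (P l - C (eval l A.poly) * A.poly)) := by
    intro l
    conv_lhs => rw [as_sum (P l - C (eval l A.poly) * A.poly)]
    refine Finset.sum_subset (fun ν hν => hsmem ν (hlow l ν (mem_support_iff.1 hν))) ?_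
    intro ν _ hν
    rw [notMem_support_iff.1 hν, monomial_zero]
  obtain ⟨D, n, hD, hn⟩ := A.exists_cramer s (fun ν hν => (Finset.mem_filter.1 hν).2) hP
    (A.condMap_eq_zero_of_isBakerAkhiezer hφ hform)
  let f : (Fin N → ℂ) → (Fin N → ℂ) → ℂ := fun x l => eval x (P l - C (eval l A.poly) * A.poly)
  have hf : ∀ x, Continuous (f x) := by
    intro x
    have h1 : f x = fun l => φ x l * Complex.exp (-(x ⬝ᵥ l)) - eval l A.poly * eval x A.poly := by
      funext l
      simp only [f, hform, map_sub, map_mul, eval_C]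
      rw [mul_assoc, ← Complex.exp_add, add_neg_cancel, Complex.exp_zero, mul_one]
    rw [h1]
    have h2 : Continuous fun l : Fin N → ℂ => x ⬝ᵥ l := by
      unfold dotProduct
      fun_prop
    exact ((hφ.continuous x).mul (Complex.continuous_exp.comp h2.neg)).sub
      ((MvPolynomial.continuous_eval A.poly).mul continuous_const)
  have hDf : ∀ x l, eval l D * f x l =
      eval l (∑ ν ∈ s, eval x (monomial ν (1 : ℂ)) • n ν) := by
    intro x l
    simp only [f]
    rw [hP l, map_sum, map_sum, Finset.mul_sum]
    refine Finset.sum_congr rfl fun ν hν => ?_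
    rw [smul_eval, ← hn l ν hν, eval_monomial, eval_monomial]
    ring
  -- For fixed `x`, the lower part is continuous in `l` and is a polynomial over `D`, hence a
  -- polynomial. Varying `x` separates the numerators.
  have hdvd := forall_dvd_of_forall_eval_dvd (s := s) (D := D) (n := n) fun x =>
    dvd_of_continuous_quotient hD (hf x) (hDf x)
  choose! G hG using hdvd
  have hfG : ∀ x l, f x l = eval l (∑ ν ∈ s, eval x (monomial ν (1 : ℂ)) • G ν) := by
    intro x
    refine congrFun (Continuous.ext_on (dense_eval_ne_zero hD) (hf x)
      (MvPolynomial.continuous_eval _) fun l hl => ?_)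
    refine mul_left_cancel₀ hl ((hDf x l).trans ?_)
    rw [← map_mul, Finset.mul_sum]
    congr 1
    refine Finset.sum_congr rfl fun ν hν => ?_
    rw [hG ν hν, mul_smul_comm]
  refine ⟨inX A.poly * inL A.poly + ∑ ν ∈ s, inX (monomial ν 1) * inL (G ν), fun x l => ?_, ?_⟩
  · have h1 := hfG x l
    simp only [f, map_sub, map_mul, eval_C, sub_eq_iff_eq_add] at h1
    rw [hform, h1]
    simp only [map_add, map_mul, map_sum, eval_inX, eval_inL, smul_eval]
    ring
  · rw [add_sub_cancel_left]
    refine Submodule.sum_mem _ fun ν hν => ?_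
    rw [mul_comm]
    have h1 : inX (monomial ν (1 : ℂ)) ∈ degLT xWeight A.totalMult := by
      refine rename_mem_degLT _ fun m hm => ?_
      rw [coeff_monomial] at hm
      split_ifs at hm with h
      · rw [← h]; exact (Finset.mem_filter.1 hν).2
      · exact absurd rfl hm
    simpa using (inL_xWeight (G ν)).mul_mem_degLT h1

end HyperplaneConfig

namespace MvPolynomial

lemma pderiv_pderiv_comm {σ : Type*} (i j : σ) (p : MvPolynomial σ ℂ) :
    pderiv i (pderiv j p) = pderiv j (pderiv i p) := by
  classical
  have h : ⁅pderiv (R := ℂ) i, pderiv j⁆ = 0 := derivation_ext fun k => by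
    rw [Derivation.commutator_apply, pderiv_X, pderiv_X]
    by_cases hj : j = k <;> by_cases hi : i = k <;>
      simp [hi, hj, Ne.symm]
  have := DFunLike.congr_fun h p
  rwa [Derivation.commutator_apply, Derivation.zero_apply, sub_eq_zero] at this

lemma twist_comm {B : Type*} [CommRing B] [Algebra ℂ B] {δ δ' : Derivation ℂ B B} {a a' : B}
    (h : ∀ p, δ (δ' p) = δ' (δ p)) (ha : δ a' = δ' a) :
    Commute (twist δ a) (twist δ' a') := by
  refine LinearMap.ext fun p => ?_
  simp only [Module.End.mul_apply, twist_apply, map_add, Derivation.leibniz, smul_eq_mul, h p, ha]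
  ring

lemma coeff_X_mul_pderiv {σ : Type*} (i : σ) (m : σ →₀ ℕ) (p : MvPolynomial σ ℂ) :
    coeff m (X i * pderiv i p) = m i * coeff m p := by
  classical
  induction p using MvPolynomial.induction_on' with
  | monomial u a =>
    rw [X_mul_pderiv_monomial, coeff_smul, coeff_monomial]
    split_ifs with h
    · rw [h, nsmul_eq_mul]
    · simp
  | add p q hp hq => rw [map_add, mul_add, coeff_add, coeff_add, hp, hq, mul_add]

end MvPolynomial

/-! ### Derivatives in `x` and `l` conjugated by `exp (x, l)`, and the exchange of variables. -/

section TwistedDerivatives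

variable {N : ℕ}

/-- Polynomials in two sets of `N` variables. -/
abbrev BiPoly (N : ℕ) := MvPolynomial (Fin N ⊕ Fin N) ℂ

/-- `∂/∂x_j` conjugated by `exp (x, l)`. -/
def dX (j : Fin N) : Module.End ℂ (BiPoly N) := twist (pderiv (Sum.inl j)) (X (Sum.inr j))

/-- `∂/∂l_j` conjugated by `exp (x, l)`. -/
def dL (j : Fin N) : Module.End ℂ (BiPoly N) := twist (pderiv (Sum.inr j)) (X (Sum.inl j))

lemma dX_apply (j : Fin N) (R : BiPoly N) :
    dX j R = pderiv (Sum.inl j) R + X (Sum.inr j) * R := rfl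

lemma dL_apply (j : Fin N) (R : BiPoly N) :
    dL j R = pderiv (Sum.inr j) R + X (Sum.inl j) * R := rfl

lemma dX_mul (j : Fin N) (p R : BiPoly N) :
    dX j (p * R) = pderiv (Sum.inl j) p * R + p * dX j R := twist_mul _ _ _ _

lemma dL_mul (j : Fin N) (p R : BiPoly N) :
    dL j (p * R) = pderiv (Sum.inr j) p * R + p * dL j R := twist_mul _ _ _ _

lemma pderiv_inl_inX (j : Fin N) (p : MvPolynomial (Fin N) ℂ) :
    pderiv (Sum.inl j) (inX p) = inX (pderiv j p) := pderiv_rename Sum.inl_injective _ _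

lemma pderiv_inr_inL (j : Fin N) (p : MvPolynomial (Fin N) ℂ) :
    pderiv (Sum.inr j) (inL p) = inL (pderiv j p) := pderiv_rename Sum.inr_injective _ _

lemma pderiv_inr_inX (j : Fin N) (p : MvPolynomial (Fin N) ℂ) :
    pderiv (Sum.inr j) (inX p) = 0 := by
  classical
  refine pderiv_eq_zero_of_notMem_vars fun h => ?_
  have := vars_rename Sum.inl p h
  simp at this

lemma pderiv_inl_inL (j : Fin N) (p : MvPolynomial (Fin N) ℂ) :
    pderiv (Sum.inl j) (inL p) = 0 := by
  classical
  refine pderiv_eq_zero_of_notMem_vars fun h => ?_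
  have := vars_rename Sum.inr p h
  simp at this

lemma pderiv_inl_X_inr (i j : Fin N) : pderiv (Sum.inl i) (X (Sum.inr j) : BiPoly N) = 0 :=
  pderiv_X_of_ne (by simp)

lemma pderiv_inr_X_inl (i j : Fin N) : pderiv (Sum.inr i) (X (Sum.inl j) : BiPoly N) = 0 :=
  pderiv_X_of_ne (by simp)

lemma dX_inL_mul (j : Fin N) (p : MvPolynomial (Fin N) ℂ) (R : BiPoly N) :
    dX j (inL p * R) = inL p * dX j R := by
  rw [dX_mul, pderiv_inl_inL, zero_mul, zero_add]

lemma dL_inX_mul (j : Fin N) (p : MvPolynomial (Fin N) ℂ) (R : BiPoly N) :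
    dL j (inX p * R) = inX p * dL j R := by
  rw [dL_mul, pderiv_inr_inX, zero_mul, zero_add]

/-- Both are conjugates of commuting partial derivatives by the same exponential. -/
lemma dX_dL_comm (i j : Fin N) : Commute (dX i) (dL j) := by
  classical
  refine twist_comm (pderiv_pderiv_comm _ _) ?_
  rw [pderiv_X, pderiv_X]
  by_cases h : i = j
  · subst h; simp
  · simp [h, Ne.symm h]

lemma dX_dX_comm (i j : Fin N) : Commute (dX i) (dX j) :=
  twist_comm (pderiv_pderiv_comm _ _) (by rw [pderiv_inl_X_inr, pderiv_inl_X_inr])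

/-- Exchange of the two sets of variables. -/
def swapVars : BiPoly N →ₐ[ℂ] BiPoly N := rename Sum.swap

lemma swapVars_swapVars (R : BiPoly N) : swapVars (swapVars R) = R := by
  rw [swapVars, rename_rename, Sum.swap_swap_eq, rename_id_apply]

lemma swapVars_inX (p : MvPolynomial (Fin N) ℂ) : swapVars (inX p) = inL p := by
  rw [swapVars, inX, rename_rename]; rfl

lemma swapVars_inL (p : MvPolynomial (Fin N) ℂ) : swapVars (inL p) = inX p := by
  rw [swapVars, inL, rename_rename]; rfl

lemma swapVars_X_inl (j : Fin N) : swapVars (X (Sum.inl j)) = X (Sum.inr j) := by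
  rw [swapVars, rename_X]; rfl

lemma swapVars_X_inr (j : Fin N) : swapVars (X (Sum.inr j)) = X (Sum.inl j) := by
  rw [swapVars, rename_X]; rfl

lemma swapVars_pderiv (i : Fin N ⊕ Fin N) (R : BiPoly N) :
    swapVars (pderiv i R) = pderiv i.swap (swapVars R) :=
  (pderiv_rename (Function.LeftInverse.injective (g := Sum.swap) Sum.swap_swap) _ _).symm

lemma swapVars_dX (j : Fin N) (R : BiPoly N) : swapVars (dX j R) = dL j (swapVars R) := by
  rw [dX_apply, dL_apply, map_add, map_mul, swapVars_X_inr, swapVars_pderiv]; rfl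

lemma eval_swapVars (x l : Fin N → ℂ) (R : BiPoly N) :
    eval (Sum.elim x l) (swapVars R) = eval (Sum.elim l x) R := by
  rw [swapVars, eval_rename]
  congr 2
  funext i
  cases i <;> rfl

lemma inX_linForm (c : Fin N → ℂ) : inX (linForm c) = linForm (Sum.elim c 0) := by
  simp [inX, linForm]

lemma inL_linForm (c : Fin N → ℂ) : inL (linForm c) = linForm (Sum.elim 0 c) := by
  simp [inL, linForm]

lemma dirD_elim_inX (c : Fin N → ℂ) (p : MvPolynomial (Fin N) ℂ) :
    dirD (Sum.elim c 0) (inX p) = inX (dirD c p) := by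
  simp [dirD_apply, pderiv_inl_inX, map_sum, map_smul]

lemma dirD_elim_inL (c : Fin N → ℂ) (p : MvPolynomial (Fin N) ℂ) :
    dirD (Sum.elim c 0) (inL p) = 0 := by
  simp [dirD_apply, pderiv_inl_inL]

end TwistedDerivatives

/-! ### Quasi-invariant multiples of the exponential. -/

namespace HyperplaneConfig

variable {N : ℕ} (A : HyperplaneConfig N)

/-- The linear form `(α, x)` as a polynomial in both sets of variables. -/
def xForm (i : A.ι) : BiPoly N := linForm (Sum.elim (A.cvec i) 0)

/-- `∂_α`, acting in `x`, conjugated by `exp (x, l)`. -/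
def dAlpha (i : A.ι) : Module.End ℂ (BiPoly N) :=
  twist (dirD (Sum.elim (A.cvec i) 0)) (linForm (Sum.elim 0 (A.cvec i)))

lemma xForm_eq (i : A.ι) : A.xForm i = inX (linForm (A.cvec i)) := (inX_linForm _).symm

lemma dAlpha_eq_sum (i : A.ι) : A.dAlpha i = ∑ j, A.cvec i j • dX j := by
  refine LinearMap.ext fun R => ?_
  rw [LinearMap.sum_apply, dAlpha, twist_apply, dirD_apply, linForm]
  simp [dX_apply, Finset.sum_add_distrib, Finset.sum_mul, smul_eq_C_mul, mul_assoc]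

lemma inX_poly : inX A.poly = ∏ i, A.xForm i ^ A.mult i := by
  rw [poly_eq, map_prod]
  exact Finset.prod_congr rfl fun i _ => by rw [map_pow, xForm_eq]

lemma elim_cvec_ne_zero (i : A.ι) : (Sum.elim (A.cvec i) 0 : Fin N ⊕ Fin N → ℂ) ≠ 0 := by
  intro h
  refine A.cvec_ne_zero i (funext fun j => ?_)
  exact congrFun h (Sum.inl j)

lemma prime_xForm (i : A.ι) : Prime (A.xForm i) := prime_linForm (A.elim_cvec_ne_zero i)

lemma eval_xForm (i : A.ι) (x l : Fin N → ℂ) :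
    eval (Sum.elim x l) (A.xForm i) = A.cvec i ⬝ᵥ x := by
  rw [xForm_eq, eval_inX, eval_linForm]

lemma xForm_not_dvd {i j : A.ι} (hij : i ≠ j) : ¬ A.xForm i ∣ A.xForm j := by
  rintro ⟨r, hr⟩
  obtain ⟨x, h1, h2⟩ := A.exists_orthogonal hij
  apply h2
  rw [← A.eval_xForm j x 0, hr, map_mul, eval_xForm, h1, zero_mul]

lemma xForm_not_dvd_inL (i : A.ι) {p : MvPolynomial (Fin N) ℂ} (hp : p ≠ 0) :
    ¬ A.xForm i ∣ inL p := by
  rintro ⟨r, hr⟩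
  apply hp
  refine MvPolynomial.funext fun l => ?_
  rw [← eval_inL 0 l, hr, map_mul, eval_xForm, dotProduct_zero, zero_mul, map_zero]

lemma elim_cvec_weight (i : A.ι) (j : Fin N ⊕ Fin N)
    (h : (Sum.elim (A.cvec i) 0 : Fin N ⊕ Fin N → ℂ) j ≠ 0) : xWeight j = 1 := by
  cases j with
  | inl j => rfl
  | inr j => exact absurd rfl h

lemma elim_cvec_self (i : A.ι) : (Sum.elim (A.cvec i) 0 : Fin N ⊕ Fin N → ℂ) ⬝ᵥ
    Sum.elim (A.cvec i) 0 ≠ 0 := by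
  have := A.cvec_dotProduct_self_ne_zero i
  simpa [dotProduct] using this

/-- The polynomials `R(x, l)` such that `R(x, l) exp (x, l)` is quasi-invariant in `x`. -/
def quasiX : Submodule ℂ (BiPoly N) where
  carrier := {R | ∀ i, ∀ s < A.mult i, A.xForm i ∣ (A.dAlpha i ^ (2 * s + 1)) R}
  add_mem' := fun hp hq i s hs => by rw [map_add]; exact dvd_add (hp i s hs) (hq i s hs)
  zero_mem' := fun i s _ => by rw [map_zero]; exact dvd_zero _
  smul_mem' := fun c p hp i s hs => by
    rw [map_smul, smul_eq_C_mul]; exact (hp i s hs).mul_left _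

variable {A} {R : BiPoly N}

/-- Here `(α, l)` is a nonzero polynomial in `l` alone, so `(α, x)` never divides it and no
regularity of `l` enters. -/
lemma eq_zero_of_mem_quasiX (hR : R ∈ A.quasiX) (hd : R ∈ degLT xWeight A.totalMult) : R = 0 :=
  eq_zero_of_dvd_twist A.elim_cvec_weight A.elim_cvec_self (fun _ _ => A.xForm_not_dvd)
    (fun i => by rw [← inL_linForm]; exact inL_xWeight _)
    (fun i _ => by
      rw [← inL_linForm]
      exact A.xForm_not_dvd_inL i (linForm_ne_zero (A.cvec_ne_zero i))) hd hR

lemma exists_wc_eq_of_mem_quasiX (hR : R ∈ A.quasiX) {e : ℕ}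
    (hd : R ∈ degLT xWeight (A.totalMult + e + 1)) :
    ∃ T, IsWeightedHomogeneous xWeight T e ∧
      weightedHomogeneousComponent xWeight (A.totalMult + e) R = inX A.poly * T := by
  obtain ⟨T, hT⟩ := prod_linForm_dvd_wc A.elim_cvec_weight A.elim_cvec_self
    (fun _ _ => A.xForm_not_dvd) (a := fun i => linForm (Sum.elim 0 (A.cvec i)))
    (fun i => by rw [← inL_linForm]; exact inL_xWeight _)
    (fun i _ => by
      rw [← inL_linForm]
      exact A.xForm_not_dvd_inL i (linForm_ne_zero (A.cvec_ne_zero i))) hd hR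
  refine ⟨weightedHomogeneousComponent xWeight e T,
    weightedHomogeneousComponent_isWeightedHomogeneous _ _, ?_⟩
  rw [← (inX_xWeight A.isWeightedHomogeneous_poly).wc_mul, inX_poly]
  change _ = weightedHomogeneousComponent xWeight (A.totalMult + e)
    ((∏ i, linForm (Sum.elim (A.cvec i) 0) ^ A.mult i) * T)
  rw [← hT]
  exact ((weightedHomogeneousComponent_isWeightedHomogeneous _ _
    ).weightedHomogeneousComponent_same).symm

lemma dAlpha_dL_comm (i : A.ι) (j : Fin N) : Commute (A.dAlpha i) (dL j) := by
  rw [dAlpha_eq_sum]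
  exact Commute.sum_left _ _ _ fun k _ => (dX_dL_comm k j).smul_left _

/-- The conditions differentiate and restrict in `x` only, and `∂/∂l` commutes with both. -/
lemma dL_mem_quasiX (j : Fin N) (hR : R ∈ A.quasiX) : dL j R ∈ A.quasiX := by
  intro i s hs
  obtain ⟨r, hr⟩ := hR i s hs
  have h := LinearMap.congr_fun ((dAlpha_dL_comm i j).pow_left (2 * s + 1)).eq R
  rw [Module.End.mul_apply, Module.End.mul_apply, hr, xForm_eq, dL_inX_mul, ← xForm_eq] at h
  rw [h]
  exact dvd_mul_right _ _

lemma dAlpha_pow_inL_mul (i : A.ι) (p : MvPolynomial (Fin N) ℂ) (n : ℕ) (R : BiPoly N) :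
    (A.dAlpha i ^ n) (inL p * R) = inL p * (A.dAlpha i ^ n) R := by
  induction n generalizing R with
  | zero => rfl
  | succ n ih =>
    rw [pow_succ, Module.End.mul_apply, Module.End.mul_apply, ← ih, dAlpha, twist_mul,
      dirD_elim_inL, zero_mul, zero_add]

lemma inL_mul_mem_quasiX (p : MvPolynomial (Fin N) ℂ) (hR : R ∈ A.quasiX) :
    inL p * R ∈ A.quasiX := fun i s hs => by
  rw [dAlpha_pow_inL_mul]
  exact (hR i s hs).mul_left _

lemma mem_quasiX_of_inL_mul {p : MvPolynomial (Fin N) ℂ} (hp : p ≠ 0)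
    (hR : inL p * R ∈ A.quasiX) : R ∈ A.quasiX := fun i s hs => by
  have h := hR i s hs
  rw [dAlpha_pow_inL_mul] at h
  exact ((A.prime_xForm i).dvd_or_dvd h).resolve_left (A.xForm_not_dvd_inL i hp)

lemma linForm_dvd_of_mem_quasiInvariants {q : MvPolynomial (Fin N) ℂ} (hq : q ∈ A.quasiInvariants)
    (i : A.ι) {s : ℕ} (hs : s < A.mult i) :
    linForm (A.cvec i) ∣ ((dirD (A.cvec i)).toLinearMap ^ (2 * s + 1)) q := by
  refine linForm_dvd_of_eval_eq_zero (A.cvec_ne_zero i) fun x hx => ?_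
  rw [← polyDirDeriv_eq]
  exact hq i s hs x hx

lemma mem_quasiInvariants_of_dvd {q : MvPolynomial (Fin N) ℂ}
    (h : ∀ i, ∀ s < A.mult i,
      linForm (A.cvec i) ∣ ((dirD (A.cvec i)).toLinearMap ^ (2 * s + 1)) q) :
    q ∈ A.quasiInvariants := by
  intro i s hs x hx
  obtain ⟨r, hr⟩ := h i s hs
  rw [polyDirDeriv_eq, hr, map_mul, eval_linForm, hx, zero_mul]

lemma dirD_elim_pow_inX (c : Fin N → ℂ) (n : ℕ) (p : MvPolynomial (Fin N) ℂ) :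
    ((dirD (Sum.elim c 0)).toLinearMap ^ n) (inX p) = inX (((dirD c).toLinearMap ^ n) p) := by
  induction n generalizing p with
  | zero => rfl
  | succ n ih =>
    rw [pow_succ, Module.End.mul_apply, pow_succ, Module.End.mul_apply, ← ih]
    congr 1
    exact dirD_elim_inX c p

lemma inX_mul_mem_quasiX {q : MvPolynomial (Fin N) ℂ} (hq : q ∈ A.quasiInvariants)
    (hR : R ∈ A.quasiX) : inX q * R ∈ A.quasiX := fun i s hs => by
  refine dvd_twist_pow_mul _ _ (m := A.mult i) (fun t ht => ?_) (hR i) s hs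
  rw [dirD_elim_pow_inX, xForm_eq]
  exact map_dvd inX (linForm_dvd_of_mem_quasiInvariants hq i ht)

/-- `x² = ∑ x_j²`. -/
def normSqPoly (N : ℕ) : MvPolynomial (Fin N) ℂ := ∑ j, X j ^ 2

lemma normSqPoly_mem_quasiInvariants : normSqPoly N ∈ A.quasiInvariants := by
  have h1 : ∀ c : Fin N → ℂ, dirD c (normSqPoly N) = C 2 * linForm c := by
    intro c
    rw [normSqPoly, map_sum, linForm, Finset.mul_sum]
    refine Finset.sum_congr rfl fun j _ => ?_
    rw [Derivation.leibniz_pow, dirD_X]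
    simp only [Nat.add_one_sub_one, pow_one, smul_eq_mul, nsmul_eq_mul]
    rw [show (C 2 : MvPolynomial (Fin N) ℂ) = 2 from rfl]
    push_cast
    ring
  refine mem_quasiInvariants_of_dvd fun i s _ => ?_
  cases s with
  | zero =>
    rw [mul_zero, zero_add, pow_one]
    change _ ∣ dirD _ _
    rw [h1]
    exact dvd_mul_left _ _
  | succ s =>
    rw [show 2 * (s + 1) + 1 = 2 * s + 1 + 1 + 1 by ring, pow_succ, pow_succ, pow_succ]
    simp only [Module.End.mul_apply, Derivation.coeFn_coe]
    rw [h1, Derivation.leibniz, dirD_C, dirD_linForm, smul_zero, add_zero, smul_eq_mul, ← C_mul,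
      dirD_C, map_zero]
    exact dvd_zero _

/-- The Euler operator in `x`, conjugated by `exp (x, l)`. -/
def eulerX (R : BiPoly N) : BiPoly N := ∑ j, X (Sum.inl j) * dX j R

lemma dAlpha_eulerX (i : A.ι) (R : BiPoly N) :
    A.dAlpha i (eulerX R) = eulerX (A.dAlpha i R) + A.dAlpha i R := by
  have h1 : ∀ j, A.dAlpha i (X (Sum.inl j) * dX j R) =
      A.cvec i j • dX j R + X (Sum.inl j) * dX j (A.dAlpha i R) := by
    intro j
    have hc : A.dAlpha i (dX j R) = dX j (A.dAlpha i R) := by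
      have : Commute (A.dAlpha i) (dX j) := by
        rw [dAlpha_eq_sum]
        exact Commute.sum_left _ _ _ fun k _ => (dX_dX_comm k j).smul_left _
      exact LinearMap.congr_fun this.eq R
    rw [← hc, dAlpha, twist_mul, dirD_X, smul_eq_C_mul]
    rfl
  rw [eulerX, map_sum, Finset.sum_congr rfl fun j _ => h1 j, Finset.sum_add_distrib, add_comm]
  congr 1
  rw [dAlpha_eq_sum, LinearMap.sum_apply]
  rfl

lemma dAlpha_pow_eulerX (i : A.ι) (n : ℕ) (R : BiPoly N) :
    (A.dAlpha i ^ n) (eulerX R) =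
      eulerX ((A.dAlpha i ^ n) R) + (n : ℂ) • (A.dAlpha i ^ n) R := by
  induction n with
  | zero => simp
  | succ n ih =>
    rw [pow_succ', Module.End.mul_apply, ih, map_add, map_smul, dAlpha_eulerX,
      Module.End.mul_apply]
    push_cast
    rw [add_smul, one_smul]
    abel

/-- Moving the Euler operator past `∂_α^n` adds only `n ∂_α^n`, and the Euler operator maps
multiples of `(α, x)` to multiples of `(α, x)`. -/
lemma eulerX_mem_quasiX (hR : R ∈ A.quasiX) : eulerX R ∈ A.quasiX := by
  intro i s hs
  rw [dAlpha_pow_eulerX]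
  obtain ⟨r, hr⟩ := hR i s hs
  have h : A.xForm i ∣ eulerX (A.xForm i * r) := by
    have : eulerX (A.xForm i * r) = A.xForm i * (r + eulerX r) := by
      have h1 : ∀ j, X (Sum.inl j) * dX j (A.xForm i * r) =
          C (A.cvec i j) * X (Sum.inl j) * r + A.xForm i * (X (Sum.inl j) * dX j r) := by
        intro j
        have h2 : pderiv (Sum.inl j) (A.xForm i) = C (A.cvec i j) := by
          rw [xForm_eq, pderiv_inl_inX, ← dirD_single, dirD_linForm, dotProduct_single, mul_one,
            inX, rename_C]
        rw [dX_mul, h2]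
        ring
      rw [eulerX, Finset.sum_congr rfl fun j _ => h1 j, Finset.sum_add_distrib,
        ← Finset.sum_mul, ← Finset.mul_sum, mul_add, eulerX]
      congr 2
      simp [xForm, linForm]
    rw [this]
    exact dvd_mul_right _ _
  rw [hr]
  refine dvd_add h ?_
  rw [smul_eq_C_mul]
  exact (dvd_mul_right _ _).mul_left _

end HyperplaneConfig

/-! ### Specialization of variables and bookkeeping of degrees. -/

section Specialization

variable {N : ℕ}

/-- Specialization of the second set of variables. -/
def specL (l : Fin N → ℂ) : BiPoly N →ₐ[ℂ] MvPolynomial (Fin N) ℂ :=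
  aeval (Sum.elim X (C ∘ l))

lemma specL_pderiv (l : Fin N → ℂ) (j : Fin N) (R : BiPoly N) :
    specL l (pderiv (Sum.inl j) R) = pderiv j (specL l R) :=
  aeval_sumElim_pderiv_inl _ _ _

lemma specL_inX (l : Fin N → ℂ) (p : MvPolynomial (Fin N) ℂ) : specL l (inX p) = p := by
  rw [specL, inX, aeval_rename]
  exact aeval_X_left_apply p

lemma specL_X_inr (l : Fin N → ℂ) (j : Fin N) : specL l (X (Sum.inr j)) = C (l j) := by
  simp [specL]

lemma eval_specL (x l : Fin N → ℂ) (R : BiPoly N) :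
    eval x (specL l R) = eval (Sum.elim x l) R := by
  rw [← aeval_eq_eval_apply, specL, ← AlgHom.comp_apply, comp_aeval, ← aeval_eq_eval_apply]
  congr 2
  funext i
  cases i <;> simp

lemma specL_inL (l : Fin N → ℂ) (p : MvPolynomial (Fin N) ℂ) :
    specL l (inL p) = C (eval l p) := by
  refine MvPolynomial.funext fun x => ?_
  rw [eval_specL, eval_inL, eval_C]

lemma specL_dX (l : Fin N → ℂ) (j : Fin N) (R : BiPoly N) :
    specL l (dX j R) = pderiv j (specL l R) + C (l j) * specL l R := by
  rw [dX_apply, map_add, map_mul, specL_X_inr, specL_pderiv]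

end Specialization

section Degrees

variable {N : ℕ}

lemma weight_xWeight (m : Fin N ⊕ Fin N →₀ ℕ) :
    Finsupp.weight xWeight m = ∑ j, m (Sum.inl j) := by
  rw [Finsupp.weight_apply, Finsupp.sum_fintype _ _ (by simp), Fintype.sum_sum_type]
  simp [xWeight]

lemma weight_lWeight (m : Fin N ⊕ Fin N →₀ ℕ) :
    Finsupp.weight lWeight m = ∑ j, m (Sum.inr j) := by
  rw [Finsupp.weight_apply, Finsupp.sum_fintype _ _ (by simp), Fintype.sum_sum_type]
  simp [lWeight]

/-- The Euler operator in `l`, conjugated by `exp (x, l)`. -/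
def eulerL (R : BiPoly N) : BiPoly N := ∑ j, X (Sum.inr j) * dL j R

lemma swapVars_eulerX (R : BiPoly N) :
    swapVars (HyperplaneConfig.eulerX R) = eulerL (swapVars R) := by
  simp only [HyperplaneConfig.eulerX, eulerL, map_sum, map_mul, swapVars_X_inl, swapVars_dX]

/-- The exponential contributes `(x, l) R` to both terms, which cancels; what remains counts
degrees. -/
lemma coeff_eulerX_sub_eulerL (R : BiPoly N) (m : Fin N ⊕ Fin N →₀ ℕ) :
    coeff m (HyperplaneConfig.eulerX R - eulerL R) =
      ((Finsupp.weight xWeight m : ℂ) - Finsupp.weight lWeight m) * coeff m R := by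
  have h : HyperplaneConfig.eulerX R - eulerL R =
      ∑ j, X (Sum.inl j) * pderiv (Sum.inl j) R - ∑ j, X (Sum.inr j) * pderiv (Sum.inr j) R := by
    rw [HyperplaneConfig.eulerX, eulerL, ← Finset.sum_sub_distrib, ← Finset.sum_sub_distrib]
    refine Finset.sum_congr rfl fun j _ => ?_
    rw [dX_apply, dL_apply]
    ring
  rw [h, coeff_sub, coeff_sum, coeff_sum, weight_xWeight, weight_lWeight]
  simp only [coeff_X_mul_pderiv]
  rw [← Finset.sum_mul, ← Finset.sum_mul]
  push_cast
  ring

lemma pderiv_inr_mem_xdeg {d : ℕ} {R : BiPoly N} (j : Fin N) (h : R ∈ degLT xWeight d) :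
    pderiv (Sum.inr j) R ∈ degLT xWeight d := pderiv_mem_degLT _ h

lemma inL_mul_mem_xdeg {d : ℕ} {R : BiPoly N} (p : MvPolynomial (Fin N) ℂ)
    (h : R ∈ degLT xWeight d) : inL p * R ∈ degLT xWeight d := by
  simpa using (inL_xWeight p).mul_mem_degLT h

lemma X_inl_mul_mem_xdeg {d : ℕ} {R : BiPoly N} (j : Fin N) (h : R ∈ degLT xWeight d) :
    X (Sum.inl j) * R ∈ degLT xWeight (d + 1) := by
  rw [add_comm]
  exact (isWeightedHomogeneous_X ℂ xWeight (Sum.inl j)).mul_mem_degLT h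

lemma pderiv_inl_mem_ldeg {d : ℕ} {R : BiPoly N} (j : Fin N) (h : R ∈ degLT lWeight d) :
    pderiv (Sum.inl j) R ∈ degLT lWeight d := pderiv_mem_degLT _ h

lemma inX_mul_mem_ldeg {d : ℕ} {R : BiPoly N} (p : MvPolynomial (Fin N) ℂ)
    (h : R ∈ degLT lWeight d) : inX p * R ∈ degLT lWeight d := by
  simpa using (inX_lWeight p).mul_mem_degLT h

lemma X_inl_mul_mem_ldeg {d : ℕ} {R : BiPoly N} (j : Fin N) (h : R ∈ degLT lWeight d) :
    X (Sum.inl j) * R ∈ degLT lWeight d := by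
  have := inX_mul_mem_ldeg (X j) h
  rwa [inX, rename_X] at this

lemma X_inr_mul_mem_ldeg {d : ℕ} {R : BiPoly N} (j : Fin N) (h : R ∈ degLT lWeight d) :
    X (Sum.inr j) * R ∈ degLT lWeight (d + 1) := by
  rw [add_comm]
  exact (isWeightedHomogeneous_X ℂ lWeight (Sum.inr j)).mul_mem_degLT h

lemma swapVars_mem_ldeg {d : ℕ} {R : BiPoly N} (h : R ∈ degLT xWeight d) :
    swapVars R ∈ degLT lWeight d := by
  refine rename_mem_degLT _ ?_
  convert h using 2
  funext i
  cases i <;> rfl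

lemma two_mul_mem_degLT {σ : Type*} {w : σ → ℕ} {d : ℕ} {p : MvPolynomial σ ℂ}
    (h : p ∈ degLT w d) : 2 * p ∈ degLT w d := by
  rw [two_mul]; exact add_mem h h

lemma exists_inL_of_isWeightedHomogeneous_zero {T : BiPoly N}
    (hT : IsWeightedHomogeneous xWeight T 0) : ∃ t, T = inL t := by
  classical
  obtain ⟨t, ht⟩ := exists_rename_eq_of_vars_subset_range T Sum.inr Sum.inr_injective (by
    intro i hi
    rw [Finset.mem_coe, mem_vars_iff_mem_support] at hi
    obtain ⟨m, hm, him⟩ := hi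
    cases i with
    | inr j => exact ⟨j, rfl⟩
    | inl j =>
      exfalso
      have h := hT (mem_support_iff.1 hm)
      rw [weight_xWeight, Finset.sum_eq_zero_iff] at h
      exact (Finsupp.mem_support_iff.1 him) (h j (Finset.mem_univ j)))
  exact ⟨t, ht.symm⟩

lemma eval_eq_coeff_zero {σ : Type*} [Fintype σ] {R : MvPolynomial σ ℂ} {y : σ → ℂ}
    (h : ∀ m, coeff m R ≠ 0 → m ≠ 0 → ∃ i, y i = 0 ∧ m i ≠ 0) : eval y R = coeff 0 R := by
  classical
  rw [eval_eq', Finset.sum_eq_single 0]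
  · simp
  · intro m hm hm0
    obtain ⟨i, hi, hmi⟩ := h m (mem_support_iff.1 hm) hm0
    rw [Finset.prod_eq_zero (Finset.mem_univ i) (by rw [hi, zero_pow hmi]), mul_zero]
  · intro h0
    rw [notMem_support_iff.1 h0, zero_mul]

end Degrees

/-! ### Bihomogeneity of the Baker-Akhiezer function. -/

namespace HyperplaneConfig

variable {N : ℕ} (A : HyperplaneConfig N)

lemma specL_dAlpha_pow (l : Fin N → ℂ) (i : A.ι) (n : ℕ) (R : BiPoly N) :
    specL l ((A.dAlpha i ^ n) R) = (A.twistAt l i ^ n) (specL l R) := by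
  induction n generalizing R with
  | zero => rfl
  | succ n ih =>
    rw [pow_succ, Module.End.mul_apply, ih, pow_succ, Module.End.mul_apply]
    congr 1
    rw [dAlpha_eq_sum, LinearMap.sum_apply, map_sum, twistAt, twist_apply, dirD_apply, dotProduct,
      map_sum, Finset.sum_mul, ← Finset.sum_add_distrib]
    refine Finset.sum_congr rfl fun j _ => ?_
    rw [LinearMap.smul_apply, map_smul, specL_dX, smul_add, C_mul]
    simp only [smul_eq_C_mul]
    ring

/-- The properties of the polynomial part of a Baker-Akhiezer function on which the
construction of the quantum integrals rests. -/
structure IsBAPoly (P : BiPoly N) : Prop where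
  low : P - inX A.poly * inL A.poly ∈ degLT xWeight A.totalMult
  quasi : P ∈ A.quasiX
  ne : coeff 0 P ≠ 0

variable {A}

lemma mem_quasiX_of_isBakerAkhiezer {φ : (Fin N → ℂ) → (Fin N → ℂ) → ℂ}
    (hφ : A.IsBakerAkhiezer φ) {P : BiPoly N}
    (hP : ∀ x l, φ x l = eval (Sum.elim x l) P * Complex.exp (x ⬝ᵥ l)) : P ∈ A.quasiX := by
  intro i s hs
  refine linForm_dvd_of_eval_eq_zero (A.elim_cvec_ne_zero i) fun y hy => ?_
  have h1 : ∀ x l, φ x l = eval x (specL l P) * Complex.exp (x ⬝ᵥ l) := fun x l => by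
    rw [eval_specL, hP]
  have h2 := A.condMap_eq_zero_iff.1
    (A.condMap_eq_zero_of_isBakerAkhiezer hφ (P := fun l => specL l P) h1 (y ∘ Sum.inr)) i s hs
    (y ∘ Sum.inl) (by simpa [dotProduct] using hy)
  rw [← specL_dAlpha_pow, eval_specL, Sum.elim_comp_inl_inr] at h2
  exact h2

variable {P : BiPoly N}

/-- The difference is quasi-invariant, and the leading part `A_m(x) A_m(l)` drops out of it, having
degree `|m|` in either set. What is left has too small a degree to be nonzero. -/
lemma IsBAPoly.eulerX_eq (hP : A.IsBAPoly P) : eulerX P = eulerL P := by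
  have hV : eulerX P - eulerL P ∈ A.quasiX := by
    refine sub_mem (eulerX_mem_quasiX hP.quasi) (Submodule.sum_mem _ fun j _ => ?_)
    have := inL_mul_mem_quasiX (X j) (dL_mem_quasiX j hP.quasi)
    rwa [inL, rename_X] at this
  have hmul : ∀ m, coeff m (inX A.poly * inL A.poly) ≠ 0 →
      Finsupp.weight xWeight m = A.totalMult ∧ Finsupp.weight lWeight m = A.totalMult := by
    intro m hm
    have h1 := (inX_xWeight A.isWeightedHomogeneous_poly).mul (inL_xWeight A.poly)
    have h2 := (inX_lWeight A.poly).mul (inL_lWeight A.isWeightedHomogeneous_poly)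
    exact ⟨by simpa using h1 hm, by simpa using h2 hm⟩
  refine sub_eq_zero.1 (eq_zero_of_mem_quasiX hV fun m hm => ?_)
  rw [coeff_eulerX_sub_eulerL] at hm
  by_contra hlt
  have hlow : coeff m (P - inX A.poly * inL A.poly) = 0 := by
    by_contra hne
    exact hlt (hP.low m hne)
  rw [coeff_sub, sub_eq_zero] at hlow
  rw [hlow] at hm
  obtain ⟨h1, h2⟩ := hmul m (right_ne_zero_of_mul hm)
  rw [h1, h2, sub_self, zero_mul] at hm
  exact hm rfl

/-- The coefficient form of `IsBAPoly.eulerX_eq`, expressing `φ(tx, l) = φ(x, tl)`. It converts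
bounds on the degree in `x` into bounds on the degree in `l`. -/
lemma IsBAPoly.weight_eq (hP : A.IsBAPoly P) {m : Fin N ⊕ Fin N →₀ ℕ}
    (hm : coeff m P ≠ 0) :
    Finsupp.weight xWeight m = Finsupp.weight lWeight m := by
  have h := coeff_eulerX_sub_eulerL P m
  rw [hP.eulerX_eq, sub_self, coeff_zero] at h
  have := (mul_eq_zero.1 h.symm).resolve_right hm
  exact_mod_cast sub_eq_zero.1 this

lemma IsBAPoly.low_l (hP : A.IsBAPoly P) :
    P - inX A.poly * inL A.poly ∈ degLT lWeight A.totalMult := by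
  intro m hm
  have h1 := hP.low m hm
  by_cases h : coeff m P = 0
  · rw [coeff_sub, h, zero_sub] at hm
    have h2 := (inX_xWeight A.isWeightedHomogeneous_poly).mul (inL_xWeight A.poly)
    have h3 := h2 (neg_ne_zero.1 hm)
    omega
  · rwa [← hP.weight_eq h]

/-- A monomial that survives at `l = 0` has degree zero in `l`, hence also in `x`. -/
lemma IsBAPoly.specL_zero (hP : A.IsBAPoly P) : specL 0 P = C (coeff 0 P) := by
  refine MvPolynomial.funext fun x => ?_
  rw [eval_specL, eval_C]
  refine eval_eq_coeff_zero fun m hm hm0 => ?_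
  by_contra! h
  apply hm0
  have h1 : Finsupp.weight lWeight m = 0 := by
    rw [weight_lWeight]
    exact Finset.sum_eq_zero fun j _ => h (Sum.inr j) rfl
  have h2 := hP.weight_eq hm
  rw [h1, weight_xWeight, Finset.sum_eq_zero_iff] at h2
  rw [weight_lWeight, Finset.sum_eq_zero_iff] at h1
  ext i
  cases i with
  | inl j => exact h2 j (Finset.mem_univ j)
  | inr j => exact h1 j (Finset.mem_univ j)

lemma IsBAPoly.specL_zero_swap (hP : A.IsBAPoly P) : specL 0 (swapVars P) = C (coeff 0 P) := by
  refine MvPolynomial.funext fun x => ?_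
  rw [eval_specL, eval_swapVars, eval_C]
  refine eval_eq_coeff_zero fun m hm hm0 => ?_
  by_contra! h
  apply hm0
  have h1 : Finsupp.weight xWeight m = 0 := by
    rw [weight_xWeight]
    exact Finset.sum_eq_zero fun j _ => h (Sum.inl j) rfl
  have h2 := hP.weight_eq hm
  rw [h1, weight_lWeight, eq_comm, Finset.sum_eq_zero_iff] at h2
  rw [weight_xWeight, Finset.sum_eq_zero_iff] at h1
  ext i
  cases i with
  | inl j => exact h1 j (Finset.mem_univ j)
  | inr j => exact h2 j (Finset.mem_univ j)

end HyperplaneConfig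

/-! ### Calogero-Moser operators in `x` and `l`, and the equation in `l`. -/

namespace HyperplaneConfig

variable {N : ℕ} (A : HyperplaneConfig N)

/-- `A_m(x)` times the Calogero-Moser operator in `x`, conjugated by `exp (x, l)`. -/
def cmX : Module.End ℂ (BiPoly N) :=
  LinearMap.mulLeft ℂ (inX A.poly) * ∑ j, dX j * dX j
    - (2 : ℂ) • ∑ j, LinearMap.mulLeft ℂ (inX (pderiv j A.poly)) * dX j

/-- `A_m(l)` times the Calogero-Moser operator in `l`, conjugated by `exp (x, l)`. -/
def cmL : Module.End ℂ (BiPoly N) :=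
  LinearMap.mulLeft ℂ (inL A.poly) * ∑ j, dL j * dL j
    - (2 : ℂ) • ∑ j, LinearMap.mulLeft ℂ (inL (pderiv j A.poly)) * dL j

lemma cmX_apply (R : BiPoly N) : A.cmX R = inX A.poly * ∑ j, dX j (dX j R)
    - 2 * ∑ j, inX (pderiv j A.poly) * dX j R := by
  simp [cmX, LinearMap.sum_apply, smul_eq_C_mul, map_ofNat, Finset.mul_sum]

lemma cmL_apply (R : BiPoly N) : A.cmL R = inL A.poly * ∑ j, dL j (dL j R)
    - 2 * ∑ j, inL (pderiv j A.poly) * dL j R := by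
  simp [cmL, LinearMap.sum_apply, smul_eq_C_mul, map_ofNat, Finset.mul_sum]

lemma swapVars_cmX (R : BiPoly N) : swapVars (A.cmX R) = A.cmL (swapVars R) := by
  simp only [cmX_apply, cmL_apply, map_sub, map_mul, map_sum, swapVars_inX, swapVars_dX, map_ofNat]

lemma cmX_inL_mul (p : MvPolynomial (Fin N) ℂ) (R : BiPoly N) :
    A.cmX (inL p * R) = inL p * A.cmX R := by
  have h : ∀ j, inX (pderiv j A.poly) * (inL p * dX j R) =
      inL p * (inX (pderiv j A.poly) * dX j R) := fun j => by ring
  simp only [cmX_apply, dX_inL_mul, h, ← Finset.mul_sum]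
  ring

lemma cmL_inX_mul (p : MvPolynomial (Fin N) ℂ) (R : BiPoly N) :
    A.cmL (inX p * R) = inX p * A.cmL R := by
  have h : ∀ j, inL (pderiv j A.poly) * (inX p * dL j R) =
      inX p * (inL (pderiv j A.poly) * dL j R) := fun j => by ring
  simp only [cmL_apply, dL_inX_mul, h, ← Finset.mul_sum]
  ring

lemma cmX_dL (j : Fin N) (R : BiPoly N) : A.cmX (dL j R) = dL j (A.cmX R) := by
  have h : ∀ k (Y : BiPoly N), dX k (dL j Y) = dL j (dX k Y) := fun k Y =>
    LinearMap.congr_fun (dX_dL_comm k j).eq Y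
  rw [cmX_apply, cmX_apply, map_sub, dL_inX_mul, map_sum]
  simp only [h]
  congr 1
  rw [two_mul, two_mul, map_add, map_sum]
  simp only [dL_inX_mul]

lemma cmX_cmL (R : BiPoly N) : A.cmX (A.cmL R) = A.cmL (A.cmX R) := by
  rw [cmL_apply, map_sub, cmX_inL_mul, map_sum, cmL_apply]
  simp only [cmX_dL]
  congr 1
  rw [two_mul, two_mul, map_add, map_sum]
  simp only [cmX_inL_mul, cmX_dL]

lemma inX_X (j : Fin N) : inX (X j : MvPolynomial (Fin N) ℂ) = X (Sum.inl j) := rename_X _ _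

lemma inL_X (j : Fin N) : inL (X j : MvPolynomial (Fin N) ℂ) = X (Sum.inr j) := rename_X _ _

lemma pderiv_normSqPoly (j : Fin N) : pderiv j (normSqPoly N) = 2 * X j := by
  classical
  rw [normSqPoly, map_sum, Finset.sum_eq_single j]
  · rw [pderiv_pow, pderiv_X_self]; simp
  · intro i _ hi
    rw [pderiv_pow, pderiv_X_of_ne hi, mul_zero]
  · simp

lemma sum_X_mul_pderiv_poly : ∑ j, X j * pderiv j A.poly = (A.totalMult : ℂ) • A.poly := by
  have h : A.poly.IsHomogeneous A.totalMult := A.isWeightedHomogeneous_poly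
  rw [h.sum_X_mul_pderiv]
  exact (Nat.cast_smul_eq_nsmul ℂ _ _).symm

/-- The commutation relation of the Calogero-Moser operator with `x²`. -/
lemma cmX_normSq_mul (R : BiPoly N) : A.cmX (inX (normSqPoly N) * R) =
    inX (normSqPoly N) * A.cmX R +
      inX A.poly * (4 * eulerX R + (2 * (N : BiPoly N) - 4 * (A.totalMult : BiPoly N)) * R) := by
  have h1 : ∀ j, dX j (inX (normSqPoly N) * R) =
      2 * (X (Sum.inl j) * R) + inX (normSqPoly N) * dX j R := by
    intro j
    rw [dX_mul, pderiv_inl_inX, pderiv_normSqPoly, map_mul, map_ofNat, inX_X]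
    ring
  have h2 : ∀ j, dX j (dX j (inX (normSqPoly N) * R)) =
      2 * R + 4 * (X (Sum.inl j) * dX j R) + inX (normSqPoly N) * dX j (dX j R) := by
    intro j
    rw [h1, map_add, two_mul, map_add, dX_mul, pderiv_X_self, dX_mul, pderiv_inl_inX,
      pderiv_normSqPoly, map_mul, map_ofNat, inX_X]
    ring
  have h3 : ∑ j, inX (pderiv j A.poly) * (2 * (X (Sum.inl j) * R)) =
      2 * ((A.totalMult : BiPoly N) * inX A.poly * R) := by
    have h := congrArg (inX (N := N)) A.sum_X_mul_pderiv_poly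
    rw [map_sum, map_smul, smul_eq_C_mul, map_natCast] at h
    rw [← h, Finset.sum_mul, Finset.mul_sum]
    refine Finset.sum_congr rfl fun j _ => ?_
    rw [map_mul, inX_X]
    ring
  rw [cmX_apply, cmX_apply, eulerX, Finset.sum_congr rfl fun j _ => h2 j]
  simp only [h1, mul_add, Finset.sum_add_distrib, h3, Finset.mul_sum, mul_sub,
    Finset.sum_const, Finset.card_univ, Fintype.card_fin, nsmul_eq_mul]
  have h4 : ∑ j, 2 * (inX (pderiv j A.poly) * (inX (normSqPoly N) * dX j R)) =
      ∑ j, inX (normSqPoly N) * (2 * (inX (pderiv j A.poly) * dX j R)) :=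
    Finset.sum_congr rfl fun j _ => by ring
  have h5 : ∑ j, inX A.poly * (inX (normSqPoly N) * dX j (dX j R)) =
      ∑ j, inX (normSqPoly N) * (inX A.poly * dX j (dX j R)) :=
    Finset.sum_congr rfl fun j _ => by ring
  rw [h4, h5]
  ring

lemma swapVars_cmL (R : BiPoly N) : swapVars (A.cmL R) = A.cmX (swapVars R) := by
  conv_lhs => rw [← swapVars_swapVars R]
  rw [← swapVars_cmX, swapVars_swapVars]

lemma cmL_normSq_mul (R : BiPoly N) : A.cmL (inL (normSqPoly N) * R) =
    inL (normSqPoly N) * A.cmL R +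
      inL A.poly * (4 * eulerL R + (2 * (N : BiPoly N) - 4 * (A.totalMult : BiPoly N)) * R) := by
  have h := congrArg swapVars (A.cmX_normSq_mul (swapVars R))
  simpa only [swapVars_cmX, map_mul, map_add, map_sub, swapVars_inX, swapVars_swapVars,
    swapVars_eulerX, map_ofNat, map_natCast] using h

/-- The part of `cmL` that is of first order in `x`. -/
def coreL (R : BiPoly N) : BiPoly N :=
  inL A.poly * ∑ j, X (Sum.inl j) * pderiv (Sum.inr j) R
    - (∑ j, X (Sum.inl j) * inL (pderiv j A.poly)) * R

/-- The part of `cmL` that is of order zero in `x`. -/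
def restL (R : BiPoly N) : BiPoly N :=
  inL A.poly * ∑ j, pderiv (Sum.inr j) (pderiv (Sum.inr j) R)
    - 2 * ∑ j, inL (pderiv j A.poly) * pderiv (Sum.inr j) R

/-- The term quadratic in `x` is the eigenvalue term, so the equation `L_l φ = x² φ` becomes `restL
R + 2 * coreL R = 0`. Here `coreL R` is `A_m(l)²` times the derivative of `R / A_m(l)` in `l` along
`x`. -/
lemma cmL_expand (R : BiPoly N) :
    A.cmL R = A.restL R + 2 * A.coreL R + inL A.poly * (inX (normSqPoly N) * R) := by
  have h1 : ∀ j, dL j (dL j R) = pderiv (Sum.inr j) (pderiv (Sum.inr j) R)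
      + 2 * (X (Sum.inl j) * pderiv (Sum.inr j) R) + X (Sum.inl j) ^ 2 * R := by
    intro j
    simp only [dL_apply, map_add, Derivation.leibniz, pderiv_inr_X_inl, smul_eq_mul]
    ring
  have h2 : inX (normSqPoly N) = ∑ j, X (Sum.inl j) ^ 2 := by
    simp only [normSqPoly, map_sum, map_pow, inX_X]
  rw [cmL_apply, restL, coreL, h2, Finset.sum_congr rfl fun j _ => h1 j]
  simp only [Finset.sum_add_distrib, dL_apply, mul_add, Finset.sum_mul, ← Finset.mul_sum]
  have h3 : ∑ j, inL (pderiv j A.poly) * (X (Sum.inl j) * R) =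
      ∑ j, X (Sum.inl j) * inL (pderiv j A.poly) * R :=
    Finset.sum_congr rfl fun j _ => by ring
  rw [h3]
  ring

lemma coreL_sub (R S : BiPoly N) : A.coreL (R - S) = A.coreL R - A.coreL S := by
  simp only [coreL, map_sub, mul_sub, Finset.sum_sub_distrib]
  ring

lemma coreL_top : A.coreL (inX A.poly * inL A.poly) = 0 := by
  have h : ∀ j, X (Sum.inl j) * pderiv (Sum.inr j) (inX A.poly * inL A.poly) =
      inX A.poly * (X (Sum.inl j) * inL (pderiv j A.poly)) := by
    intro j
    rw [Derivation.leibniz, pderiv_inr_inX, pderiv_inr_inL, smul_zero, add_zero, smul_eq_mul]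
    ring
  simp only [coreL, h, ← Finset.mul_sum]
  ring

variable {A} {P : BiPoly N}

lemma IsBAPoly.mem_xdeg (hP : A.IsBAPoly P) : P ∈ degLT xWeight (A.totalMult + 1) := by
  have h := add_mem (degLT_mono (Nat.le_succ _) hP.low)
    ((inX_xWeight A.isWeightedHomogeneous_poly).mul (inL_xWeight A.poly)).mem_degLT
  simpa using h

lemma IsBAPoly.wc_x (hP : A.IsBAPoly P) :
    weightedHomogeneousComponent xWeight A.totalMult P = inX A.poly * inL A.poly := by
  have h1 := wc_eq_zero_of_mem_degLT hP.low le_rfl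
  have h2 := (inX_xWeight A.isWeightedHomogeneous_poly).mul (inL_xWeight A.poly)
  rw [map_sub, sub_eq_zero] at h1
  rw [h1]
  exact h2.weightedHomogeneousComponent_same

/-- The Baker-Akhiezer function is an eigenfunction of the Calogero-Moser operator in `l`. -/
theorem IsBAPoly.cmL_eq (hP : A.IsBAPoly P) :
    A.cmL P = inL A.poly * (inX (normSqPoly N) * P) := by
  set Z := A.cmL P - inL A.poly * (inX (normSqPoly N) * P) with hZ
  have hZ' : Z = A.restL P + 2 * A.coreL P := by rw [hZ, cmL_expand]; ring
  have hV : Z ∈ A.quasiX := by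
    refine sub_mem ?_ (inL_mul_mem_quasiX _
      (inX_mul_mem_quasiX normSqPoly_mem_quasiInvariants hP.quasi))
    rw [cmL_apply, two_mul]
    have h2 : ∑ j, inL (pderiv j A.poly) * dL j P ∈ A.quasiX :=
      Submodule.sum_mem _ fun j _ => inL_mul_mem_quasiX _ (dL_mem_quasiX j hP.quasi)
    exact sub_mem (inL_mul_mem_quasiX _ (Submodule.sum_mem _ fun j _ =>
      dL_mem_quasiX j (dL_mem_quasiX j hP.quasi))) (add_mem h2 h2)
  -- `coreL` may raise the degree in `x` by one, but it kills the leading part of `P`; so `Z` has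
  -- degree at most `|m|` in `x`.
  have hcore : A.coreL P = A.coreL (P - inX A.poly * inL A.poly) := by
    rw [coreL_sub, coreL_top, sub_zero]
  have hd : Z ∈ degLT xWeight (A.totalMult + 0 + 1) := by
    rw [hZ', hcore]
    refine add_mem (sub_mem ?_ (two_mul_mem_degLT ?_)) (two_mul_mem_degLT (sub_mem ?_ ?_))
    · exact inL_mul_mem_xdeg _ (Submodule.sum_mem _ fun j _ =>
        pderiv_inr_mem_xdeg _ (pderiv_inr_mem_xdeg _ hP.mem_xdeg))
    · exact Submodule.sum_mem _ fun j _ =>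
        inL_mul_mem_xdeg _ (pderiv_inr_mem_xdeg _ hP.mem_xdeg)
    · exact inL_mul_mem_xdeg _ (Submodule.sum_mem _ fun j _ =>
        X_inl_mul_mem_xdeg _ (pderiv_inr_mem_xdeg _ hP.low))
    · rw [Finset.sum_mul]
      refine Submodule.sum_mem _ fun j _ => ?_
      rw [mul_assoc]
      exact X_inl_mul_mem_xdeg _ (inL_mul_mem_xdeg _ hP.low)
  obtain ⟨T, hT, hTe⟩ := exists_wc_eq_of_mem_quasiX hV (e := 0) hd
  obtain ⟨t, rfl⟩ := exists_inL_of_isWeightedHomogeneous_zero hT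
  -- Both products have leading part `A_m(x) A_m(l) t(l)`, so uniqueness applies to their
  -- difference.
  have hzero : inL A.poly * Z - inL t * P = 0 := by
    refine eq_zero_of_mem_quasiX
      (sub_mem (inL_mul_mem_quasiX _ hV) (inL_mul_mem_quasiX _ hP.quasi))
      (mem_degLT_of_wc_eq_zero
        (sub_mem (inL_mul_mem_xdeg _ hd) (inL_mul_mem_xdeg _ hP.mem_xdeg)) ?_)
    have h1 := (inL_xWeight A.poly).wc_mul A.totalMult Z
    have h2 := (inL_xWeight t).wc_mul A.totalMult P
    rw [zero_add] at h1 h2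
    rw [map_sub, h1, h2, hP.wc_x]
    rw [add_zero] at hTe
    rw [hTe]
    ring
  -- At `x = 0` the polynomial `P` is a nonzero constant, so the derivatives in `restL` vanish
  -- there, and `coreL` carries a factor `x_j`.
  have ht : t = 0 := by
    have h1 := congrArg (fun R => specL 0 (swapVars R)) hzero
    have h2 : specL 0 (swapVars Z) = 0 := by
      have h3 : ∀ j (R : BiPoly N), specL 0 (swapVars (pderiv (Sum.inr j) R)) =
          pderiv j (specL 0 (swapVars R)) := by
        intro j R
        rw [swapVars_pderiv]
        exact specL_pderiv _ _ _
      have h4 : ∀ j : Fin N, specL 0 (swapVars (X (Sum.inl j))) = 0 := by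
        intro j
        rw [swapVars_X_inl, specL_X_inr, Pi.zero_apply, C_0]
      rw [hZ', restL, coreL]
      simp [map_sub, map_add, map_mul, map_sum, h3, h4, hP.specL_zero_swap]
    simp only [map_sub, map_mul, h2, mul_zero, zero_sub, map_zero, neg_eq_zero, swapVars_inL,
      specL_inX, hP.specL_zero_swap] at h1
    exact (mul_eq_zero.1 h1).resolve_right ((C_injective _ _).ne_iff' C_0 |>.2 hP.ne)
  rw [ht, map_zero, zero_mul, sub_zero, mul_eq_zero] at hzero
  exact sub_eq_zero.1 (hzero.resolve_left
    ((map_ne_zero_iff _ inL_injective).2 A.poly_ne_zero))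

end HyperplaneConfig

/-! ### Wronskians along lines and uniqueness for the equation in `l`. -/

/-- Polynomials in one variable with vanishing Wronskian are proportional. -/
lemma C_leadingCoeff_mul_eq_of_derivative_mul {a b : Polynomial ℂ}
    (h : Polynomial.derivative a * b = a * Polynomial.derivative b) (hb : b ≠ 0) :
    Polynomial.C b.leadingCoeff * a = Polynomial.C (a.coeff b.natDegree) * b := by
  rw [← sub_eq_zero]
  set g := Polynomial.C b.leadingCoeff * a - Polynomial.C (a.coeff b.natDegree) * b with hg
  by_contra hne
  -- The combination `g` has no term of degree `b.natDegree`, yet its Wronskian with `b` still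
  -- vanishes. Comparing top coefficients here forces `g` and `b` to have equal degree, a
  -- contradiction unless `g = 0`.
  have hgb : (Polynomial.X * Polynomial.derivative g) * b =
      g * (Polynomial.X * Polynomial.derivative b) := by
    simp only [hg, Polynomial.derivative_sub, Polynomial.derivative_C_mul]
    linear_combination (Polynomial.X * Polynomial.C b.leadingCoeff) * h
  have hXd : ∀ f : Polynomial ℂ, (Polynomial.X * Polynomial.derivative f).natDegree ≤ f.natDegree ∧
      (Polynomial.X * Polynomial.derivative f).coeff f.natDegree =
        f.natDegree * f.leadingCoeff := by
    intro f
    have hc : ∀ n, (Polynomial.X * Polynomial.derivative f).coeff n = n * f.coeff n := by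
      intro n
      cases n with
      | zero => simp
      | succ n => rw [Polynomial.coeff_X_mul, Polynomial.coeff_derivative]; push_cast; ring
    refine ⟨Polynomial.natDegree_le_iff_coeff_eq_zero.2 fun n hn => ?_, hc _⟩
    rw [hc, Polynomial.coeff_eq_zero_of_natDegree_lt hn, mul_zero]
  have hco := congrArg (fun f => Polynomial.coeff f (g.natDegree + b.natDegree)) hgb
  rw [Polynomial.coeff_mul_add_eq_of_natDegree_le (hXd g).1 le_rfl,
    Polynomial.coeff_mul_add_eq_of_natDegree_le le_rfl (hXd b).1, (hXd g).2, (hXd b).2] at hco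
  have hgl : g.leadingCoeff ≠ 0 := Polynomial.leadingCoeff_ne_zero.2 hne
  have hbl : b.leadingCoeff ≠ 0 := Polynomial.leadingCoeff_ne_zero.2 hb
  have heq : (g.natDegree : ℂ) = b.natDegree := by
    refine mul_right_cancel₀ (mul_ne_zero hgl hbl) ?_
    simp only [Polynomial.coeff_natDegree] at hco
    linear_combination hco
  have heq' : g.natDegree = b.natDegree := by exact_mod_cast heq
  apply hgl
  rw [Polynomial.leadingCoeff, heq', hg, Polynomial.coeff_sub, Polynomial.coeff_C_mul,
    Polynomial.coeff_C_mul, Polynomial.leadingCoeff]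
  ring

lemma natDegree_alongLine_le {σ : Type*} [Fintype σ] {w : σ → ℕ} {x v : σ → ℂ}
    (hv : ∀ i, v i ≠ 0 → w i = 1) {d : ℕ} {p : MvPolynomial σ ℂ} (hp : p ∈ degLT w (d + 1)) :
    (alongLine x v p).natDegree ≤ d := by
  rw [as_sum p, map_sum]
  refine Polynomial.natDegree_sum_le_of_forall_le _ _ fun m hm => ?_
  rw [alongLine, aeval_monomial, Finsupp.prod_fintype _ _ (by simp)]
  refine Polynomial.natDegree_mul_le.trans ?_
  have h1 : (algebraMap ℂ (Polynomial ℂ) (coeff m p)).natDegree = 0 := Polynomial.natDegree_C _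
  rw [h1, zero_add]
  refine (Polynomial.natDegree_prod_le _ _).trans ?_
  have h2 := hp m (mem_support_iff.1 hm)
  rw [Finsupp.weight_apply, Finsupp.sum_fintype _ _ (by simp)] at h2
  refine (Finset.sum_le_sum fun i _ => ?_).trans (Nat.lt_succ_iff.1 h2)
  refine Polynomial.natDegree_pow_le.trans ?_
  rw [smul_eq_mul]
  refine Nat.mul_le_mul_left _ ?_
  by_cases hi : v i = 0
  · simp [hi]
  · rw [hv i hi]
    refine (Polynomial.natDegree_add_le _ _).trans (max_le (by simp) ?_)
    exact (Polynomial.natDegree_C_mul_le _ _).trans Polynomial.natDegree_X_le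

namespace HyperplaneConfig

variable {N : ℕ} {A : HyperplaneConfig N}

lemma alongLine_linForm {σ : Type*} [Fintype σ] (x v c : σ → ℂ) : alongLine x v (linForm c) =
    Polynomial.C (c ⬝ᵥ x) + Polynomial.C (c ⬝ᵥ v) * Polynomial.X := by
  simp [linForm, alongLine, dotProduct, mul_add, Finset.sum_add_distrib, Finset.sum_mul, mul_assoc]

lemma alongLine_poly {x : Fin N → ℂ} (hx : x ∈ A.regular) (l : Fin N → ℂ) :
    alongLine l x A.poly ≠ 0 ∧ (alongLine l x A.poly).natDegree = A.totalMult := by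
  have h : alongLine l x A.poly = ∏ i, (Polynomial.C (A.cvec i ⬝ᵥ l) +
      Polynomial.C (A.cvec i ⬝ᵥ x) * Polynomial.X) ^ A.mult i := by
    rw [poly_eq, map_prod]
    exact Finset.prod_congr rfl fun i _ => by rw [map_pow, alongLine_linForm]
  have hf : ∀ i, (Polynomial.C (A.cvec i ⬝ᵥ l) +
      Polynomial.C (A.cvec i ⬝ᵥ x) * Polynomial.X) ^ A.mult i ≠ 0 ∧
      ((Polynomial.C (A.cvec i ⬝ᵥ l) +
      Polynomial.C (A.cvec i ⬝ᵥ x) * Polynomial.X) ^ A.mult i).natDegree = A.mult i := by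
    intro i
    by_cases hi : A.mult i = 0
    · simp [hi]
    · have h0 := A.cvec_dotProduct_ne_zero_of_regular hx hi
      have h1 : (Polynomial.C (A.cvec i ⬝ᵥ l) +
          Polynomial.C (A.cvec i ⬝ᵥ x) * Polynomial.X).natDegree = 1 := by
        rw [add_comm]; exact Polynomial.natDegree_linear h0
      refine ⟨pow_ne_zero _ fun hz => ?_, by rw [Polynomial.natDegree_pow, h1, mul_one]⟩
      rw [hz] at h1
      simp at h1
  refine ⟨?_, ?_⟩
  · rw [h]; exact Finset.prod_ne_zero_iff.2 fun i _ => (hf i).1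
  · rw [h, Polynomial.natDegree_prod _ _ fun i _ => (hf i).1]
    exact Finset.sum_congr rfl fun i _ => (hf i).2

lemma alongLine_inL (x l v : Fin N → ℂ) (p : MvPolynomial (Fin N) ℂ) :
    alongLine (Sum.elim x l) (Sum.elim 0 v) (inL p) = alongLine l v p := by
  rw [alongLine, inL, aeval_rename]; rfl

lemma alongLine_X_inl (x l v : Fin N → ℂ) (j : Fin N) :
    alongLine (Sum.elim x l) (Sum.elim 0 v) (X (Sum.inl j)) = Polynomial.C (x j) := by
  simp [alongLine]

/-- On the line `l + t x`, the equation `coreL T = 0` says that `T` and `A_m` have vanishing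
Wronskian in `t`. Regularity of `x` makes the degree of `A_m` in `t` exactly `|m|`. -/
lemma alongLine_proportional {T : BiPoly N} (hcore : A.coreL T = 0) {x : Fin N → ℂ}
    (hx : x ∈ A.regular) (l : Fin N → ℂ) :
    Polynomial.C (alongLine l x A.poly).leadingCoeff *
        alongLine (Sum.elim x l) (Sum.elim 0 x) T =
      Polynomial.C ((alongLine (Sum.elim x l) (Sum.elim 0 x) T).coeff A.totalMult) *
        alongLine l x A.poly := by
  obtain ⟨hb, hdeg⟩ := alongLine_poly hx l
  have h := C_leadingCoeff_mul_eq_of_derivative_mul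
    (a := alongLine (Sum.elim x l) (Sum.elim 0 x) T) (b := alongLine l x A.poly) ?_ hb
  · rwa [hdeg] at h
  · have h1 := congrArg (alongLine (Sum.elim x l) (Sum.elim 0 x)) hcore
    rw [coreL, map_sub, map_mul, map_mul, map_sum, map_sum, map_zero, sub_eq_zero] at h1
    simp only [map_mul, alongLine_inL, alongLine_X_inl] at h1
    rw [derivative_alongLine, derivative_alongLine, dirD_apply, dirD_apply]
    simp only [map_sum, map_smul, Fintype.sum_sum_type, Sum.elim_inl, Sum.elim_inr, Pi.zero_apply,
      zero_smul, Finset.sum_const_zero, zero_add, Polynomial.smul_eq_C_mul]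
    linear_combination h1

/-- `restL` lowers the degree in `l` by one more than `coreL` does, so nothing can cancel the top
component of `coreL R`. -/
lemma coreL_wc_eq_zero {R : BiPoly N} {k M : ℕ} (hM : A.totalMult = M + 1)
    (hR : R ∈ degLT lWeight (k + 1)) (h : A.restL R + 2 * A.coreL R = 0) :
    A.coreL (weightedHomogeneousComponent lWeight k R) = 0 := by
  have hal : IsWeightedHomogeneous lWeight (inL A.poly) (M + 1) := by
    rw [← hM]; exact inL_lWeight A.isWeightedHomogeneous_poly
  have haj : ∀ j, IsWeightedHomogeneous lWeight (inL (pderiv j A.poly)) M := fun j => by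
    refine inL_lWeight (A.isWeightedHomogeneous_poly.pderiv ?_)
    rw [hM]; rfl
  set T := weightedHomogeneousComponent lWeight k R with hT
  have hR' : R - T ∈ degLT lWeight k := sub_wc_mem_degLT hR
  have htwo : (2 : BiPoly N) ≠ 0 := two_ne_zero
  cases k with
  | zero =>
    have h1 : R = T := sub_eq_zero.1 (eq_zero_of_mem_degLT_zero hR')
    have h2 : ∀ j, pderiv (Sum.inr j) R = 0 := fun j =>
      eq_zero_of_mem_degLT_zero (pderiv_mem_degLT (w := lWeight) _ hR)
    rw [← h1]
    have h3 : A.restL R = 0 := by simp [restL, h2]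
    rw [h3, zero_add] at h
    exact (mul_eq_zero.1 h).resolve_left htwo
  | succ k =>
    have hd : ∀ j, pderiv (Sum.inr j) R ∈ degLT lWeight (k + 1) := fun j =>
      pderiv_mem_degLT (w := lWeight) _ hR
    have hdd : ∀ j, pderiv (Sum.inr j) (pderiv (Sum.inr j) R) ∈ degLT lWeight k := fun j =>
      pderiv_mem_degLT (w := lWeight) _ (hd j)
    have hrest : A.restL R ∈ degLT lWeight (M + 1 + k) := by
      refine sub_mem (hal.mul_mem_degLT (Submodule.sum_mem _ fun j _ => hdd j))
        (two_mul_mem_degLT (Submodule.sum_mem _ fun j _ => ?_))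
      exact degLT_mono (by omega) ((haj j).mul_mem_degLT (hd j))
    have hcore' : A.coreL (R - T) ∈ degLT lWeight (M + 1 + k) := by
      refine sub_mem (hal.mul_mem_degLT (Submodule.sum_mem _ fun j _ =>
        X_inl_mul_mem_ldeg _ (pderiv_mem_degLT (w := lWeight) _ hR'))) ?_
      rw [Finset.sum_mul]
      refine Submodule.sum_mem _ fun j _ => ?_
      rw [mul_assoc]
      exact X_inl_mul_mem_ldeg _ (degLT_mono (by omega) ((haj j).mul_mem_degLT hR'))
    have hTh : IsWeightedHomogeneous lWeight T (k + 1) :=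
      weightedHomogeneousComponent_isWeightedHomogeneous _ _
    have hXl : ∀ j : Fin N, IsWeightedHomogeneous lWeight (X (Sum.inl j) : BiPoly N) 0 :=
      fun j => isWeightedHomogeneous_X ℂ lWeight (Sum.inl j)
    have hcoreT : IsWeightedHomogeneous lWeight (A.coreL T) (M + 1 + k) := by
      refine IsWeightedHomogeneous.sub (hal.mul (IsWeightedHomogeneous.sum _ _ _ fun j _ => ?_)) ?_
      · simpa using (hXl j).mul (hTh.pderiv (i := Sum.inr j) (n' := k) rfl)
      · have h1 : IsWeightedHomogeneous lWeight
            (∑ j, X (Sum.inl j) * inL (pderiv j A.poly) : BiPoly N) M :=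
          IsWeightedHomogeneous.sum _ _ _ fun j _ => by simpa using (hXl j).mul (haj j)
        have h2 := h1.mul hTh
        rwa [show M + (k + 1) = M + 1 + k by ring] at h2
    have hmem : A.coreL T ∈ degLT lWeight (M + 1 + k) := by
      have h1 : (2 : BiPoly N) * A.coreL T = -(A.restL R) - 2 * A.coreL (R - T) := by
        rw [coreL_sub]
        linear_combination h
      have h2 : (2 : BiPoly N) * A.coreL T ∈ degLT lWeight (M + 1 + k) := by
        rw [h1]
        exact sub_mem (neg_mem hrest) (two_mul_mem_degLT hcore')
      have h3 : A.coreL T = (2⁻¹ : ℂ) • (2 * A.coreL T) := by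
        rw [show (2 : BiPoly N) = C 2 from (map_ofNat C 2).symm, ← smul_eq_C_mul, smul_smul]
        norm_num
      rw [h3]
      exact Submodule.smul_mem _ _ h2
    rw [← hcoreT.weightedHomogeneousComponent_same]
    exact wc_eq_zero_of_mem_degLT hmem le_rfl

lemma restL_add_coreL_of_cmL {R : BiPoly N}
    (h : A.cmL R = inL A.poly * (inX (normSqPoly N) * R)) : A.restL R + 2 * A.coreL R = 0 := by
  rw [cmL_expand] at h
  linear_combination h

/-- Uniqueness of eigenfunctions of the Calogero-Moser operator in `l` of small degree in `l`. -/
lemma eq_zero_of_cmL {R : BiPoly N} (h : A.cmL R = inL A.poly * (inX (normSqPoly N) * R))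
    (hR : R ∈ degLT lWeight A.totalMult) : R = 0 := by
  suffices hk : ∀ k ≤ A.totalMult, R ∈ degLT lWeight k → R = 0 from hk _ le_rfl hR
  intro k
  induction k with
  | zero => exact fun _ => eq_zero_of_mem_degLT_zero
  | succ k ih =>
    intro hk hRk
    refine ih (by omega) (mem_degLT_of_wc_eq_zero hRk ?_)
    obtain ⟨M, hM⟩ : ∃ M, A.totalMult = M + 1 := ⟨A.totalMult - 1, by omega⟩
    have hcore := coreL_wc_eq_zero hM hRk (restL_add_coreL_of_cmL h)
    have hT := (weightedHomogeneousComponent_isWeightedHomogeneous (w := lWeight) k R).mem_degLT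
    refine eq_zero_of_eval_eq_zero_of_ne ((map_ne_zero_iff _ inX_injective).2 A.poly_ne_zero)
      fun y hy => ?_
    rw [← Sum.elim_comp_inl_inr y] at hy ⊢
    rw [eval_inX] at hy
    -- On the line, the component has degree below `|m|` but is proportional to a polynomial of
    -- degree exactly `|m|`, so it vanishes.
    have h1 := alongLine_proportional hcore hy (y ∘ Sum.inr)
    rw [Polynomial.coeff_eq_zero_of_natDegree_lt, Polynomial.C_0, zero_mul, mul_eq_zero,
      Polynomial.C_eq_zero, Polynomial.leadingCoeff_eq_zero] at h1
    · have h2 := congrArg (Polynomial.eval 0) (h1.resolve_left (alongLine_poly hy _).1)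
      rwa [eval_alongLine, zero_smul, add_zero, Polynomial.eval_zero] at h2
    · refine lt_of_le_of_lt (natDegree_alongLine_le (w := lWeight) (fun i hi => ?_) hT)
        (Nat.lt_of_succ_le hk)
      cases i with
      | inl j => exact absurd rfl hi
      | inr j => rfl

end HyperplaneConfig

/-! ### The equation in `x` and the symmetry. -/

namespace HyperplaneConfig

variable {N : ℕ} {A : HyperplaneConfig N} {P : BiPoly N}

lemma eval_smul_of_isWeightedHomogeneous {σ : Type*} [Fintype σ] {w : σ → ℕ} {d : ℕ}
    {p : MvPolynomial σ ℂ} (hp : IsWeightedHomogeneous w p d) (u : ℂ) (y : σ → ℂ) :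
    eval (fun i => u ^ w i * y i) p = u ^ d * eval y p := by
  rw [eval_eq', eval_eq', Finset.mul_sum]
  refine Finset.sum_congr rfl fun m hm => ?_
  have h := hp (mem_support_iff.1 hm)
  rw [Finsupp.weight_apply, Finsupp.sum_fintype _ _ (by simp)] at h
  simp only [mul_pow, Finset.prod_mul_distrib, ← pow_mul]
  rw [Finset.prod_pow_eq_pow_sum, ← h]
  simp only [smul_eq_mul, mul_comm (w _)]
  ring

lemma eval_poly_smul (u : ℂ) (l : Fin N → ℂ) :
    eval (u • l) A.poly = u ^ A.totalMult * eval l A.poly := by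
  rw [← eval_smul_of_isWeightedHomogeneous A.isWeightedHomogeneous_poly]
  congr 2
  funext i
  simp

lemma eval_smul_right {T : BiPoly N} {d : ℕ} (hT : IsWeightedHomogeneous lWeight T d) (u : ℂ)
    (x l : Fin N → ℂ) :
    eval (Sum.elim x (u • l)) T = u ^ d * eval (Sum.elim x l) T := by
  rw [← eval_smul_of_isWeightedHomogeneous hT]
  congr 2
  funext i
  cases i <;> simp [lWeight]

/-- The restriction of a polynomial in two sets of variables to the diagonal. -/
def diag : BiPoly N →ₐ[ℂ] MvPolynomial (Fin N) ℂ := aeval (Sum.elim X X)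

lemma eval_diag (x : Fin N → ℂ) (R : BiPoly N) : eval x (diag R) = eval (Sum.elim x x) R := by
  rw [← aeval_eq_eval_apply, diag, ← AlgHom.comp_apply, comp_aeval, ← aeval_eq_eval_apply]
  congr 2
  funext i
  cases i <;> simp

/-- The quotient `T / A_m(l)` is homogeneous of degree zero in `l` and invariant under `l ↦ l + s
x`; as `s` grows, its argument tends to the direction of `x`. -/
lemma inX_poly_mul_eq_of_coreL {T : BiPoly N} (hT : IsWeightedHomogeneous lWeight T A.totalMult)
    (hcore : A.coreL T = 0) : inX A.poly * T = inX (diag T) * inL A.poly := by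
  have hax : inX A.poly ≠ 0 := (map_ne_zero_iff _ inX_injective).2 A.poly_ne_zero
  rw [← sub_eq_zero]
  refine eq_zero_of_eval_eq_zero_of_ne hax fun y hy => ?_
  rw [← Sum.elim_comp_inl_inr y] at hy ⊢
  rw [eval_inX] at hy
  generalize y ∘ Sum.inl = x at hy
  generalize y ∘ Sum.inr = l
  have hx : x ∈ A.regular := hy
  have hlin : ∀ s : ℂ, eval (Sum.elim x (l + s • x)) T * eval l A.poly =
      eval (Sum.elim x l) T * eval (l + s • x) A.poly := by
    intro s
    have h1 := alongLine_proportional hcore hx l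
    have hev : ∀ t : ℂ, (alongLine l x A.poly).leadingCoeff *
        eval (Sum.elim x (l + t • x)) T =
        (alongLine (Sum.elim x l) (Sum.elim 0 x) T).coeff A.totalMult *
          eval (l + t • x) A.poly := by
      intro t
      have h2 := congrArg (Polynomial.eval t) h1
      rw [Polynomial.eval_mul, Polynomial.eval_mul, Polynomial.eval_C, Polynomial.eval_C,
        eval_alongLine, eval_alongLine] at h2
      rw [← h2]
      congr 3
      funext i
      cases i <;> simp
    have h0 := hev 0
    rw [zero_smul, add_zero] at h0
    refine mul_left_cancel₀
      (Polynomial.leadingCoeff_ne_zero.2 (alongLine_poly hx l).1) ?_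
    linear_combination eval l A.poly * hev s - eval (l + s • x) A.poly * h0
  -- With `u = 1 / s`, homogeneity makes both sides polynomial in `u`, so the identity extends to `u
  -- = 0`.
  have hu : (fun u : ℂ => eval (Sum.elim x (u • l + x)) T * eval l A.poly) =
      fun u => eval (Sum.elim x l) T * eval (u • l + x) A.poly := by
    refine Continuous.ext_on (dense_compl_singleton (0 : ℂ)) ?_ ?_ fun u hu => ?_
    · refine ((MvPolynomial.continuous_eval T).comp ?_).mul continuous_const
      refine continuous_pi fun i => ?_
      cases i with
      | inl j => exact continuous_const
      | inr j =>
        exact (continuous_apply j).comp ((continuous_id.smul continuous_const).add continuous_const)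
    · exact continuous_const.mul ((MvPolynomial.continuous_eval A.poly).comp
        ((continuous_id.smul continuous_const).add continuous_const))
    · have h1 := hlin u⁻¹
      have h2 : u • l + x = u • (l + u⁻¹ • x) := by
        rw [smul_add, smul_smul, mul_inv_cancel₀ hu, one_smul]
      simp only [h2, eval_poly_smul, eval_smul_right hT]
      linear_combination u ^ A.totalMult * h1
  have h := congrFun hu 0
  simp only [zero_smul, zero_add] at h
  rw [map_sub, map_mul, map_mul, eval_inX, eval_inX, eval_inL, eval_diag, sub_eq_zero, mul_comm,
    ← h]

/-- For one hyperplane, the only term not visibly divisible by `(α, x)^{m_α}` is a multiple of `(α,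
x)^{m_α - 1} ∂_α R`, and the first-order condition supplies the missing factor. -/
lemma inX_poly_dvd_cmX {R : BiPoly N} (hR : R ∈ A.quasiX) : inX A.poly ∣ A.cmX R := by
  classical
  rw [cmX_apply]
  refine dvd_sub (dvd_mul_right _ _) (Dvd.dvd.mul_left ?_ _)
  rw [inX_poly]
  refine prod_pow_dvd_of_prime _ _ _ A.prime_xForm (fun _ _ => A.xForm_not_dvd) fun i _ => ?_
  obtain ⟨B, hB⟩ : linForm (A.cvec i) ^ A.mult i ∣ A.poly :=
    Finset.dvd_prod_of_mem (fun i => linForm (A.cvec i) ^ A.mult i) (Finset.mem_univ i)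
  cases hm : A.mult i with
  | zero => rw [pow_zero]; exact one_dvd _
  | succ m =>
    rw [hm] at hB
    obtain ⟨r, hr⟩ := hR i 0 (by omega)
    rw [mul_zero, zero_add, pow_one, dAlpha_eq_sum, LinearMap.sum_apply] at hr
    have h1 : ∀ j, inX (pderiv j A.poly) * dX j R =
        A.xForm i ^ (m + 1) * (inX (pderiv j B) * dX j R) +
        A.xForm i ^ m * ((m : BiPoly N) + 1) * inX B * ((A.cvec i j • dX j) R) := by
      intro j
      have h2 : pderiv j (linForm (A.cvec i)) = C (A.cvec i j) := by
        rw [← dirD_single, dirD_linForm, dotProduct_single, mul_one]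
      have h3 : inX (C (A.cvec i j) : MvPolynomial (Fin N) ℂ) = C (A.cvec i j) := rename_C _ _
      rw [hB, Derivation.leibniz, pderiv_pow, h2, LinearMap.smul_apply, smul_eq_C_mul, xForm_eq]
      simp only [smul_eq_mul, map_add, map_mul, map_pow, map_natCast, h3, Nat.add_sub_cancel]
      push_cast
      ring
    rw [Finset.sum_congr rfl fun j _ => h1 j, Finset.sum_add_distrib, ← Finset.mul_sum,
      ← Finset.mul_sum, hr]
    refine dvd_add (dvd_mul_right _ _) ⟨((m : BiPoly N) + 1) * inX B * r, ?_⟩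
    ring

lemma poly_eq_one_of_totalMult (hM : A.totalMult = 0) : A.poly = 1 := by
  rw [poly_eq]
  refine Finset.prod_eq_one fun i _ => ?_
  have h : A.mult i = 0 := (Finset.sum_eq_zero_iff.1 hM) i (Finset.mem_univ i)
  rw [h, pow_zero]

lemma cmX_one (hA : A.poly = 1) : A.cmX 1 = inL (normSqPoly N) := by
  have h : ∀ j : Fin N, dX j (dX j 1) = X (Sum.inr j) ^ 2 := by
    intro j
    rw [dX_apply, dX_apply]
    simp only [map_add, Derivation.leibniz, pderiv_inl_X_inr, map_zero,
      Derivation.map_one_eq_zero, smul_eq_mul]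
    ring
  simp only [cmX_apply, hA, map_one, h, Derivation.map_one_eq_zero, map_zero, zero_mul,
    Finset.sum_const_zero, mul_zero, sub_zero, one_mul, normSqPoly, map_sum, map_pow, inL_X]

/-- The Baker-Akhiezer function is an eigenfunction of the Calogero-Moser operator in `x`. -/
theorem IsBAPoly.cmX_eq (hP : A.IsBAPoly P) :
    A.cmX P = inX A.poly * (inL (normSqPoly N) * P) := by
  have hax : inX A.poly ≠ 0 := (map_ne_zero_iff _ inX_injective).2 A.poly_ne_zero
  rcases Nat.eq_zero_or_eq_succ_pred A.totalMult with hM | hM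
  · have hA := poly_eq_one_of_totalMult hM
    have h := hP.low
    rw [hM, hA, map_one, map_one, one_mul] at h
    have hP1 : P = 1 := sub_eq_zero.1 (eq_zero_of_mem_degLT_zero h)
    rw [hP1, cmX_one hA, hA, map_one, one_mul, mul_one]
  set U : BiPoly N := P - inX A.poly * inL A.poly with hU
  have hPU : P = U + inX A.poly * inL A.poly := by rw [hU]; ring
  obtain ⟨Y, hY⟩ := inX_poly_dvd_cmX hP.quasi
  set R := inL (normSqPoly N) * P - Y with hR
  have haxR : inX A.poly * R = inX A.poly * (inL (normSqPoly N) * P) - A.cmX P := by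
    rw [hR, hY]; ring
  -- The two operators commute, and their commutators with `x²` and `l²` agree on `P` since `eulerX
  -- P = eulerL P`. Hence the defect `R` solves the same equation in `l` as `P`.
  have heq : A.cmL R = inL A.poly * (inX (normSqPoly N) * R) := by
    refine mul_left_cancel₀ hax ?_
    rw [← cmL_inX_mul, haxR, map_sub, cmL_inX_mul, cmL_normSq_mul, ← cmX_cmL, hP.cmL_eq,
      cmX_inL_mul, cmX_normSq_mul, hP.eulerX_eq]
    linear_combination (-(inL A.poly * inX (normSqPoly N))) * haxR
  have hPl : P ∈ degLT lWeight (A.totalMult + 1) := by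
    have h1 := ((inX_lWeight A.poly).mul (inL_lWeight A.isWeightedHomogeneous_poly)).mem_degLT
    rw [zero_add] at h1
    rw [hPU]
    exact add_mem (degLT_mono (Nat.le_succ _) hP.low_l) h1
  have hRl : R ∈ degLT lWeight (A.totalMult + 1) := by
    refine (inX_lWeight A.poly).mem_degLT_of_mul_mem hax (d := A.totalMult + 1) ?_
    rw [zero_add]
    have hexp : inX A.poly * R = swapVars (-(A.restL (swapVars P) + 2 * A.coreL (swapVars P))) := by
      rw [haxR, show -(A.restL (swapVars P) + 2 * A.coreL (swapVars P)) =
        inL A.poly * (inX (normSqPoly N) * swapVars P) - A.cmL (swapVars P) by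
          rw [cmL_expand]; ring]
      rw [map_sub, map_mul, map_mul, swapVars_inL, swapVars_inX, swapVars_swapVars, swapVars_cmL,
        swapVars_swapVars]
    -- Terms of degree `|m| + 1` in `l` could come only from the leading part of `P`, which `coreL`
    -- kills.
    have hsw : A.coreL (swapVars P) = A.coreL (swapVars U) := by
      have : swapVars U = swapVars P - inX A.poly * inL A.poly := by
        rw [hU, map_sub, map_mul, swapVars_inL, swapVars_inX, mul_comm (inL A.poly)]
      rw [this, coreL_sub, coreL_top, sub_zero]
    rw [hexp, hsw]
    simp only [restL, coreL, map_neg, map_add, map_sub, map_mul, map_sum, swapVars_inL,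
      swapVars_X_inl, swapVars_pderiv, swapVars_swapVars, Sum.swap_inr, map_ofNat]
    refine neg_mem (add_mem (sub_mem ?_ (two_mul_mem_degLT ?_))
      (two_mul_mem_degLT (sub_mem ?_ ?_)))
    · exact inX_mul_mem_ldeg _ (Submodule.sum_mem _ fun j _ =>
        pderiv_inl_mem_ldeg _ (pderiv_inl_mem_ldeg _ hPl))
    · exact Submodule.sum_mem _ fun j _ => inX_mul_mem_ldeg _ (pderiv_inl_mem_ldeg _ hPl)
    · exact inX_mul_mem_ldeg _ (Submodule.sum_mem _ fun j _ =>
        X_inr_mul_mem_ldeg _ (pderiv_inl_mem_ldeg _ hP.low_l))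
    · rw [Finset.sum_mul]
      refine Submodule.sum_mem _ fun j _ => ?_
      rw [mul_assoc]
      exact X_inr_mul_mem_ldeg _ (inX_mul_mem_ldeg _ hP.low_l)
  set T := weightedHomogeneousComponent lWeight A.totalMult R with hTdef
  have hTh : IsWeightedHomogeneous lWeight T A.totalMult :=
    weightedHomogeneousComponent_isWeightedHomogeneous _ _
  have hTe := inX_poly_mul_eq_of_coreL hTh
    (coreL_wc_eq_zero hM hRl (restL_add_coreL_of_cmL heq))
  -- The components of degree `|m|` in `l` cancel by `hTe`, so uniqueness for the equation in `l`
  -- applies.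
  have hzero : inX (A.poly ^ 2) * R - inX (diag T) * P = 0 := by
    refine eq_zero_of_cmL (A := A) ?_ ?_
    · rw [map_sub, cmL_inX_mul, cmL_inX_mul, heq, hP.cmL_eq]
      ring
    · have hsplit : inX (A.poly ^ 2) * R - inX (diag T) * P =
          inX (A.poly ^ 2) * (R - T) - inX (diag T) * U := by
        rw [hPU, map_pow]
        linear_combination inX A.poly * hTe
      rw [hsplit]
      exact sub_mem (inX_mul_mem_ldeg _ (sub_wc_mem_degLT hRl)) (inX_mul_mem_ldeg _ hP.low_l)
  -- At `l = 0`, both `l²` and the derivatives of the constant `P(x, 0)` vanish.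
  have hR0 : specL 0 R = 0 := by
    have h := congrArg (specL 0) haxR
    have h1 : ∀ j, specL 0 (dX j P) = 0 := fun j => by
      rw [specL_dX, hP.specL_zero]; simp
    have h2 : ∀ j, specL 0 (dX j (dX j P)) = 0 := fun j => by
      rw [specL_dX, h1]; simp
    have h3 : eval 0 (normSqPoly N) = 0 := by simp [normSqPoly]
    simp only [cmX_apply, map_sub, map_mul, map_sum, h1, h2, specL_inL, h3, C_0, specL_inX,
      mul_zero, zero_mul, Finset.sum_const_zero, sub_zero] at h
    exact (mul_eq_zero.1 h).resolve_left A.poly_ne_zero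
  have hdiag : diag T = 0 := by
    have h := congrArg (specL 0) hzero
    rw [map_sub, map_mul, map_mul, hR0, mul_zero, zero_sub, map_zero, neg_eq_zero, specL_inX,
      hP.specL_zero] at h
    exact (mul_eq_zero.1 h).resolve_right ((C_injective _ _).ne_iff' C_0 |>.2 hP.ne)
  rw [hdiag, map_zero, zero_mul, sub_zero, map_pow] at hzero
  have hRz : R = 0 := (mul_eq_zero.1 hzero).resolve_left (pow_ne_zero _ hax)
  rw [hRz, mul_zero] at haxR
  exact (sub_eq_zero.1 haxR.symm).symm

/-- The Baker-Akhiezer function is symmetric. -/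
theorem IsBAPoly.swapVars_eq (hP : A.IsBAPoly P) : swapVars P = P := by
  rw [← sub_eq_zero]
  refine eq_zero_of_cmL (A := A) ?_ ?_
  · have h := congrArg swapVars hP.cmX_eq
    rw [swapVars_cmX, map_mul, map_mul, swapVars_inX, swapVars_inL] at h
    rw [map_sub, h, hP.cmL_eq]
    ring
  -- The leading part is symmetric and cancels from the difference.
  · have h1 : swapVars P - P = swapVars (P - inX A.poly * inL A.poly) -
        (P - inX A.poly * inL A.poly) := by
      rw [map_sub, map_mul, swapVars_inX, swapVars_inL]
      ring
    rw [h1]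
    exact sub_mem (swapVars_mem_ldeg hP.low) hP.low_l

end HyperplaneConfig

/-! ### Differential operators in `l` with polynomial coefficients. -/

section OperatorPowers

variable {N : ℕ} {M M₂ : Type*} [AddCommGroup M] [Module ℂ M] [AddCommGroup M₂] [Module ℂ M₂]

/-- The ordered monomial `T_1^{ν_1} ⋯ T_N^{ν_N}` in a family of operators. -/
def opPow (T : Fin N → Module.End ℂ M) (ν : Fin N →₀ ℕ) : Module.End ℂ M :=
  ((List.finRange N).map fun j => T j ^ ν j).prod

lemma opPow_apply (T : Fin N → Module.End ℂ M) (ν : Fin N →₀ ℕ) (r : M) :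
    opPow T ν r = (List.finRange N).foldr (fun j s => (T j ^ ν j) s) r := by
  unfold opPow
  induction List.finRange N with
  | nil => rfl
  | cons j t ih =>
    rw [List.map_cons, List.prod_cons, Module.End.mul_apply, ih, List.foldr_cons]

/-- Induction along the factors of `opPow T ν`. -/
lemma opPow_induction {T : Fin N → Module.End ℂ M} (C : (Fin N → ℕ) → M → Prop) {r : M}
    (h0 : C 0 r) (hT : ∀ k s j, C k s → C (k + Pi.single j 1) (T j s)) (ν : Fin N →₀ ℕ) :
    C ν (opPow T ν r) := by
  have hpow : ∀ j n k s, C k s → C (k + Pi.single j n) ((T j ^ n) s) := by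
    intro j n
    induction n with
    | zero => intro k s hs; simpa using hs
    | succ n ih =>
      intro k s hs
      have h := hT _ _ j (ih k s hs)
      rw [pow_succ', Module.End.mul_apply, Pi.single_add, ← add_assoc]
      exact h
  have hlist : ∀ t : List (Fin N),
      C ((t.map fun j => Pi.single j (ν j)).sum) (t.foldr (fun j s => (T j ^ ν j) s) r) := by
    intro t
    induction t with
    | nil => exact h0
    | cons j t ih =>
      rw [List.map_cons, List.sum_cons, add_comm]
      exact hpow _ _ _ _ ih
  rw [opPow_apply]
  have h := hlist (List.finRange N)
  rw [← Fin.sum_univ_def, Finset.univ_sum_single] at h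
  exact h

lemma opPow_intertwine {T : Fin N → Module.End ℂ M} {T' : Fin N → Module.End ℂ M₂} (f : M → M₂)
    (h : ∀ j r, f (T j r) = T' j (f r)) (ν : Fin N →₀ ℕ) (r : M) :
    f (opPow T ν r) = opPow T' ν (f r) := by
  have hpow : ∀ j n s, f ((T j ^ n) s) = (T' j ^ n) (f s) := by
    intro j n
    induction n with
    | zero => intro s; rfl
    | succ n ih =>
      intro s
      rw [pow_succ, Module.End.mul_apply, ih, h, pow_succ, Module.End.mul_apply]
  rw [opPow_apply, opPow_apply]
  induction List.finRange N with
  | nil => rfl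
  | cons j t ih => rw [List.foldr_cons, List.foldr_cons, hpow, ih]

lemma twistMulti_eq (g : MvPolynomial (Fin N) ℂ) (ν : Fin N →₀ ℕ) (p : MvPolynomial (Fin N) ℂ) :
    twistMulti g ν p = opPow (fun j => twist (pderiv j) (pderiv j g)) ν p := by
  rw [opPow_apply, twistMulti]

end OperatorPowers

section OperatorsInL

variable {N : ℕ}

/-- The operator `∑_ν a_ν(l) ∂^ν` in `l`, conjugated by `exp (x, l)`. -/
def opL (a : (Fin N →₀ ℕ) →₀ MvPolynomial (Fin N) ℂ) (R : BiPoly N) : BiPoly N :=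
  a.sum fun ν c => inL c * opPow dL ν R

lemma opL_add_left (a b : (Fin N →₀ ℕ) →₀ MvPolynomial (Fin N) ℂ) (R : BiPoly N) :
    opL (a + b) R = opL a R + opL b R :=
  Finsupp.sum_add_index' (fun _ => by rw [map_zero, zero_mul])
    fun _ _ _ => by rw [map_add, add_mul]

lemma opL_smul_left (p : MvPolynomial (Fin N) ℂ) (a : (Fin N →₀ ℕ) →₀ MvPolynomial (Fin N) ℂ)
    (R : BiPoly N) : opL (p • a) R = inL p * opL a R := by
  rw [opL, Finsupp.sum_smul_index' fun _ => by rw [map_zero, zero_mul], opL, Finsupp.mul_sum]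
  exact Finsupp.sum_congr fun ν _ => by rw [smul_eq_mul, map_mul, mul_assoc]

lemma opL_single (ν : Fin N →₀ ℕ) (c : MvPolynomial (Fin N) ℂ) (R : BiPoly N) :
    opL (Finsupp.single ν c) R = inL c * opPow dL ν R :=
  Finsupp.sum_single_index (by rw [map_zero, zero_mul])

lemma opL_zero_left (R : BiPoly N) : opL 0 R = 0 := Finsupp.sum_zero_index

lemma opL_sum_right {ι : Type*} (a : (Fin N →₀ ℕ) →₀ MvPolynomial (Fin N) ℂ) (s : Finset ι)
    (R : ι → BiPoly N) : opL a (∑ i ∈ s, R i) = ∑ i ∈ s, opL a (R i) := by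
  simp only [opL, Finsupp.sum, map_sum, Finset.mul_sum]
  exact Finset.sum_comm

lemma opL_smul_right (a : (Fin N →₀ ℕ) →₀ MvPolynomial (Fin N) ℂ) (c : ℂ) (R : BiPoly N) :
    opL a (c • R) = c • opL a R := by
  simp only [opL, Finsupp.sum, map_smul, Finset.smul_sum, mul_smul_comm]

lemma opL_inX_mul (a : (Fin N →₀ ℕ) →₀ MvPolynomial (Fin N) ℂ) (p : MvPolynomial (Fin N) ℂ)
    (R : BiPoly N) : opL a (inX p * R) = inX p * opL a R := by
  rw [opL, opL, Finsupp.mul_sum]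
  refine Finsupp.sum_congr fun ν _ => ?_
  rw [← opPow_intertwine (T := dL) (T' := dL) (fun R => inX p * R)
    fun j R => (dL_inX_mul j p R).symm]
  ring

lemma monomial_eq_inX_mul_inL (m : Fin N ⊕ Fin N →₀ ℕ) (c : ℂ) :
    monomial m c = inL (monomial (Finsupp.equivFunOnFinite.symm (m ∘ Sum.inr)) c) *
      inX (monomial (Finsupp.equivFunOnFinite.symm (m ∘ Sum.inl)) 1) := by
  refine MvPolynomial.funext fun y => ?_
  rw [← Sum.elim_comp_inl_inr y, map_mul, eval_inL, eval_inX, eval_monomial, eval_monomial,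
    eval_monomial, Finsupp.prod_fintype _ _ (by simp), Finsupp.prod_fintype _ _ (by simp),
    Finsupp.prod_fintype _ _ (by simp), Fintype.prod_sum_type]
  simp only [Sum.elim_inl, Sum.elim_inr, Finsupp.equivFunOnFinite_symm_apply_apply,
    Function.comp_apply]
  ring

/-- The summand `∂/∂l_j` of `dL j` does not raise the degree in `x`, so leading parts see only the
multiplication by `x_j`. -/
lemma opPow_dL_sub_mem {d : ℕ} {R T : BiPoly N} (hT : IsWeightedHomogeneous xWeight T d)
    (hR : R - T ∈ degLT xWeight d) (ν : Fin N →₀ ℕ) :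
    opPow dL ν R - inX (monomial ν 1) * T ∈ degLT xWeight (∑ j, ν j + d) := by
  have h := opPow_induction (T := dL) (r := R)
    (fun k S => ∃ T', T' = inX (∏ j, X j ^ k j) * T ∧
      IsWeightedHomogeneous xWeight T' (∑ j, k j + d) ∧
      S - T' ∈ degLT xWeight (∑ j, k j + d))
    ⟨T, by simp, by simpa using hT, by simpa using hR⟩ (by
      rintro k S j ⟨T', hT', hh, hS⟩
      have hk : ∑ i, (k + Pi.single j 1 : Fin N → ℕ) i + d = ∑ i, k i + d + 1 := by
        simp [Finset.sum_add_distrib]; ring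
      refine ⟨X (Sum.inl j) * T', ?_, ?_, ?_⟩
      · have : ∏ i, (X i : MvPolynomial (Fin N) ℂ) ^ (k + Pi.single j 1 : Fin N → ℕ) i =
            X j * ∏ i, X i ^ k i := by
          simp only [Pi.add_apply, pow_add, Finset.prod_mul_distrib]
          rw [mul_comm, Finset.prod_eq_single j (fun i _ hi => by simp [hi]) (by simp)]
          simp
        rw [this, hT', map_mul, HyperplaneConfig.inX_X]
        ring
      · rw [hk, add_comm _ 1]
        exact (isWeightedHomogeneous_X ℂ xWeight (Sum.inl j)).mul hh
      · rw [hk]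
        have : dL j S - X (Sum.inl j) * T' =
            (pderiv (Sum.inr j) (S - T') + X (Sum.inl j) * (S - T')) +
              pderiv (Sum.inr j) T' := by
          rw [dL_apply, map_sub]; ring
        rw [this]
        exact add_mem (add_mem (degLT_mono (Nat.le_succ _) (pderiv_inr_mem_xdeg _ hS))
          (X_inl_mul_mem_xdeg _ hS)) (pderiv_inr_mem_xdeg _ hh.mem_degLT)) ν
  obtain ⟨T', hT', _, hS⟩ := h
  have hm : (monomial ν 1 : MvPolynomial (Fin N) ℂ) = ∏ j, X j ^ ν j := by
    rw [monomial_eq, C_1, one_mul, Finsupp.prod_fintype _ _ (by simp)]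
  rwa [hm, ← hT']

end OperatorsInL

/-! ### Generation of quasi-invariants from the Baker-Akhiezer function. -/

namespace HyperplaneConfig

variable {N : ℕ} {A : HyperplaneConfig N} {P : BiPoly N}

lemma opL_mem_quasiX (a : (Fin N →₀ ℕ) →₀ MvPolynomial (Fin N) ℂ) {R : BiPoly N}
    (hR : R ∈ A.quasiX) : opL a R ∈ A.quasiX :=
  Submodule.sum_mem _ fun ν _ => inL_mul_mem_quasiX _
    (opPow_induction (fun _ S => S ∈ A.quasiX) hR (fun _ _ j hS => dL_mem_quasiX j hS) ν)

lemma cmX_opL (a : (Fin N →₀ ℕ) →₀ MvPolynomial (Fin N) ℂ) (R : BiPoly N) :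
    A.cmX (opL a R) = opL a (A.cmX R) := by
  rw [opL, opL, Finsupp.sum, Finsupp.sum, map_sum]
  refine Finset.sum_congr rfl fun ν _ => ?_
  rw [cmX_inL_mul, opPow_intertwine (T := dL) (T' := dL) A.cmX fun j R => A.cmX_dL j R]

/-- Applied to `P`, the operator `c(l) ∂^ν` has leading part `c(l) x^ν A_m(x) A_m(l)`; summing over
the monomials of `T` matches the required leading part. -/
lemma IsBAPoly.exists_opL_top (hP : A.IsBAPoly P) {e : ℕ} {T : BiPoly N}
    (hT : IsWeightedHomogeneous xWeight T e) :
    ∃ a, inL A.poly * (inX A.poly * T) - opL a P ∈ degLT xWeight (A.totalMult + e) := by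
  classical
  have hmon : ∀ m c, Finsupp.weight xWeight m = e →
      ∃ a, inL A.poly * (inX A.poly * monomial m c) - opL a P ∈
        degLT xWeight (A.totalMult + e) := by
    intro m c hm
    set ν : Fin N →₀ ℕ := Finsupp.equivFunOnFinite.symm (m ∘ Sum.inl) with hν
    refine ⟨Finsupp.single ν
      (monomial (Finsupp.equivFunOnFinite.symm (m ∘ Sum.inr)) c), ?_⟩
    have htop := (inX_xWeight A.isWeightedHomogeneous_poly).mul (inL_xWeight A.poly)
    rw [add_zero] at htop
    have h := opPow_dL_sub_mem htop hP.low ν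
    have hsum : ∑ j, ν j = e := by
      rw [← hm, weight_xWeight]
      rfl
    rw [hsum, add_comm] at h
    have h2 := neg_mem (inL_mul_mem_xdeg
      (monomial (Finsupp.equivFunOnFinite.symm (m ∘ Sum.inr)) c) h)
    rw [opL_single, monomial_eq_inX_mul_inL]
    convert h2 using 1
    ring
  have hsum : ∀ s : Finset (Fin N ⊕ Fin N →₀ ℕ), s ⊆ T.support →
      ∃ a, inL A.poly * (inX A.poly * ∑ m ∈ s, monomial m (coeff m T)) - opL a P ∈
        degLT xWeight (A.totalMult + e) := by
    intro s
    induction s using Finset.induction_on with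
    | empty =>
      intro _
      refine ⟨0, ?_⟩
      rw [opL_zero_left, Finset.sum_empty, mul_zero, mul_zero, sub_zero]
      exact zero_mem _
    | insert m s hms ih =>
      intro hs
      obtain ⟨a, ha⟩ := ih ((Finset.subset_insert _ _).trans hs)
      obtain ⟨b, hb⟩ := hmon m (coeff m T)
        (hT (mem_support_iff.1 (hs (Finset.mem_insert_self _ _))))
      refine ⟨b + a, ?_⟩
      rw [Finset.sum_insert hms, opL_add_left]
      convert add_mem hb ha using 1
      ring
  have h := hsum T.support le_rfl
  rwa [← as_sum T] at h

/-- Up to a power of `A_m(l)`, every quasi-invariant multiple of the exponential is obtained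
from the Baker-Akhiezer function by a differential operator in `l`. -/
theorem IsBAPoly.exists_opL (hP : A.IsBAPoly P) {R : BiPoly N} (hR : R ∈ A.quasiX) :
    ∃ p a, inL (A.poly ^ p) * R = opL a P := by
  obtain ⟨d, hd⟩ := exists_mem_degLT xWeight R
  -- Writing the bound as `|m| + d` lets the induction end at `d = 0`, where uniqueness applies.
  replace hd : R ∈ degLT xWeight (A.totalMult + d) := degLT_mono (Nat.le_add_left _ _) hd
  induction d generalizing R with
  | zero => exact ⟨0, 0, by rw [eq_zero_of_mem_quasiX hR hd, mul_zero, opL_zero_left]⟩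
  | succ e ih =>
    obtain ⟨T, hT, hTe⟩ := exists_wc_eq_of_mem_quasiX hR hd
    obtain ⟨b, hb⟩ := hP.exists_opL_top hT
    have hlow : inL A.poly * R - opL b P ∈ degLT xWeight (A.totalMult + e) := by
      have h1 := inL_mul_mem_xdeg A.poly (sub_wc_mem_degLT (d := A.totalMult + e) hd)
      rw [hTe] at h1
      convert add_mem h1 hb using 1
      ring
    obtain ⟨p, a, ha⟩ := ih (sub_mem (inL_mul_mem_quasiX _ hR) (opL_mem_quasiX b hP.quasi)) hlow
    refine ⟨p + 1, a + A.poly ^ p • b, ?_⟩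
    rw [opL_add_left, opL_smul_left, ← ha, pow_succ, map_mul]
    ring

/-- The Calogero-Moser operator preserves quasi-invariance. -/
theorem IsBAPoly.exists_cmX_eq (hP : A.IsBAPoly P) {R : BiPoly N} (hR : R ∈ A.quasiX) :
    ∃ U ∈ A.quasiX, A.cmX R = inX A.poly * U := by
  obtain ⟨U, hU⟩ := inX_poly_dvd_cmX hR
  refine ⟨U, ?_, hU⟩
  obtain ⟨p, a, ha⟩ := hP.exists_opL hR
  have hax : inX A.poly ≠ 0 := (map_ne_zero_iff _ inX_injective).2 A.poly_ne_zero
  -- `opL a` commutes with `cmX` and with multiplication by `A_m(x)`, so it carries the eigenvalue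
  -- equation for `P` over to `R`.
  have h : inL (A.poly ^ p) * U = opL a (inL (normSqPoly N) * P) := by
    refine mul_left_cancel₀ hax ?_
    rw [← opL_inX_mul, ← hP.cmX_eq, ← cmX_opL, ← ha, cmX_inL_mul, hU]
    ring
  refine mem_quasiX_of_inL_mul (pow_ne_zero p A.poly_ne_zero) ?_
  rw [h]
  exact opL_mem_quasiX a (inL_mul_mem_quasiX _ hP.quasi)

end HyperplaneConfig

/-! ### The Calogero-Moser operator on quasi-invariants and its exponential. -/

section Euler

variable {N : ℕ}

/-- The Euler operator `∑ x_j ∂_j`. -/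
def eulerP : Derivation ℂ (MvPolynomial (Fin N) ℂ) (MvPolynomial (Fin N) ℂ) :=
  ∑ j, (X j : MvPolynomial (Fin N) ℂ) • pderiv j

lemma eulerP_apply (p : MvPolynomial (Fin N) ℂ) : eulerP p = ∑ j, X j * pderiv j p := by
  have h := map_sum (Derivation.coeFnAddMonoidHom (R := ℂ) (A := MvPolynomial (Fin N) ℂ)
    (M := MvPolynomial (Fin N) ℂ)) (fun j => (X j : MvPolynomial (Fin N) ℂ) • pderiv j) Finset.univ
  have h' := congrFun h p
  rw [Finset.sum_apply] at h'
  exact h'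

lemma pderiv_eulerP (j : Fin N) (p : MvPolynomial (Fin N) ℂ) :
    pderiv j (eulerP p) = eulerP (pderiv j p) + pderiv j p := by
  classical
  rw [eulerP_apply, eulerP_apply, map_sum]
  simp only [Derivation.leibniz, smul_eq_mul, Finset.sum_add_distrib, pderiv_pderiv_comm j]
  congr 1
  rw [Finset.sum_eq_single j]
  · rw [pderiv_X_self, mul_one]
  · intro i _ hi
    rw [pderiv_X_of_ne hi, mul_zero]
  · simp

end Euler

namespace HyperplaneConfig

variable {N : ℕ} (A : HyperplaneConfig N)

/-- `A_m` times the Calogero-Moser operator, on polynomials. -/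
def cmPoly : Module.End ℂ (MvPolynomial (Fin N) ℂ) :=
  LinearMap.mulLeft ℂ A.poly * ∑ j, (pderiv j).toLinearMap * (pderiv j).toLinearMap
    - (2 : ℂ) • ∑ j, LinearMap.mulLeft ℂ (pderiv j A.poly) * (pderiv j).toLinearMap

lemma cmPoly_apply (p : MvPolynomial (Fin N) ℂ) : A.cmPoly p =
    A.poly * ∑ j, pderiv j (pderiv j p) - 2 * ∑ j, pderiv j A.poly * pderiv j p := by
  simp [cmPoly, LinearMap.sum_apply, smul_eq_C_mul, map_ofNat, Finset.mul_sum]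

lemma specL_zero_cmX (R : BiPoly N) : specL 0 (A.cmX R) = A.cmPoly (specL 0 R) := by
  simp [cmX_apply, cmPoly_apply, specL_dX, specL_inX, map_ofNat (specL 0) 2]

variable {A}

lemma specL_zero_mem_quasiInvariants {R : BiPoly N} (hR : R ∈ A.quasiX) :
    specL 0 R ∈ A.quasiInvariants := by
  refine mem_quasiInvariants_of_dvd fun i s hs => ?_
  have h0 : A.twistAt 0 i = (dirD (A.cvec i)).toLinearMap := by
    refine LinearMap.ext fun p => ?_
    simp [twistAt, twist_apply]
  have h := map_dvd (specL 0) (hR i s hs)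
  rwa [xForm_eq, specL_inX, specL_dAlpha_pow, h0] at h

lemma cmPoly_mem_degLT {d : ℕ} {p : MvPolynomial (Fin N) ℂ} (hp : p ∈ degLT 1 (d + 1)) :
    A.cmPoly p ∈ degLT 1 (A.totalMult + d) := by
  have h1 : ∀ j, pderiv j p ∈ degLT 1 d := fun j => pderiv_mem_degLT j hp
  have h2 : ∀ j, pderiv j (pderiv j p) ∈ degLT 1 d := fun j =>
    pderiv_mem_degLT j (degLT_mono (Nat.le_succ d) (h1 j))
  have hA : A.poly.IsHomogeneous A.totalMult := A.isWeightedHomogeneous_poly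
  rw [cmPoly_apply]
  refine sub_mem (A.isWeightedHomogeneous_poly.mul_mem_degLT
    (Submodule.sum_mem _ fun j _ => h2 j)) (two_mul_mem_degLT (Submodule.sum_mem _ fun j _ => ?_))
  exact degLT_mono (by omega) (IsWeightedHomogeneous.mul_mem_degLT (hA.pderiv (i := j)) (h1 j))

lemma eulerP_poly : eulerP A.poly = (A.totalMult : ℂ) • A.poly := by
  rw [eulerP_apply, sum_X_mul_pderiv_poly]

/-- The infinitesimal form of homogeneity: `cmPoly` shifts degrees by `|m| - 2`. -/
lemma eulerP_cmPoly (p : MvPolynomial (Fin N) ℂ) :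
    eulerP (A.cmPoly p) = A.cmPoly (eulerP p) + ((A.totalMult : ℂ) - 2) • A.cmPoly p := by
  have hA : ∀ j, eulerP (pderiv j A.poly) =
      (A.totalMult : MvPolynomial (Fin N) ℂ) * pderiv j A.poly - pderiv j A.poly := by
    intro j
    have h := pderiv_eulerP j A.poly
    rw [eulerP_poly, Derivation.map_smul, smul_eq_C_mul, map_natCast] at h
    rw [h]; ring
  have hA' : eulerP A.poly = (A.totalMult : MvPolynomial (Fin N) ℂ) * A.poly := by
    rw [eulerP_poly, smul_eq_C_mul, map_natCast]
  have h1 : ∀ j, eulerP (pderiv j p) = pderiv j (eulerP p) - pderiv j p := fun j => by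
    rw [pderiv_eulerP]; ring
  have h2 : ∀ j, eulerP (pderiv j (pderiv j p)) =
      pderiv j (pderiv j (eulerP p)) - 2 * pderiv j (pderiv j p) := fun j => by
    rw [pderiv_eulerP, map_add, pderiv_eulerP]; ring
  have h3 : ∀ j, eulerP (pderiv j A.poly * pderiv j p) =
      ((A.totalMult : MvPolynomial (Fin N) ℂ) - 2) * (pderiv j A.poly * pderiv j p) +
        pderiv j A.poly * pderiv j (eulerP p) := by
    intro j
    rw [Derivation.leibniz, h1, hA, smul_eq_mul, smul_eq_mul]
    ring
  have h4 : eulerP (2 : MvPolynomial (Fin N) ℂ) = 0 := Derivation.map_natCast _ 2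
  rw [cmPoly_apply, cmPoly_apply, map_sub, Derivation.leibniz, Derivation.leibniz, h4, hA',
    map_sum, map_sum, Finset.sum_congr rfl fun j _ => h2 j, Finset.sum_congr rfl fun j _ => h3 j,
    Finset.sum_sub_distrib, Finset.sum_add_distrib, ← Finset.mul_sum, ← Finset.mul_sum]
  simp only [smul_eq_mul, smul_eq_C_mul, C_sub, map_natCast, map_ofNat]
  ring

/-- The Calogero-Moser operator on the space of quasi-invariants. -/
structure IsCmOperator (L : Module.End ℂ A.quasiInvariants) : Prop where
  poly_mul : ∀ q : A.quasiInvariants,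
    A.poly * (L q : MvPolynomial (Fin N) ℂ) = A.cmPoly (q : MvPolynomial (Fin N) ℂ)

/-- Stability of `quasiX` is applied to `q(x) P` and specialized at `l = 0`, where `P` becomes the
nonzero constant `coeff 0 P`. -/
theorem IsBAPoly.exists_isCmOperator {P : BiPoly N} (hP : A.IsBAPoly P) :
    ∃ L : Module.End ℂ A.quasiInvariants, IsCmOperator L := by
  have h : ∀ q : A.quasiInvariants, ∃ r : A.quasiInvariants,
      A.poly * (r : MvPolynomial (Fin N) ℂ) = A.cmPoly (q : MvPolynomial (Fin N) ℂ) := by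
    intro q
    obtain ⟨U, hU, hUe⟩ := hP.exists_cmX_eq (inX_mul_mem_quasiX q.2 hP.quasi)
    have h1 := congrArg (specL 0) hUe
    rw [specL_zero_cmX, map_mul (specL 0), map_mul (specL 0), specL_inX, specL_inX,
      hP.specL_zero, mul_comm _ (C _), ← smul_eq_C_mul, map_smul] at h1
    refine ⟨(coeff 0 P)⁻¹ • ⟨specL 0 U, specL_zero_mem_quasiInvariants hU⟩, ?_⟩
    rw [Submodule.coe_smul, mul_smul_comm, ← h1, smul_smul, inv_mul_cancel₀ hP.ne, one_smul]
  choose f hf using h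
  refine ⟨⟨⟨f, fun q r => ?_⟩, fun c q => ?_⟩, ⟨hf⟩⟩
  · refine Subtype.ext (mul_left_cancel₀ A.poly_ne_zero ?_)
    rw [Submodule.coe_add, mul_add, hf, hf, hf, Submodule.coe_add, map_add]
  · refine Subtype.ext (mul_left_cancel₀ A.poly_ne_zero ?_)
    rw [RingHom.id_apply, Submodule.coe_smul, mul_smul_comm, hf, hf, Submodule.coe_smul, map_smul]

variable {L : Module.End ℂ A.quasiInvariants}

namespace IsCmOperator

lemma mem_degLT (hL : IsCmOperator L) {d : ℕ} {q : A.quasiInvariants}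
    (hq : (q : MvPolynomial (Fin N) ℂ) ∈ degLT 1 (d + 1)) :
    (L q : MvPolynomial (Fin N) ℂ) ∈ degLT 1 d := by
  refine A.isWeightedHomogeneous_poly.mem_degLT_of_mul_mem A.poly_ne_zero ?_
  rw [hL.poly_mul]
  exact cmPoly_mem_degLT hq

lemma pow_mem_degLT (hL : IsCmOperator L) {d : ℕ} {q : A.quasiInvariants} (k : ℕ)
    (hq : (q : MvPolynomial (Fin N) ℂ) ∈ degLT 1 (d + k)) :
    ((L ^ k) q : MvPolynomial (Fin N) ℂ) ∈ degLT 1 d := by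
  induction k generalizing q with
  | zero => exact hq
  | succ k ih =>
    rw [pow_succ, Module.End.mul_apply]
    exact ih (hL.mem_degLT hq)

lemma pow_eq_zero (hL : IsCmOperator L) {d k : ℕ} {q : A.quasiInvariants}
    (hq : (q : MvPolynomial (Fin N) ℂ) ∈ degLT 1 d) (hk : d ≤ k) : (L ^ k) q = 0 :=
  Subtype.ext (eq_zero_of_mem_degLT_zero
    (hL.pow_mem_degLT k (degLT_mono (by omega) hq)))

lemma eulerP_apply_eq (hL : IsCmOperator L) (q : A.quasiInvariants) {c : ℂ}
    (hq : eulerP (q : MvPolynomial (Fin N) ℂ) = c • (q : MvPolynomial (Fin N) ℂ)) :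
    eulerP (L q : MvPolynomial (Fin N) ℂ) = (c - 2) • (L q : MvPolynomial (Fin N) ℂ) := by
  refine mul_left_cancel₀ A.poly_ne_zero ?_
  have h := congrArg eulerP (hL.poly_mul q)
  rw [eulerP_cmPoly, hq, map_smul, ← hL.poly_mul, Derivation.leibniz, eulerP_poly] at h
  simp only [smul_eq_mul, smul_eq_C_mul, C_sub, map_natCast, map_ofNat] at h ⊢
  linear_combination h

lemma eulerP_pow_apply (hL : IsCmOperator L) (q : A.quasiInvariants) {c : ℂ}
    (hq : eulerP (q : MvPolynomial (Fin N) ℂ) = c • (q : MvPolynomial (Fin N) ℂ)) (k : ℕ) :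
    eulerP ((L ^ k) q : MvPolynomial (Fin N) ℂ) =
      (c - 2 * k) • ((L ^ k) q : MvPolynomial (Fin N) ℂ) := by
  induction k with
  | zero => simpa using hq
  | succ k ih =>
    rw [pow_succ', Module.End.mul_apply, hL.eulerP_apply_eq _ ih]
    push_cast
    ring_nf

end IsCmOperator

/-- The coefficients of the series `exp (-t / 2)`. -/
def gaussCoeff (k : ℕ) : ℂ := (-1 / 2) ^ k / k.factorial

lemma gaussCoeff_zero : gaussCoeff 0 = 1 := by simp [gaussCoeff]

lemma gaussCoeff_succ (k : ℕ) : 2 * ((k : ℂ) + 1) * gaussCoeff (k + 1) = -gaussCoeff k := by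
  have h1 : ((k : ℂ) + 1) ≠ 0 := Nat.cast_add_one_ne_zero k
  have h2 : (k.factorial : ℂ) ≠ 0 := Nat.cast_ne_zero.2 k.factorial_ne_zero
  rw [gaussCoeff, gaussCoeff, Nat.factorial_succ]
  push_cast
  field_simp
  ring

/-- `exp (-L / 2)` for a locally nilpotent operator `L`. -/
def expNeg (L : Module.End ℂ A.quasiInvariants) (q : A.quasiInvariants) : A.quasiInvariants :=
  ∑ᶠ k, gaussCoeff k • (L ^ k) q

namespace IsCmOperator

lemma expNeg_eq (hL : IsCmOperator L) {d K : ℕ} {q : A.quasiInvariants}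
    (hq : (q : MvPolynomial (Fin N) ℂ) ∈ degLT 1 d) (hK : d ≤ K) :
    expNeg L q = ∑ k ∈ Finset.range K, gaussCoeff k • (L ^ k) q := by
  refine finsum_eq_sum_of_support_subset _ fun k hk => ?_
  rw [Finset.coe_range, Set.mem_Iio]
  by_contra hlt
  exact hk (by simp only [hL.pow_eq_zero hq (hK.trans (not_lt.1 hlt)), smul_zero])

/-- `exp (-L / 2)` as a linear map. -/
def expNegLinear (hL : IsCmOperator L) : Module.End ℂ A.quasiInvariants where
  toFun := expNeg L
  map_add' q r := by
    obtain ⟨d, hd⟩ := exists_mem_degLT 1 (q : MvPolynomial (Fin N) ℂ)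
    obtain ⟨e, he⟩ := exists_mem_degLT 1 (r : MvPolynomial (Fin N) ℂ)
    have hd' := degLT_mono (le_max_left d e) hd
    have he' := degLT_mono (le_max_right d e) he
    rw [hL.expNeg_eq hd' le_rfl, hL.expNeg_eq he' le_rfl,
      hL.expNeg_eq (q := q + r) (add_mem hd' he') le_rfl, ← Finset.sum_add_distrib]
    simp only [map_add, smul_add]
  map_smul' c q := by
    obtain ⟨d, hd⟩ := exists_mem_degLT 1 (q : MvPolynomial (Fin N) ℂ)
    rw [hL.expNeg_eq hd le_rfl,
      hL.expNeg_eq (q := c • q) (Submodule.smul_mem _ c hd) le_rfl, RingHom.id_apply,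
      Finset.smul_sum]
    simp only [map_smul, smul_comm c]

lemma expNegLinear_eq (hL : IsCmOperator L) {d K : ℕ} {q : A.quasiInvariants}
    (hq : (q : MvPolynomial (Fin N) ℂ) ∈ degLT 1 d) (hK : d ≤ K) :
    hL.expNegLinear q = ∑ k ∈ Finset.range K, gaussCoeff k • (L ^ k) q :=
  hL.expNeg_eq hq hK

/-- Every term with `k > 0` lowers the degree, so `exp (-L / 2)` is unitriangular; bijectivity
follows by induction on the degree. -/
lemma expNegLinear_sub_mem (hL : IsCmOperator L) {d : ℕ} {q : A.quasiInvariants}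
    (hq : (q : MvPolynomial (Fin N) ℂ) ∈ degLT 1 (d + 1)) :
    ((hL.expNegLinear q - q : A.quasiInvariants) : MvPolynomial (Fin N) ℂ) ∈ degLT 1 d := by
  rw [hL.expNegLinear_eq hq le_rfl, Finset.sum_range_succ', gaussCoeff_zero, pow_zero,
    Module.End.one_apply, one_smul, add_sub_cancel_right, Submodule.coe_sum]
  refine Submodule.sum_mem _ fun k _ => Submodule.smul_mem _ _ ?_
  refine hL.pow_mem_degLT (k + 1) (degLT_mono (by omega) hq)

lemma expNegLinear_bijective (hL : IsCmOperator L) : Function.Bijective hL.expNegLinear := by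
  constructor
  · rw [injective_iff_map_eq_zero]
    intro q hq
    obtain ⟨d, hd⟩ := exists_mem_degLT 1 (q : MvPolynomial (Fin N) ℂ)
    induction d with
    | zero => exact Subtype.ext (eq_zero_of_mem_degLT_zero hd)
    | succ d ih =>
      have h := hL.expNegLinear_sub_mem hd
      rw [hq, zero_sub] at h
      exact ih (neg_mem_iff.1 h)
  · intro r
    obtain ⟨d, hd⟩ := exists_mem_degLT 1 (r : MvPolynomial (Fin N) ℂ)
    induction d generalizing r with
    | zero =>
      have h : r = 0 := Subtype.ext (eq_zero_of_mem_degLT_zero hd)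
      exact ⟨0, by rw [map_zero, h]⟩
    | succ d ih =>
      obtain ⟨q, hq⟩ := ih _ (hL.expNegLinear_sub_mem hd)
      refine ⟨r - q, ?_⟩
      rw [map_sub, hq, sub_sub_cancel]

/-- Since `E L^k q = (d - 2k) L^k q`, the operator `E - d` multiplies the `k`-th term of the series
by `-2k`. The recursion `gaussCoeff_succ` identifies the outcome with `L` applied to the series. -/
lemma cmPoly_expNegLinear (hL : IsCmOperator L) {d : ℕ} {q : A.quasiInvariants}
    (hq : (q : MvPolynomial (Fin N) ℂ).IsHomogeneous d) :
    A.cmPoly (hL.expNegLinear q : MvPolynomial (Fin N) ℂ) =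
      A.poly * (eulerP (hL.expNegLinear q : MvPolynomial (Fin N) ℂ) +
        (-(d : ℂ)) • (hL.expNegLinear q : MvPolynomial (Fin N) ℂ)) := by
  have hE : eulerP (q : MvPolynomial (Fin N) ℂ) = (d : ℂ) • (q : MvPolynomial (Fin N) ℂ) := by
    rw [eulerP_apply, hq.sum_X_mul_pderiv]
    exact (Nat.cast_smul_eq_nsmul ℂ _ _).symm
  have hdeg : (q : MvPolynomial (Fin N) ℂ) ∈ degLT 1 (d + 1) :=
    IsWeightedHomogeneous.mem_degLT hq
  rw [← hL.poly_mul]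
  congr 1
  have h1 : L (hL.expNegLinear q) =
      ∑ k ∈ Finset.range (d + 1), gaussCoeff k • (L ^ (k + 1)) q := by
    rw [hL.expNegLinear_eq hdeg le_rfl, map_sum]
    refine Finset.sum_congr rfl fun k _ => ?_
    rw [map_smul, pow_succ', Module.End.mul_apply]
  -- One term more than in `h1`: the factor `k` kills the first term, and the remaining indices
  -- shift by one.
  have h2 := hL.expNegLinear_eq hdeg (K := d + 1 + 1) (Nat.le_succ _)
  have h3 : ∀ k, eulerP ((gaussCoeff k • (L ^ k) q : A.quasiInvariants) : MvPolynomial (Fin N) ℂ) +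
      (-(d : ℂ)) • ((gaussCoeff k • (L ^ k) q : A.quasiInvariants) : MvPolynomial (Fin N) ℂ) =
      (-(2 * k * gaussCoeff k)) • ((L ^ k) q : MvPolynomial (Fin N) ℂ) := by
    intro k
    rw [Submodule.coe_smul, Derivation.map_smul, hL.eulerP_pow_apply q hE, smul_smul, smul_smul,
      ← add_smul]
    congr 1
    ring
  rw [h1, h2, Submodule.coe_sum, Submodule.coe_sum, map_sum, Finset.smul_sum,
    ← Finset.sum_add_distrib, Finset.sum_congr rfl fun k _ => h3 k,
    Finset.sum_range_succ' _ (d + 1)]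
  simp only [Nat.cast_zero, mul_zero, zero_mul, neg_zero, zero_smul, add_zero]
  refine Finset.sum_congr rfl fun k _ => ?_
  rw [Submodule.coe_smul]
  congr 1
  push_cast
  rw [gaussCoeff_succ, neg_neg]

end IsCmOperator

/-- The logarithmic derivative of `A_m`. If `m_α = 0` the form `(α, x)` may vanish at a regular
point, but the zero numerator removes that term. -/
lemma eval_pderiv_poly {x : Fin N → ℂ} (hx : x ∈ A.regular) (j : Fin N) :
    eval x (pderiv j A.poly) =
      (∑ i, A.mult i / (A.cvec i ⬝ᵥ x) * A.cvec i j) * eval x A.poly := by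
  classical
  have hfac : ∀ i, eval x (pderiv j (linForm (A.cvec i) ^ A.mult i)) =
      A.mult i / (A.cvec i ⬝ᵥ x) * A.cvec i j * eval x (linForm (A.cvec i) ^ A.mult i) := by
    intro i
    have h2 : pderiv j (linForm (A.cvec i)) = C (A.cvec i j) := by
      rw [← dirD_single, dirD_linForm, dotProduct_single, mul_one]
    rw [pderiv_pow, h2]
    simp only [map_mul, map_pow, map_natCast, eval_C, eval_linForm]
    cases hm : A.mult i with
    | zero => simp
    | succ m =>
      have h0 := A.cvec_dotProduct_ne_zero_of_regular hx (i := i) (by omega)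
      rw [Nat.add_sub_cancel]
      field_simp
      ring
  have hprod : ∀ s : Finset A.ι, eval x (pderiv j (∏ i ∈ s, linForm (A.cvec i) ^ A.mult i)) =
      (∑ i ∈ s, A.mult i / (A.cvec i ⬝ᵥ x) * A.cvec i j) *
        eval x (∏ i ∈ s, linForm (A.cvec i) ^ A.mult i) := by
    intro s
    induction s using Finset.induction_on with
    | empty => simp
    | insert i s hi ih =>
      rw [Finset.prod_insert hi, Finset.sum_insert hi, Derivation.leibniz, smul_eq_mul,
        smul_eq_mul, map_add, map_mul, map_mul, map_mul, ih, hfac]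
      ring
  rw [poly_eq]
  exact hprod _

/-- The action of the Calogero-Moser operator on polynomial functions. -/
lemma poly_mul_cmOp {p : MvPolynomial (Fin N) ℂ} {x : Fin N → ℂ} (hx : x ∈ A.regular) :
    eval x A.poly * A.cmOp (fun y => eval y p) x = eval x (A.cmPoly p) := by
  have h1 : ∀ j (r : MvPolynomial (Fin N) ℂ),
      partialDeriv j (fun y => eval y r) = fun y => eval y (pderiv j r) := fun j r => by
    rw [partialDeriv, dirDeriv_eval, dirD_single]
  have h2 : ∀ i, dirDeriv (A.cvec i) (fun y => eval y p) x =
      ∑ j, A.cvec i j * eval x (pderiv j p) := fun i => by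
    rw [dirDeriv_eval, dirD_apply]
    simp only [map_sum, smul_eval]
  simp only [cmOp, h1, h2, cmPoly_apply, map_sub, map_mul, map_sum, map_ofNat, mul_sub,
    eval_pderiv_poly hx]
  congr 1
  simp only [Finset.mul_sum, Finset.sum_mul]
  rw [Finset.sum_comm]
  refine Finset.sum_congr rfl fun j _ => Finset.sum_congr rfl fun i _ => ?_
  ring

lemma isEigen_of_cmPoly {c : ℂ} {H : MvPolynomial (Fin N) ℂ}
    (h : A.cmPoly H = A.poly * (eulerP H + c • H)) : A.IsEigen c H := by
  intro x hx
  refine mul_left_cancel₀ hx ?_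
  have h1 : ∀ j, partialDeriv j (fun y => eval y H) x = eval x (pderiv j H) := fun j => by
    rw [partialDeriv, dirDeriv_eval, dirD_single]
  rw [harmonicCmOp, mul_sub, poly_mul_cmOp hx, h, eulerP_apply]
  simp only [h1, map_mul, map_add, map_sum, eval_X, smul_eval]
  ring

end HyperplaneConfig

/-! ### Replacing the Gaussian by Taylor polynomials. -/

section Gaussian

variable {N : ℕ}

open HyperplaneConfig

/-- `∂/∂l_j` conjugated by `exp ((x, l) - l² / 2)`. -/
def dG (j : Fin N) : Module.End ℂ (BiPoly N) :=
  twist (pderiv (Sum.inr j)) (X (Sum.inl j) - X (Sum.inr j))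

/-- `l² - c`. -/
def shiftedNormSq (N : ℕ) (c : ℂ) : BiPoly N := inL (normSqPoly N) - C c

/-- The Taylor polynomial of `exp (-(l² - c) / 2)`. -/
def gaussTrunc (N : ℕ) (c : ℂ) (K : ℕ) : BiPoly N :=
  ∑ k ∈ Finset.range K, C (gaussCoeff k) * shiftedNormSq N c ^ k

lemma pderiv_shiftedNormSq (c : ℂ) (j : Fin N) :
    pderiv (Sum.inr j) (shiftedNormSq N c) = 2 * X (Sum.inr j) := by
  rw [shiftedNormSq, map_sub, pderiv_inr_inL, pderiv_normSqPoly, map_mul, map_ofNat, inL_X,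
    pderiv_C, sub_zero]

lemma pderiv_gaussTrunc (c : ℂ) (K : ℕ) (j : Fin N) :
    pderiv (Sum.inr j) (gaussTrunc N c (K + 1)) = -(X (Sum.inr j) * gaussTrunc N c K) := by
  induction K with
  | zero => simp [gaussTrunc]
  | succ K ih =>
    have h : (C (2 * ((K : ℂ) + 1) * gaussCoeff (K + 1)) : BiPoly N) = C (-gaussCoeff K) := by
      rw [gaussCoeff_succ]
    simp only [C_mul, C_add, C_neg, map_ofNat, map_natCast, C_1] at h
    rw [gaussTrunc, Finset.sum_range_succ, map_add, ← gaussTrunc, ih, gaussTrunc, gaussTrunc,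
      Finset.sum_range_succ, Derivation.leibniz, pderiv_C, smul_zero, add_zero, pderiv_pow,
      pderiv_shiftedNormSq, smul_eq_mul, Nat.add_sub_cancel]
    push_cast
    linear_combination X (Sum.inr j) * shiftedNormSq N c ^ K * h

lemma dL_gaussTrunc_mul (c : ℂ) (K : ℕ) (j : Fin N) (R : BiPoly N) :
    dL j (gaussTrunc N c (K + 1) * R) = gaussTrunc N c (K + 1) * dG j R +
      shiftedNormSq N c ^ K * (C (gaussCoeff K) * X (Sum.inr j) * R) := by
  have h : gaussTrunc N c (K + 1) =
      gaussTrunc N c K + C (gaussCoeff K) * shiftedNormSq N c ^ K := Finset.sum_range_succ _ _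
  rw [dL_mul, pderiv_gaussTrunc, dL_apply, dG, twist_apply]
  linear_combination X (Sum.inr j) * R * h

/-- A derivative lowers the order of vanishing along `l² = c` by one, and the truncation error
itself vanishes there to order `K`. -/
lemma pow_dvd_dL_sub {c : ℂ} {K n : ℕ} (hn : n ≤ K) (j : Fin N) {R R' : BiPoly N}
    (h : shiftedNormSq N c ^ (n + 1) ∣ R - gaussTrunc N c (K + 1) * R') :
    shiftedNormSq N c ^ n ∣ dL j R - gaussTrunc N c (K + 1) * dG j R' := by
  obtain ⟨w, hw⟩ := h
  have hR : R = gaussTrunc N c (K + 1) * R' + shiftedNormSq N c ^ (n + 1) * w := by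
    rw [← hw]; ring
  have h2 : dL j R - gaussTrunc N c (K + 1) * dG j R' =
      shiftedNormSq N c ^ K * (C (gaussCoeff K) * X (Sum.inr j) * R') +
      shiftedNormSq N c ^ n * ((((n + 1 : ℕ) : BiPoly N) * (2 * X (Sum.inr j))) * w +
        shiftedNormSq N c * dL j w) := by
    rw [hR, map_add, dL_gaussTrunc_mul, dL_mul, pderiv_pow, pderiv_shiftedNormSq,
      Nat.add_sub_cancel]
    ring
  rw [h2]
  exact dvd_add ((pow_dvd_pow _ hn).mul_right _) (dvd_mul_right _ _)

/-- Fewer than `K` derivatives leave at least one factor `l² - c` in the error. -/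
lemma dvd_opPow_dL_sub {c : ℂ} {K : ℕ} (R : BiPoly N) (ν : Fin N →₀ ℕ) (hν : ∑ j, ν j < K) :
    shiftedNormSq N c ∣ opPow dL ν (gaussTrunc N c (K + 1) * R) -
      gaussTrunc N c (K + 1) * opPow dG ν R := by
  -- Both expressions are differentiated together, as components of a pair, so that the order of
  -- vanishing of their difference can be tracked.
  have h := opPow_induction
    (T := fun j => ((dL j).prodMap (dG j) : Module.End ℂ (BiPoly N × BiPoly N)))
    (r := (gaussTrunc N c (K + 1) * R, R))
    (fun k S => ∀ n, n + ∑ j, k j ≤ K →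
      shiftedNormSq N c ^ n ∣ S.1 - gaussTrunc N c (K + 1) * S.2)
    (fun n _ => by rw [sub_self]; exact dvd_zero _) (by
      intro k S j hS n hn
      have hk : ∑ i, (k + Pi.single j 1 : Fin N → ℕ) i = ∑ i, k i + 1 := by
        simp [Finset.sum_add_distrib]
      rw [hk] at hn
      exact pow_dvd_dL_sub (by omega) j (hS (n + 1) (by omega))) ν 1 (by omega)
  rw [pow_one] at h
  convert h using 2
  · exact (opPow_intertwine (T' := dL)
      (T := fun j => ((dL j).prodMap (dG j) : Module.End ℂ (BiPoly N × BiPoly N)))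
      Prod.fst (fun _ _ => rfl) ν (gaussTrunc N c (K + 1) * R, R)).symm
  · congr 1
    exact (opPow_intertwine (T' := dG)
      (T := fun j => ((dL j).prodMap (dG j) : Module.End ℂ (BiPoly N × BiPoly N)))
      Prod.snd (fun _ _ => rfl) ν (gaussTrunc N c (K + 1) * R, R)).symm

lemma eval_normSqPoly (l : Fin N → ℂ) : eval l (normSqPoly N) = l ⬝ᵥ l := by
  simp [normSqPoly, dotProduct, pow_two]

lemma eval_shiftedNormSq (x l : Fin N → ℂ) :
    eval (Sum.elim x l) (shiftedNormSq N (l ⬝ᵥ l)) = 0 := by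
  rw [shiftedNormSq, map_sub, eval_inL, eval_normSqPoly, eval_C, sub_self]

lemma eval_gaussTrunc (x l : Fin N → ℂ) (K : ℕ) :
    eval (Sum.elim x l) (gaussTrunc N (l ⬝ᵥ l) (K + 1)) = 1 := by
  rw [gaussTrunc, map_sum, Finset.sum_range_succ', Finset.sum_eq_zero]
  · simp [gaussCoeff_zero]
  · intro k _
    rw [map_mul, map_pow, eval_shiftedNormSq, zero_pow (Nat.succ_ne_zero k), mul_zero]

/-- At the point `l`, the derivatives of `R exp ((x, l) - l² / 2)` are those of the product
of `R exp (x, l)` with a Taylor polynomial. -/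
lemma eval_opPow_dG (x l : Fin N → ℂ) {K : ℕ} (R : BiPoly N) (ν : Fin N →₀ ℕ)
    (hν : ∑ j, ν j < K) :
    eval (Sum.elim x l) (opPow dG ν R) =
      eval (Sum.elim x l) (opPow dL ν (gaussTrunc N (l ⬝ᵥ l) (K + 1) * R)) := by
  obtain ⟨w, hw⟩ := dvd_opPow_dL_sub (c := l ⬝ᵥ l) R ν hν
  have h := congrArg (eval (Sum.elim x l)) hw
  rw [map_sub, map_mul (eval _), map_mul (eval _), eval_shiftedNormSq, zero_mul, eval_gaussTrunc,
    one_mul] at h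
  exact (sub_eq_zero.1 h).symm

/-- Specialization of the first set of variables. -/
def specX (x : Fin N → ℂ) : BiPoly N →ₐ[ℂ] MvPolynomial (Fin N) ℂ := (specL x).comp swapVars

lemma eval_specX (x l : Fin N → ℂ) (R : BiPoly N) :
    eval l (specX x R) = eval (Sum.elim x l) R := by
  rw [specX, AlgHom.comp_apply, eval_specL, eval_swapVars]

lemma twistMulti_specX (x : Fin N → ℂ) (ν : Fin N →₀ ℕ) (R : BiPoly N) :
    twistMulti (linForm x - C (1 / 2) * normSqPoly N) ν (specX x R) = specX x (opPow dG ν R) := by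
  rw [twistMulti_eq]
  refine (opPow_intertwine (specX x) (fun j R => ?_) ν R).symm
  have h1 : specX x (pderiv (Sum.inr j) R) = pderiv j (specX x R) := by
    rw [specX, AlgHom.comp_apply, swapVars_pderiv]
    exact specL_pderiv _ _ _
  have h2 : specX x (X (Sum.inl j)) = C (x j) := by
    rw [specX, AlgHom.comp_apply, swapVars_X_inl, specL_X_inr]
  have h3 : specX x (X (Sum.inr j)) = X j := by
    rw [specX, AlgHom.comp_apply, swapVars_X_inr, ← inX_X, specL_inX]
  have h4 : pderiv j (linForm x - C (1 / 2) * normSqPoly N) = C (x j) - X j := by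
    have h5 : (C (1 / 2) * 2 : MvPolynomial (Fin N) ℂ) = 1 := by
      rw [show (2 : MvPolynomial (Fin N) ℂ) = C 2 from rfl, ← C_mul]
      norm_num
    rw [map_sub, ← dirD_single, dirD_linForm, dotProduct_single, mul_one, dirD_single,
      Derivation.leibniz, pderiv_C, pderiv_normSqPoly, smul_zero, add_zero, smul_eq_mul,
      ← mul_assoc, h5, one_mul]
  rw [twist_apply, h4, dG, twist_apply, map_add, map_mul, map_sub, h1, h2, h3]

lemma twistMulti_specL (l : Fin N → ℂ) (ν : Fin N →₀ ℕ) (R : BiPoly N) :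
    twistMulti (linForm l) ν (specL l R) = specL l (opPow dX ν R) := by
  rw [twistMulti_eq]
  refine (opPow_intertwine (specL l) (fun j R => ?_) ν R).symm
  rw [specL_dX, twist_apply, ← dirD_single, dirD_linForm, dotProduct_single, mul_one]

end Gaussian

/-! ### Quantum integrals and the value of the pairing. -/

namespace HyperplaneConfig

variable {N : ℕ} {A : HyperplaneConfig N} {P : BiPoly N} {φ : (Fin N → ℂ) → (Fin N → ℂ) → ℂ}

/-- By symmetry of `P`, an operator acting in the first variable becomes, after exchanging names,
the same operator acting in `l`. The identity on regular points then extends to polynomials. -/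
lemma IsBAPoly.isQuantumIntegral_iff (hP : A.IsBAPoly P)
    (hφ : ∀ x l, φ x l = eval (Sum.elim x l) P * Complex.exp (x ⬝ᵥ l))
    (q : MvPolynomial (Fin N) ℂ) (D : DiffOp N) :
    A.IsQuantumIntegral φ q D ↔ opL D.num P = inL (A.poly ^ D.pole) * (inX q * P) := by
  have hfun : ∀ l, (fun y => φ y l) = expFun (linForm l) (specL l P) := fun l => by
    funext y
    rw [hφ, expFun, eval_specL, eval_linForm, dotProduct_comm]
  have hswap : ∀ ν (x l : Fin N → ℂ), eval (Sum.elim x l) (opPow dX ν P) =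
      eval (Sum.elim l x) (opPow dL ν P) := by
    intro ν x l
    have h := opPow_intertwine swapVars (fun j R => swapVars_dX j R) ν P
    rw [hP.swapVars_eq] at h
    rw [← h, eval_swapVars]
  have hsym : ∀ x l, eval (Sum.elim x l) P = eval (Sum.elim l x) P := fun x l => by
    rw [← eval_swapVars, hP.swapVars_eq]
  have hop : ∀ l x, A.applyOp D (fun y => φ y l) x =
      eval (Sum.elim l x) (opL D.num P) / eval x A.poly ^ D.pole * Complex.exp (x ⬝ᵥ l) := by
    intro l x
    rw [applyOp, hfun, opL, Finsupp.sum, Finsupp.sum, map_sum, div_mul_eq_mul_div, Finset.sum_mul]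
    congr 1
    refine Finset.sum_congr rfl fun ν _ => ?_
    rw [multiDeriv_expFun, expFun, twistMulti_specL, eval_specL, hswap, eval_linForm, map_mul,
      eval_inL, dotProduct_comm l x]
    ring
  constructor
  · intro h
    have hal : inL A.poly ≠ 0 := (map_ne_zero_iff _ inL_injective).2 A.poly_ne_zero
    rw [← sub_eq_zero]
    refine eq_zero_of_eval_eq_zero_of_ne hal fun y hy => ?_
    rw [← Sum.elim_comp_inl_inr y] at hy ⊢
    rw [eval_inL] at hy
    have h1 := h (y ∘ Sum.inl) (y ∘ Sum.inr) hy
    rw [hop, hφ, hsym, ← mul_assoc] at h1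
    have h2 := mul_right_cancel₀ (Complex.exp_ne_zero _) h1
    rw [div_eq_iff (pow_ne_zero _ hy)] at h2
    rw [map_sub, h2, map_mul, map_mul, eval_inL, eval_inX, map_pow]
    ring
  · intro h l x hx
    have hx' : eval x A.poly ≠ 0 := hx
    rw [hop, h, hφ, hsym x l, map_mul, map_mul, eval_inL, eval_inX, map_pow]
    field_simp

/-- Each factor `l²` on `P` is traded for the Calogero-Moser operator in `x`, which commutes with
`opL a` and advances the sequence `U` by one step. -/
lemma IsBAPoly.opL_normSq_pow_mul (hP : A.IsBAPoly P) {p : ℕ}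
    {a : (Fin N →₀ ℕ) →₀ MvPolynomial (Fin N) ℂ} {U : ℕ → BiPoly N}
    (h0 : opL a P = inL (A.poly ^ p) * U 0)
    (hU : ∀ k, A.cmX (U k) = inX A.poly * U (k + 1)) (k : ℕ) :
    opL a (inL (normSqPoly N ^ k) * P) = inL (A.poly ^ p) * U k := by
  have hax : inX A.poly ≠ 0 := (map_ne_zero_iff _ inX_injective).2 A.poly_ne_zero
  induction k with
  | zero => rw [pow_zero, map_one, one_mul, h0]
  | succ k ih =>
    refine mul_left_cancel₀ hax ?_
    have h1 : inX A.poly * (inL (normSqPoly N ^ (k + 1)) * P) =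
        A.cmX (inL (normSqPoly N ^ k) * P) := by
      rw [cmX_inL_mul, hP.cmX_eq, pow_succ, map_mul]
      ring
    rw [← opL_inX_mul, h1, ← cmX_opL, ih, cmX_inL_mul, hU]
    ring

lemma IsBAPoly.opL_gaussTrunc_mul (hP : A.IsBAPoly P) {p : ℕ}
    {a : (Fin N →₀ ℕ) →₀ MvPolynomial (Fin N) ℂ} {U : ℕ → BiPoly N}
    (h0 : opL a P = inL (A.poly ^ p) * U 0)
    (hU : ∀ k, A.cmX (U k) = inX A.poly * U (k + 1)) (c : ℂ) (K : ℕ) :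
    opL a (gaussTrunc N c K * P) = inL (A.poly ^ p) * ∑ k ∈ Finset.range K,
      ∑ m ∈ Finset.range (k + 1), (gaussCoeff k * ((-c) ^ (k - m) * (k.choose m : ℂ))) • U m := by
  rw [gaussTrunc, Finset.sum_mul, opL_sum_right, Finset.mul_sum]
  refine Finset.sum_congr rfl fun k _ => ?_
  have h1 : C (gaussCoeff k) * shiftedNormSq N c ^ k * P = ∑ m ∈ Finset.range (k + 1),
      (gaussCoeff k * ((-c) ^ (k - m) * (k.choose m : ℂ))) • (inL (normSqPoly N ^ m) * P) := by
    rw [shiftedNormSq, sub_eq_add_neg, ← C_neg, add_pow, Finset.mul_sum, Finset.sum_mul]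
    refine Finset.sum_congr rfl fun m _ => ?_
    rw [smul_eq_C_mul, C_mul, C_mul, C_pow, map_natCast, map_pow]
    ring
  rw [h1, opL_sum_right, Finset.mul_sum]
  refine Finset.sum_congr rfl fun m _ => ?_
  rw [opL_smul_right, hP.opL_normSq_pow_mul h0 hU, mul_smul_comm]

/-- On regular points the denominator of `L_q` cancels, leaving a function continuous everywhere;
its value at the origin is the series `exp (-L / 2) q` up to the constant `coeff 0 P`. -/
lemma IsBAPoly.tendsto_applyOp (hP : A.IsBAPoly P)
    (hφ : ∀ x l, φ x l = eval (Sum.elim x l) P * Complex.exp (x ⬝ᵥ l))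
    {L : Module.End ℂ A.quasiInvariants} (hL : IsCmOperator L) (q : A.quasiInvariants)
    {D : DiffOp N} (hD : A.IsQuantumIntegral φ q D) (x : Fin N → ℂ) :
    Tendsto (A.applyOp D fun l => φ x l * Complex.exp (-(l ⬝ᵥ l) / 2)) (𝓝[A.regular] 0)
      (𝓝 (coeff 0 P * eval x (hL.expNegLinear q : MvPolynomial (Fin N) ℂ))) := by
  have hV : ∀ R : A.quasiX, ∃ U : A.quasiX, A.cmX R = inX A.poly * (U : BiPoly N) := fun R => by
    obtain ⟨U, hU, h⟩ := hP.exists_cmX_eq R.2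
    exact ⟨⟨U, hU⟩, h⟩
  choose next hnext using hV
  set U : ℕ → BiPoly N := fun k =>
    (next^[k] ⟨inX (q : MvPolynomial (Fin N) ℂ) * P, inX_mul_mem_quasiX q.2 hP.quasi⟩ : A.quasiX)
    with hUdef
  have hU : ∀ k, A.cmX (U k) = inX A.poly * U (k + 1) := fun k => by
    simp only [hUdef, Function.iterate_succ_apply', ← hnext]
  have h0 : opL D.num P = inL (A.poly ^ D.pole) * U 0 := (hP.isQuantumIntegral_iff hφ q D).1 hD
  have hspec : ∀ k, specL 0 (U k) = coeff 0 P • ((L ^ k) q : MvPolynomial (Fin N) ℂ) := by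
    intro k
    induction k with
    | zero =>
      change specL 0 (inX (q : MvPolynomial (Fin N) ℂ) * P) = _
      rw [map_mul, specL_inX, hP.specL_zero, mul_comm, ← smul_eq_C_mul]
      rfl
    | succ k ih =>
      refine mul_left_cancel₀ A.poly_ne_zero ?_
      have h := congrArg (specL 0) (hU k)
      rw [specL_zero_cmX, ih, map_smul, map_mul, specL_inX, ← hL.poly_mul] at h
      rw [← h, pow_succ', Module.End.mul_apply, mul_smul_comm]
  obtain ⟨d, hd⟩ := exists_mem_degLT 1 (q : MvPolynomial (Fin N) ℂ)
  -- Larger than every order of differentiation in `D`, so that Taylor polynomials may replace the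
  -- Gaussian, and long enough to contain the whole series for `q`.
  set K := max d (D.num.support.sup (fun ν => ∑ j, ν j) + 1) with hK
  have hν : ∀ ν ∈ D.num.support, ∑ j, ν j < K := fun ν h =>
    lt_of_le_of_lt (Finset.le_sup (f := fun ν : Fin N →₀ ℕ => ∑ j, ν j) h) (by omega)
  -- The Taylor polynomial is centred at the value `l²` of the very point of evaluation, whence the
  -- powers of `-(l ⬝ᵥ l)`; at the origin only the terms `m = k` survive.
  set Γ : (Fin N → ℂ) → ℂ := fun l => (∑ k ∈ Finset.range (K + 1), ∑ m ∈ Finset.range (k + 1),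
    gaussCoeff k * ((-(l ⬝ᵥ l)) ^ (k - m) * (k.choose m : ℂ)) * eval (Sum.elim x l) (U m)) *
      Complex.exp (x ⬝ᵥ l - 1 / 2 * (l ⬝ᵥ l)) with hΓ
  have hfun : (fun l => φ x l * Complex.exp (-(l ⬝ᵥ l) / 2)) =
      expFun (linForm x - C (1 / 2) * normSqPoly N) (specX x P) := by
    funext l
    rw [hφ, expFun, eval_specX, map_sub, map_mul, eval_linForm, eval_normSqPoly, eval_C, mul_assoc,
      ← Complex.exp_add]
    congr 2
    ring
  have hop : ∀ l ∈ A.regular,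
      A.applyOp D (fun l => φ x l * Complex.exp (-(l ⬝ᵥ l) / 2)) l = Γ l := by
    intro l hl
    have hl' : eval l A.poly ≠ 0 := hl
    have h1 : (D.num.sum fun ν a => eval l a *
        multiDeriv ν (fun l => φ x l * Complex.exp (-(l ⬝ᵥ l) / 2)) l) =
        eval (Sum.elim x l) (opL D.num (gaussTrunc N (l ⬝ᵥ l) (K + 1) * P)) *
          Complex.exp (x ⬝ᵥ l - 1 / 2 * (l ⬝ᵥ l)) := by
      rw [opL, Finsupp.sum, Finsupp.sum, map_sum, Finset.sum_mul]
      refine Finset.sum_congr rfl fun ν hν' => ?_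
      rw [hfun, multiDeriv_expFun, expFun, twistMulti_specX, eval_specX,
        eval_opPow_dG x l P ν (hν ν hν'), map_sub, map_mul (eval l), eval_linForm, eval_normSqPoly,
        eval_C, map_mul (eval (Sum.elim x l)), eval_inL]
      ring
    rw [applyOp, h1, hP.opL_gaussTrunc_mul h0 hU, map_mul, eval_inL, map_pow, hΓ]
    simp only [map_sum, smul_eval]
    field_simp
  have hcont : Continuous Γ := by
    have hdot : Continuous fun l : Fin N → ℂ => l ⬝ᵥ l := by
      unfold dotProduct; fun_prop
    have hdot' : Continuous fun l : Fin N → ℂ => x ⬝ᵥ l := by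
      unfold dotProduct; fun_prop
    have hev : ∀ m, Continuous fun l : Fin N → ℂ => eval (Sum.elim x l) (U m) := fun m => by
      have : (fun l : Fin N → ℂ => eval (Sum.elim x l) (U m)) = fun l => eval l (specX x (U m)) :=
        funext fun l => (eval_specX x l _).symm
      rw [this]
      exact MvPolynomial.continuous_eval _
    refine Continuous.mul (continuous_finsetSum _ fun k _ => continuous_finsetSum _ fun m _ => ?_)
      (Complex.continuous_exp.comp (hdot'.sub (continuous_const.mul hdot)))
    exact (continuous_const.mul ((hdot.neg.pow _).mul continuous_const)).mul (hev m)
  have hΓ0 : Γ 0 = coeff 0 P * eval x (hL.expNegLinear q : MvPolynomial (Fin N) ℂ) := by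
    have h1 : ∀ k, ∑ m ∈ Finset.range (k + 1), gaussCoeff k *
        ((-((0 : Fin N → ℂ) ⬝ᵥ 0)) ^ (k - m) * (k.choose m : ℂ)) * eval (Sum.elim x 0) (U m) =
        coeff 0 P * (gaussCoeff k * eval x ((L ^ k) q : MvPolynomial (Fin N) ℂ)) := by
      intro k
      rw [Finset.sum_eq_single k]
      · rw [Nat.sub_self, pow_zero, Nat.choose_self, ← eval_specL, hspec, smul_eval]
        push_cast
        ring
      · intro m hm hmk
        have : k - m ≠ 0 := by
          have := Finset.mem_range.1 hm
          omega
        rw [dotProduct_zero, neg_zero, zero_pow this]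
        ring
      · simp
    rw [hL.expNegLinear_eq hd (K := K + 1) (by omega), Submodule.coe_sum, map_sum, Finset.mul_sum,
      hΓ]
    simp only [h1]
    simp only [Submodule.coe_smul, smul_eval, dotProduct_zero, mul_zero, sub_zero,
      Complex.exp_zero, mul_one]
  rw [← hΓ0]
  refine ((hcont.tendsto 0).mono_left nhdsWithin_le_nhds).congr' ?_
  filter_upwards [self_mem_nhdsWithin] with l hl
  exact (hop l hl).symm

end HyperplaneConfig

end

theorem proposition4p2 {N : ℕ} (A : HyperplaneConfig N)
    (φ : (Fin N → ℂ) → (Fin N → ℂ) → ℂ) (hφ : A.IsBakerAkhiezer φ) (h0 : φ 0 0 ≠ 0) :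
    ∃ χ : A.quasiInvariants →ₗ[ℂ] A.quasiInvariants,
      -- `χ q` is the polynomial `H_q`, which is well defined
      (∀ (q : A.quasiInvariants) (h : (Fin N → ℂ) → ℂ),
        A.IsHermite φ q h ↔ h = fun x => MvPolynomial.eval x (χ q : MvPolynomial (Fin N) ℂ)) ∧
      -- `H_q` is an eigenfunction with eigenvalue `-d` for homogeneous `q` of degree `d`
      (∀ (d : ℕ) (q : A.quasiInvariants), (q : MvPolynomial (Fin N) ℂ).IsHomogeneous d →
        A.IsEigen (-(d : ℂ)) (χ q) ∧ (q ≠ 0 → χ q ≠ 0)) ∧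
      -- the `H_{q_i}` form an eigenbasis for every homogeneous basis `q_i`
      (∀ (ι : Type*) (b : Module.Basis ι ℂ A.quasiInvariants) (d : ι → ℕ),
        (∀ i, (b i : MvPolynomial (Fin N) ℂ).IsHomogeneous (d i)) →
        ∃ b' : Module.Basis ι ℂ A.quasiInvariants,
          ∀ i, b' i = χ (b i) ∧ A.IsEigen (-(d i : ℂ)) (b' i)) := by
  obtain ⟨P, hPφ, hlow⟩ := A.exists_polynomial hφ
  have hc : φ 0 0 = coeff 0 P := by
    rw [hPφ, dotProduct_zero, Complex.exp_zero, mul_one]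
    refine eval_eq_coeff_zero fun m _ hm => ?_
    obtain ⟨i, hi⟩ := Finsupp.ne_iff.1 hm
    exact ⟨i, by cases i <;> rfl, hi⟩
  have hP : A.IsBAPoly P :=
    ⟨hlow, HyperplaneConfig.mem_quasiX_of_isBakerAkhiezer hφ hPφ, hc ▸ h0⟩
  obtain ⟨L, hL⟩ := hP.exists_isCmOperator
  have hlim : ∀ (q : A.quasiInvariants) (x : Fin N → ℂ) (D : DiffOp N),
      A.IsQuantumIntegral φ q D →
      Tendsto (fun l => (φ 0 0)⁻¹ *
        A.applyOp D (fun l => φ x l * Complex.exp (-(l ⬝ᵥ l) / 2)) l) (𝓝[A.regular] 0)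
        (𝓝 (eval x (hL.expNegLinear q : MvPolynomial (Fin N) ℂ))) := by
    intro q x D hD
    have h := (hP.tendsto_applyOp hPφ hL q hD x).const_mul (φ 0 0)⁻¹
    rw [hc] at h ⊢
    rwa [inv_mul_cancel_left₀ hP.ne] at h
  have heig : ∀ (d : ℕ) (q : A.quasiInvariants), (q : MvPolynomial (Fin N) ℂ).IsHomogeneous d →
      A.IsEigen (-(d : ℂ)) (hL.expNegLinear q) := fun d q hq =>
    HyperplaneConfig.isEigen_of_cmPoly (hL.cmPoly_expNegLinear hq)
  -- The origin is a limit of regular points, so the value of the pairing is unique.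
  have hne : (𝓝[A.regular] (0 : Fin N → ℂ)).NeBot :=
    mem_closure_iff_nhdsWithin_neBot.1 (A.dense_regular 0)
  refine ⟨hL.expNegLinear, fun q h => ⟨fun hh => ?_, ?_⟩, fun d q hq => ⟨heig d q hq, ?_⟩,
    fun ι b d hb => ?_⟩
  · funext x
    obtain ⟨D, hD, ht⟩ := hh x
    exact tendsto_nhds_unique ht (hlim q x D hD)
  · rintro rfl x
    -- Existence of `L_q`: its numerators and its pole order come from generating `q(x) φ` out of
    -- `φ`.
    obtain ⟨p, a, ha⟩ := hP.exists_opL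
      (HyperplaneConfig.inX_mul_mem_quasiX q.2 hP.quasi)
    have hD : A.IsQuantumIntegral φ q ⟨a, p⟩ :=
      (hP.isQuantumIntegral_iff hPφ q _).2 ha.symm
    exact ⟨⟨a, p⟩, hD, hlim q x _ hD⟩
  · exact fun hq0 => (map_ne_zero_iff _ hL.expNegLinear_bijective.1).2 hq0
  · refine ⟨b.map (LinearEquiv.ofBijective _ hL.expNegLinear_bijective), fun i => ?_⟩
    rw [Module.Basis.map_apply, LinearEquiv.ofBijective_apply]
    exact ⟨rfl, heig (d i) (b i) (hb i)⟩
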